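/- Let $p,q\in L_2(0,\pi)$ be real valued, $h_1,h_2\in\mathbb R$, $h_2>0$, and consider the boundary value problem $$By'+\Omega(x)y=\lambda y\quad(0<x<\pi),\qquad y_1(0)=0,\qquad (\lambda+h_1)y_1(\pi)+h_2y_2(\pi)=0,$$ $$B=\begin{pmatrix}0&1\\-1&0\end{pmatrix},\qquad \Omega(x)=\begin{pmatrix}p(x)&q(x)\\q(x)&-p(x)\end{pmatrix},$$ where solutions are absolutely continuous on $[0,\pi]$ and satisfy the system almost everywhere. For each $\lambda\in\mathbb C$ there is a solution $\varphi(x,\lambda)$ of the system with $\varphi(0,\lambda)=(0,-1)^T$. The eigenvalues of the problem can be listed, each once, as a strictly increasing sequence of real numbers $(\lambda_n)_{n\in\mathbb Z}$. Put $\varphi_0(x,\lambda)=(\sin\lambda x,-\cos\lambda x)^T$ and $$\alpha_n=\int_0^\pi\bigl(|\varphi_1(x,\lambda_n)|^2+|\varphi_2(x,\lambda_n)|^2\bigr)dx+\frac1{h_2}|\varphi_1(\pi,\lambda_n)|^2 .$$ There is a transformation kernel $K(x,t)$, that is, a $2\times2$ matrix function such that for every fixed $x\in[0,\pi]$ the entries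 of $K(x,\cdot)$ lie in $L_2(0,x)$ and $$\varphi(x,\lambda)=\varphi_0(x,\lambda)+\int_0^xK(x,t)\varphi_0(t,\lambda)\,dt\qquad\text{for all }\lambda\in\mathbb C .$$ For every strictly increasing numbering $(\lambda_n)_{n\in\mathbb Z}$ of the eigenvalues, the series $$F(x,t)=\sum_{n=-\infty}^{\infty}\Bigl[\frac1{\alpha_n}\varphi_0(x,\lambda_n)\varphi_0(t,\lambda_n)^T-\frac1\pi\varphi_0(x,n)\varphi_0(t,n)^T\Bigr]$$ converges in the following sense: there is a measurable $2\times2$ matrix function $F$ on $(0,\pi)^2$, defined also for every $x\in[0,\pi]$, such that for each fixed $x\in[0,\pi]$ the entries of $F(x,\cdot)$ lie in $L_2(0,\pi)$ and are the weak limits in $L_2(0,\pi)$, as $N\to\infty$, of the entries of the partial sums over $-N\le n\le N$. For every such $F$, every transformation kernel $K$ and each fixed $x\in(0,\pi]$, $$F(x,t)+K(x,t)+\int_0^xK(x,\xi)F(\xi,t)\,d\xi=0\qquad\text{for almost every }t\in(0,x),$$ the integrand being integrable on $(0,x)$ for almost every $t\in(0,x)$. -/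

import Mathlib

open Real Set Filter Topology MeasureTheory

noncomputable section

namespace DiracBVP

/-- The matrix `B` of the Dirac system. -/
def B : Matrix (Fin 2) (Fin 2) ℂ := !![0, 1; -1, 0]

/-- The potential matrix `Ω(x)` with real entries `p`, `q`. -/
def Omega (p q : ℝ → ℝ) (x : ℝ) : Matrix (Fin 2) (Fin 2) ℂ :=
  !![(p x : ℂ), (q x : ℂ); (q x : ℂ), -(p x : ℂ)]

/-- `y` is a (Carathéodory) solution of `B y' + Ω(x) y = z y` on `(0, π)`: it is absolutely
continuous on `[0, π]` and satisfies the system almost everywhere. -/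
def IsSolution (p q : ℝ → ℝ) (z : ℂ) (y : ℝ → Fin 2 → ℂ) : Prop :=
  AbsolutelyContinuousOnInterval y 0 π ∧
    ∀ᵐ x ∂(volume.restrict (Ioo 0 π)), DifferentiableAt ℝ y x ∧
      B.mulVec (deriv y x) + (Omega p q x).mulVec (y x) = z • y x

/-- `z` is an eigenvalue of the boundary value problem with `y₁(0) = 0` and
`(z + h₁) y₁(π) + h₂ y₂(π) = 0`. -/
def IsEigenvalue (p q : ℝ → ℝ) (h₁ h₂ : ℝ) (z : ℂ) : Prop :=
  ∃ y : ℝ → Fin 2 → ℂ, IsSolution p q z y ∧ y 0 0 = 0 ∧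
    (z + (h₁ : ℂ)) * y π 0 + (h₂ : ℂ) * y π 1 = 0 ∧ ∃ x ∈ Icc 0 π, y x ≠ 0

/-- `φ(x, z)` is the solution with `φ(0, z) = (0, -1)ᵀ`, for every complex `z`
(this determines `φ(x, z)` for `x ∈ [0, π]`). -/
def IsPhi (p q : ℝ → ℝ) (φ : ℝ → ℂ → Fin 2 → ℂ) : Prop :=
  ∀ z : ℂ, IsSolution p q z (fun x => φ x z) ∧ φ 0 z = ![0, -1]

/-- The solution `φ₀(x, z) = (sin zx, -cos zx)ᵀ` of the system without potential. -/
def phi0 (x : ℝ) (z : ℂ) : Fin 2 → ℂ :=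
  ![Complex.sin (z * (x : ℂ)), -Complex.cos (z * (x : ℂ))]

/-- `K` is the kernel of the transformation operator: for each fixed `x ∈ [0, π]` its entries
are square integrable in `t` on `(0, x)`, and
`φ(x, z) = φ₀(x, z) + ∫₀ˣ K(x, t) φ₀(t, z) dt` for every complex `z`
(this determines `K(x, t)` for almost every `t ∈ (0, x)`). -/
def IsTransformationKernel (φ : ℝ → ℂ → Fin 2 → ℂ)
    (K : ℝ → ℝ → Matrix (Fin 2) (Fin 2) ℂ) : Prop :=
  ∀ x ∈ Icc 0 π,
    (∀ i j, MemLp (fun t => K x t i j) 2 (volume.restrict (Ioo 0 x))) ∧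
    ∀ z : ℂ, φ x z = phi0 x z + ∫ t in (0 : ℝ)..x, (K x t).mulVec (phi0 t z)

/-- `ev` lists all (complex) eigenvalues of the problem, each exactly once and in increasing
order, as real numbers indexed by the integers. -/
def IsEigenvalueEnumeration (p q : ℝ → ℝ) (h₁ h₂ : ℝ) (ev : ℤ → ℝ) : Prop :=
  StrictMono ev ∧ ∀ z : ℂ, IsEigenvalue p q h₁ h₂ z ↔ ∃ n : ℤ, z = (ev n : ℂ)

/-- The normalizing number `α` belonging to the real eigenvalue `μ`. -/
def normalizingNumber (φ : ℝ → ℂ → Fin 2 → ℂ) (h₂ : ℝ) (μ : ℝ) : ℝ :=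
  (∫ x in (0 : ℝ)..π, (‖φ x (μ : ℂ) 0‖ ^ 2 + ‖φ x (μ : ℂ) 1‖ ^ 2)) +
    1 / h₂ * ‖φ π (μ : ℂ) 0‖ ^ 2

/-- The partial sum over `-N ≤ n ≤ N` of
`∑ [α_n⁻¹ φ₀(x, λ_n) φ₀(t, λ_n)ᵀ - π⁻¹ φ₀(x, n) φ₀(t, n)ᵀ]`. -/
def partialF (φ : ℝ → ℂ → Fin 2 → ℂ) (h₂ : ℝ) (ev : ℤ → ℝ) (N : ℕ) (x t : ℝ) :
    Matrix (Fin 2) (Fin 2) ℂ :=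
  ∑ n ∈ Finset.Icc (-(N : ℤ)) (N : ℤ),
    ((1 / (normalizingNumber φ h₂ (ev n) : ℂ)) •
        Matrix.vecMulVec (phi0 x (ev n : ℂ)) (phi0 t (ev n : ℂ)) -
      (1 / (π : ℂ)) • Matrix.vecMulVec (phi0 x (n : ℂ)) (phi0 t (n : ℂ)))

/-- `F(x, t)` is the sum of the series: `F` is jointly measurable on the square, and for each
fixed `x ∈ [0, π]` the entries of `F(x, ·)` are square integrable on `(0, π)` and are the weak
limits in `L²(0, π)` of those of the symmetric partial sums. -/
def IsSpectralKernel (φ : ℝ → ℂ → Fin 2 → ℂ) (h₂ : ℝ) (ev : ℤ → ℝ)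
    (F : ℝ → ℝ → Matrix (Fin 2) (Fin 2) ℂ) : Prop :=
  (∀ i j, AEStronglyMeasurable (fun w : ℝ × ℝ => F w.1 w.2 i j)
    (volume.restrict (Ioo 0 π ×ˢ Ioo 0 π))) ∧
  ∀ x ∈ Icc 0 π, ∀ i j,
    MemLp (fun t => F x t i j) 2 (volume.restrict (Ioo 0 π)) ∧
    ∀ g : ℝ → ℂ, MemLp g 2 (volume.restrict (Ioo 0 π)) →
      Tendsto (fun N : ℕ => ∫ t in (0 : ℝ)..π, partialF φ h₂ ev N x t i j * g t) atTop
        (𝓝 (∫ t in (0 : ℝ)..π, F x t i j * g t))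

/-- The matrix equation `F(x,t) + K(x,t) + ∫₀ˣ K(x,ξ) F(ξ,t) dξ = 0` at the point `(x, t)`,
including the integrability of the integrand. -/
def MainEquation (F K : ℝ → ℝ → Matrix (Fin 2) (Fin 2) ℂ) (x t : ℝ) : Prop :=
  (∀ i j, IntervalIntegrable (fun ξ => (K x ξ * F ξ t) i j) volume 0 x) ∧
  F x t + K x t + Matrix.of (fun i j => ∫ ξ in (0 : ℝ)..x, (K x ξ * F ξ t) i j) = 0

end DiracBVP

end

/-! The equation is tested against a smooth `g` supported in `(0, x)`, placed in component `j`. Put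
`ĝ(z) = ∫ φ₀_j(t, z) g(t) dt` (`phi0Transform`). Fourier inversion for the free system, combined
with the weak limit defining `F`, gives `∑ α_n⁻¹ φ₀_a(ξ, λ_n) ĝ(λ_n) = ∫ F_aj(ξ, t) g(t) dt + δ_aj
g(ξ)` (`IsSpectralKernel.hasSum_phi0`). Applying the transformation operator in `ξ` turns the left
side into `S(x) = ∑ α_n⁻¹ φ_i(x, λ_n) ĝ(λ_n)`, and `S(x) = 0` by causality: `ĝ(z)` is also `∫ φ(t,
z) · κ(t) dt` with `κ` supported in some `(0, b)`, `b < x`, so `S` is the eigenfunction expansion of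
`κ_i`, which is zero beyond `b` (`IsEigenvalueEnumeration.hasSum_phi_eq_zero`). Since `g(x) = 0`,
what remains is the main equation integrated against `g`. Fubini's theorem and the du Bois-Reymond
lemma remove the test function.

The transformation operator and its inverse come from duality, not from an explicit kernel. For the
amplitudes `-φ₂ ± iφ₁`, multiplication by `exp(izτ)` trades the spectral parameter for a variable
`τ`: every finite combination over `z` solves one transport system with coefficients built from `p`
and `q`. Energy estimates on a characteristic triangle bound `∑ c_z (φ - φ₀)(x, z)` by the `L²` norm
of `∑ c_z φ₀(·, z)` on `(0, x)`, and Grönwall's inequality reverses this to bound sums of `φ₀` by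
sums of `φ`. The Riesz theorem converts both inequalities into kernels (`IsPhi.exists_kernel_row`,
`IsPhi.exists_inverse_row`).

It follows that `φ(π, ·) - φ₀(π, ·)` is the Fourier transform of an `L²` function with compact
support. Hence the large eigenvalues are integers up to square summable errors, and so are the `α_n`
compared with `π`. The exponential sums behind `F` then converge weakly in `L²(-2π, 2π)`. The shifts
between index and nearest integer at the two ends may be arbitrary, since a shift only changes the
sums by a telescoping quantity (`exists_tendsto_sum_ft`).

Parseval's identity (`IsEigenvalueEnumeration.hasSum_expansion`) is the spectral theorem for a
compact symmetric resolvent on `L²(0, π)² ⊕ ℂ`, realised as `L²` of a measure with an atom of mass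
`1/h₂` carrying `y₁(π)`. -/

namespace DiracBVP

/-! ### Integral inequalities and absolutely continuous functions -/

/-- The Cauchy–Schwarz inequality for integrals. -/
theorem norm_integral_mul_sq_le {α : Type*} [MeasurableSpace α] {μ : Measure α} {f g : α → ℂ}
    (hf : MemLp f 2 μ) (hg : MemLp g 2 μ) :
    ‖∫ a, f a * g a ∂μ‖ ^ 2 ≤ (∫ a, ‖f a‖ ^ 2 ∂μ) * ∫ a, ‖g a‖ ^ 2 ∂μ := by
  have h2 : ENNReal.ofReal 2 = 2 := by norm_num
  have h := integral_mul_le_Lp_mul_Lq_of_nonneg (μ := μ) (p := 2) (q := 2)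
    (f := fun a => ‖f a‖) (g := fun a => ‖g a‖) Real.HolderConjugate.two_two
    (Eventually.of_forall fun _ => norm_nonneg _) (Eventually.of_forall fun _ => norm_nonneg _)
    (h2 ▸ hf.norm) (h2 ▸ hg.norm)
  have h1 : ‖∫ a, f a * g a ∂μ‖ ≤ ∫ a, ‖f a‖ * ‖g a‖ ∂μ := by
    refine (norm_integral_le_integral_norm _).trans (le_of_eq ?_)
    simp only [norm_mul]
  have hA : 0 ≤ ∫ a, ‖f a‖ ^ 2 ∂μ := integral_nonneg fun _ => by positivity
  have hB : 0 ≤ ∫ a, ‖g a‖ ^ 2 ∂μ := integral_nonneg fun _ => by positivity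
  have h3 := h1.trans h
  simp only [Real.rpow_two, ← Real.sqrt_eq_rpow] at h3
  calc ‖∫ a, f a * g a ∂μ‖ ^ 2
      ≤ (√(∫ a, ‖f a‖ ^ 2 ∂μ) * √(∫ a, ‖g a‖ ^ 2 ∂μ)) ^ 2 := by gcongr
    _ = _ := by rw [mul_pow, Real.sq_sqrt hA, Real.sq_sqrt hB]

/-- Grönwall's inequality in integral form. -/
theorem le_mul_exp_of_le_add_mul_integral {S : ℝ → ℝ} {L a b : ℝ} (hS : ContinuousOn S (Icc 0 L))
    (hb : 0 ≤ b) (h : ∀ x ∈ Icc 0 L, S x ≤ a + b * ∫ t in (0 : ℝ)..x, S t) :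
    ∀ x ∈ Icc 0 L, S x ≤ a * Real.exp (b * x) := by
  intro x hx
  have hL : (0 : ℝ) ≤ L := hx.1.trans hx.2
  set G : ℝ → ℝ := fun x => ∫ t in (0 : ℝ)..x, S t with hG
  have hint : IntervalIntegrable S volume 0 L := hS.intervalIntegrable_of_Icc hL
  have hGc : ContinuousOn G (Icc 0 L) := by
    have := intervalIntegral.continuousOn_primitive_interval' (a := (0 : ℝ)) hint (by simp)
    rwa [uIcc_of_le hL] at this
  have hGd : ∀ y ∈ Ioo 0 L, HasDerivAt G (S y) y := by
    intro y hy
    have hcont : ContinuousAt S y := hS.continuousAt (Icc_mem_nhds hy.1 hy.2)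
    refine intervalIntegral.integral_hasDerivAt_right
      (hint.mono_set ?_) ?_ hcont
    · rw [uIcc_of_le hy.1.le, uIcc_of_le hL]; exact Icc_subset_Icc_right hy.2.le
    · exact (hS.mono Ioo_subset_Icc_self).stronglyMeasurableAtFilter isOpen_Ioo y hy
  have hanti : AntitoneOn (fun y => Real.exp (-(b * y)) * (a + b * G y)) (Icc 0 L) := by
    refine antitoneOn_of_deriv_nonpos (convex_Icc 0 L) ?_ ?_ ?_
    · exact (by fun_prop : Continuous fun y : ℝ => Real.exp (-(b * y))).continuousOn.mul
        (continuousOn_const.add (continuousOn_const.mul hGc))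
    · rw [interior_Icc]; intro y hy
      have := hGd y hy
      exact DifferentiableAt.differentiableWithinAt (by
        have h1 := this.differentiableAt
        fun_prop)
    · rw [interior_Icc]; intro y hy
      have h1 : HasDerivAt (fun y => Real.exp (-(b * y)) * (a + b * G y))
          (Real.exp (-(b * y)) * (-(b * 1)) * (a + b * G y) +
            Real.exp (-(b * y)) * (b * S y)) y := by
        exact (((hasDerivAt_id y).const_mul b).neg.exp).mul
          (((hGd y hy).const_mul b).const_add a)
      rw [h1.deriv]
      have h2 := h y (Ioo_subset_Icc_self hy)
      have h3 : Real.exp (-(b * y)) * (-(b * 1)) * (a + b * G y) +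
            Real.exp (-(b * y)) * (b * S y) = Real.exp (-(b * y)) * b * (S y - (a + b * G y)) := by
        ring
      rw [h3]
      exact mul_nonpos_of_nonneg_of_nonpos (by positivity) (by simpa using h2)
  have h1 := hanti (left_mem_Icc.2 hL) hx hx.1
  simp only [hG, mul_zero, neg_zero, Real.exp_zero, one_mul, intervalIntegral.integral_same,
    add_zero] at h1
  refine (h x hx).trans ?_
  have h2 : a + b * G x = Real.exp (b * x) * (Real.exp (-(b * x)) * (a + b * G x)) := by
    rw [← mul_assoc, ← Real.exp_add]; simp
  have : a + b * G x ≤ Real.exp (b * x) * a := by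
    rw [h2]; gcongr
  linarith

/-- `y` is absolutely continuous on `[0, π]` and has the derivative `y'` almost everywhere. -/
def HasAEDeriv (y y' : ℝ → ℂ) : Prop :=
  AbsolutelyContinuousOnInterval y 0 π ∧ IntervalIntegrable y' volume 0 π ∧
    ∀ᵐ x : ℝ, x ∈ Ioo 0 π → HasDerivAt y (y' x) x

theorem _root_.LipschitzWith.comp_absolutelyContinuousOnInterval {X Y : Type*}
    [PseudoMetricSpace X] [PseudoMetricSpace Y] {f : ℝ → X} {g : X → Y} {a b : ℝ} {C : NNReal}
    (hg : LipschitzWith C g) (hf : AbsolutelyContinuousOnInterval f a b) :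
    AbsolutelyContinuousOnInterval (fun x => g (f x)) a b := by
  have h0 : Tendsto (fun E : ℕ × (ℕ → ℝ × ℝ) => (C : ℝ) * ∑ i ∈ Finset.range E.1,
      dist (f (E.2 i).1) (f (E.2 i).2))
      (AbsolutelyContinuousOnInterval.totalLengthFilter ⊓
        𝓟 (AbsolutelyContinuousOnInterval.disjWithin a b)) (𝓝 0) := by
    simpa using Tendsto.const_mul (C : ℝ) hf
  refine squeeze_zero (fun t => Finset.sum_nonneg fun i _ => dist_nonneg) (fun t => ?_) h0
  rw [Finset.mul_sum]
  exact Finset.sum_le_sum fun i _ => hg.dist_le_mul _ _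

theorem _root_.IntervalIntegrable.absolutelyContinuousOnInterval_integral_complex {f : ℝ → ℂ}
    {a b c : ℝ} (h : IntervalIntegrable f volume a b) (hc : c ∈ uIcc a b) :
    AbsolutelyContinuousOnInterval (fun x => ∫ v in c..x, f v) a b := by
  have hre : IntervalIntegrable (fun x => (f x).re) volume a b :=
    ⟨h.1.re, h.2.re⟩
  have him : IntervalIntegrable (fun x => (f x).im) volume a b :=
    ⟨h.1.im, h.2.im⟩
  have h1 := Complex.isometry_ofReal.lipschitz.comp_absolutelyContinuousOnInterval
    (hre.absolutelyContinuousOnInterval_intervalIntegral hc)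
  have h2 := Complex.isometry_ofReal.lipschitz.comp_absolutelyContinuousOnInterval
    (him.absolutelyContinuousOnInterval_intervalIntegral hc)
  have h3 := h1.add (h2.const_smul Complex.I)
  have key : ∀ x ∈ uIcc a b, (∫ v in c..x, f v) =
      ((∫ v in c..x, (f v).re : ℝ) : ℂ) + Complex.I • ((∫ v in c..x, (f v).im : ℝ) : ℂ) := by
    intro x hx
    have hi : IntervalIntegrable f volume c x := h.mono_set (uIcc_subset_uIcc hc hx)
    rw [← intervalIntegral.integral_ofReal, ← intervalIntegral.integral_ofReal, smul_eq_mul,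
      ← intervalIntegral.integral_const_mul, ← intervalIntegral.integral_add]
    · refine intervalIntegral.integral_congr fun v _ => ?_
      simp only [mul_comm Complex.I, Complex.re_add_im]
    · exact ⟨hi.1.re.ofReal, hi.2.re.ofReal⟩
    · exact (IntervalIntegrable.const_mul (f := fun v => (((f v).im : ℝ) : ℂ))
        ⟨hi.1.im.ofReal, hi.2.im.ofReal⟩ Complex.I)
  -- Absolute continuity is a limit over families of subintervals of `[a, b]`, so it depends only on
  -- the values there.
  unfold AbsolutelyContinuousOnInterval at h3 ⊢
  refine h3.congr' ?_
  rw [EventuallyEq, eventually_inf_principal]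
  filter_upwards with E hE
  refine Finset.sum_congr rfl fun i hi => ?_
  have := hE.1 i (by simpa using hi)
  simp only [Pi.add_apply]
  rw [key _ this.1, key _ this.2]

theorem HasAEDeriv.continuousOn {y y' : ℝ → ℂ} (h : HasAEDeriv y y') :
    ContinuousOn y (Icc 0 π) := by
  simpa [uIcc_of_le Real.pi_pos.le] using h.1.continuousOn

theorem ae_mem_Ioo_of_mem_uIcc {P : ℝ → Prop} (h : ∀ᵐ x : ℝ, x ∈ Ioo 0 π → P x) :
    ∀ᵐ x : ℝ, x ∈ uIcc 0 π → P x := by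
  have h₁ : ∀ᵐ x : ℝ, x ≠ 0 := by simp [ae_iff, measure_singleton]
  have h₂ : ∀ᵐ x : ℝ, x ≠ π := by simp [ae_iff, measure_singleton]
  filter_upwards [h, h₁, h₂] with x hx h1 h2 hx3
  rw [uIcc_of_le Real.pi_pos.le] at hx3
  exact hx ⟨lt_of_le_of_ne hx3.1 (Ne.symm h1), lt_of_le_of_ne hx3.2 h2⟩

/-- The difference of `y` and the primitive of `y'` is absolutely continuous with zero derivative
almost everywhere, hence constant. This converts equations holding almost everywhere into integral
equations. -/
theorem HasAEDeriv.eq_add_integral {y y' : ℝ → ℂ} (h : HasAEDeriv y y') {x : ℝ}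
    (hx : x ∈ Icc 0 π) : y x = y 0 + ∫ t in (0 : ℝ)..x, y' t := by
  have h1 := h.2.1.absolutelyContinuousOnInterval_integral_complex (c := 0) (by simp)
  obtain ⟨C, hC⟩ := (h.1.sub h1).const_of_ae_hasDerivAt_zero (by
    filter_upwards [ae_mem_Ioo_of_mem_uIcc h.2.2, h.2.1.ae_hasDerivAt_integral]
      with x hx₁ hx₂ hx₃
    convert! (hx₁ hx₃).sub (hx₂ hx₃ 0 (by simp)) using 1
    simp)
  have e1 := hC 0 (by simp)
  have e2 := hC x (by rwa [uIcc_of_le Real.pi_pos.le])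
  simp only [Pi.sub_apply, intervalIntegral.integral_same, sub_zero] at e1 e2
  rw [e1, ← e2]; ring

theorem hasAEDeriv_of_eq_add_integral {y y' : ℝ → ℂ} (h' : IntervalIntegrable y' volume 0 π)
    (h : ∀ x ∈ Icc 0 π, y x = y 0 + ∫ t in (0 : ℝ)..x, y' t) : HasAEDeriv y y' := by
  refine ⟨?_, h', ?_⟩
  · have h1 := h'.absolutelyContinuousOnInterval_integral_complex (c := 0) (by simp)
    unfold AbsolutelyContinuousOnInterval at h1 ⊢
    refine h1.congr' ?_
    rw [EventuallyEq, eventually_inf_principal]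
    filter_upwards with E hE
    refine Finset.sum_congr rfl fun i hi => ?_
    have := hE.1 i (by simpa using hi)
    rw [uIcc_of_le Real.pi_pos.le] at this
    rw [h _ this.1, h _ this.2, dist_add_left]
  · filter_upwards [h'.ae_hasDerivAt_integral] with x hx hx1
    have h2 := hx (by rw [uIcc_of_le Real.pi_pos.le]; exact Ioo_subset_Icc_self hx1) 0 (by simp)
    refine (h2.const_add (y 0)).congr_of_eventuallyEq ?_
    filter_upwards [Icc_mem_nhds hx1.1 hx1.2] with z hz using h z hz

theorem HasAEDeriv.mul {y y' w w' : ℝ → ℂ} (hy : HasAEDeriv y y') (hw : HasAEDeriv w w') :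
    HasAEDeriv (fun x => y x * w x) (fun x => y' x * w x + y x * w' x) := by
  refine ⟨hy.1.smul hw.1, ?_, ?_⟩
  · exact (hy.2.1.mul_continuousOn hw.1.continuousOn).add
      (hw.2.1.continuousOn_mul hy.1.continuousOn)
  · filter_upwards [hy.2.2, hw.2.2] with x h1 h2 hx
    exact (h1 hx).mul (h2 hx)

theorem HasAEDeriv.add {y y' w w' : ℝ → ℂ} (hy : HasAEDeriv y y') (hw : HasAEDeriv w w') :
    HasAEDeriv (fun x => y x + w x) (fun x => y' x + w' x) := by
  refine ⟨hy.1.add hw.1, hy.2.1.add hw.2.1, ?_⟩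
  filter_upwards [hy.2.2, hw.2.2] with x h1 h2 hx
  exact (h1 hx).add (h2 hx)

theorem HasAEDeriv.const_mul {y y' : ℝ → ℂ} (c : ℂ) (hy : HasAEDeriv y y') :
    HasAEDeriv (fun x => c * y x) (fun x => c * y' x) := by
  refine ⟨hy.1.const_smul c, hy.2.1.const_mul c, ?_⟩
  filter_upwards [hy.2.2] with x h1 hx
  exact (h1 hx).const_mul c

theorem HasAEDeriv.sub {y y' w w' : ℝ → ℂ} (hy : HasAEDeriv y y') (hw : HasAEDeriv w w') :
    HasAEDeriv (fun x => y x - w x) (fun x => y' x - w' x) := by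
  simpa [sub_eq_add_neg] using hy.add (hw.const_mul (-1))

theorem HasAEDeriv.congr {y y' w' : ℝ → ℂ} (hy : HasAEDeriv y y')
    (h : ∀ᵐ x : ℝ, x ∈ Ioo 0 π → y' x = w' x) : HasAEDeriv y w' := by
  have h0 := ae_mem_Ioo_of_mem_uIcc h
  refine ⟨hy.1, ?_, ?_⟩
  · refine hy.2.1.congr_ae ?_
    rw [EventuallyEq, ae_restrict_iff' measurableSet_uIoc]
    filter_upwards [h0] with x hx hx1 using hx (uIoc_subset_uIcc hx1)
  · filter_upwards [hy.2.2, h] with x h1 h2 hx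
    rw [← h2 hx]; exact h1 hx

theorem HasAEDeriv.conj {y y' : ℝ → ℂ} (hy : HasAEDeriv y y') :
    HasAEDeriv (fun x => (starRingEnd ℂ) (y x)) (fun x => (starRingEnd ℂ) (y' x)) := by
  refine ⟨Complex.isometry_conj.lipschitz.comp_absolutelyContinuousOnInterval hy.1,
    ⟨?_, ?_⟩, ?_⟩
  · exact (Complex.conjCLE.toContinuousLinearMap.integrable_comp hy.2.1.1 :)
  · exact (Complex.conjCLE.toContinuousLinearMap.integrable_comp hy.2.1.2 :)
  · filter_upwards [hy.2.2] with x h1 hx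
    exact (Complex.conjCLE.toContinuousLinearMap.hasFDerivAt.comp_hasDerivAt x (h1 hx) :)

theorem hasAEDeriv_of_hasDerivAt {y y' : ℝ → ℂ} (h : ∀ x, HasDerivAt y (y' x) x)
    (h' : Continuous y') : HasAEDeriv y y' := by
  refine hasAEDeriv_of_eq_add_integral (h'.intervalIntegrable _ _) fun x _ => ?_
  rw [intervalIntegral.integral_eq_sub_of_hasDerivAt (fun t _ => h t) (h'.intervalIntegrable _ _)]
  ring

end DiracBVP

/-! ### Volterra equations and the Dirac system with square integrable coefficients -/

namespace DiracBVP

theorem _root_.MeasureTheory.MemLp.intervalIntegrable_Ioo {f : ℝ → ℂ} {a b : ℝ} (hab : a ≤ b)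
    (hf : MemLp f 2 (volume.restrict (Ioo a b))) : IntervalIntegrable f volume a b := by
  rw [intervalIntegrable_iff_integrableOn_Ioo_of_le hab]
  exact hf.integrable (by norm_num)

theorem _root_.ContinuousOn.memLp_restrict_Ioo {E : Type*} [NormedAddCommGroup E] {f : ℝ → E}
    {a b : ℝ} (hf : ContinuousOn f (Icc a b)) (p : ENNReal) :
    MemLp f p (volume.restrict (Ioo a b)) := by
  obtain ⟨C, hC⟩ := isCompact_Icc.exists_bound_of_continuousOn hf
  refine MemLp.of_bound ?_ C ?_
  · exact ((hf.mono Ioo_subset_Icc_self).aestronglyMeasurable measurableSet_Ioo)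
  · exact (ae_restrict_iff' measurableSet_Ioo).2
      (Eventually.of_forall fun x hx => hC x (Ioo_subset_Icc_self hx))

/-- Cauchy–Schwarz on a subinterval. -/
theorem norm_intervalIntegral_mul_sq_le {f g : ℝ → ℂ} {L x : ℝ} (hx : x ∈ Icc 0 L)
    (hf : MemLp f 2 (volume.restrict (Ioo 0 L))) (hg : MemLp g 2 (volume.restrict (Ioo 0 L))) :
    ‖∫ t in (0 : ℝ)..x, f t * g t‖ ^ 2 ≤
      (∫ t in Ioo 0 L, ‖f t‖ ^ 2) * ∫ t in (0 : ℝ)..x, ‖g t‖ ^ 2 := by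
  have hsub : Ioo 0 x ⊆ Ioo 0 L := Ioo_subset_Ioo_right hx.2
  have hm := Measure.restrict_mono hsub (le_refl (volume : Measure ℝ))
  rw [intervalIntegral.integral_of_le hx.1, intervalIntegral.integral_of_le hx.1,
    integral_Ioc_eq_integral_Ioo, integral_Ioc_eq_integral_Ioo]
  refine (norm_integral_mul_sq_le (hf.mono_measure hm) (hg.mono_measure hm)).trans ?_
  refine mul_le_mul_of_nonneg_right ?_ (integral_nonneg fun _ => by positivity)
  refine setIntegral_mono_set ?_ ?_ hsub.eventuallyLE
  · exact (memLp_two_iff_integrable_sq_norm hf.1).1 hf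
  · exact Eventually.of_forall fun _ => by positivity

section Volterra

variable {m : Fin 2 → Fin 2 → ℝ → ℂ}

theorem intervalIntegrable_volterra
    (hm : ∀ i j, MemLp (m i j) 2 (volume.restrict (Ioo 0 π))) {d : ℝ → Fin 2 → ℂ}
    (hd : ContinuousOn d (Icc 0 π)) (i : Fin 2) :
    IntervalIntegrable (fun t => ∑ j, m i j t * d t j) volume 0 π := by
  refine intervalIntegrable_iff.2 ?_
  refine integrable_finsetSum _ fun j _ => ?_
  have h1 := (hm i j).intervalIntegrable_Ioo Real.pi_pos.le
  refine intervalIntegrable_iff.1 (h1.mul_continuousOn ?_)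
  rw [uIcc_of_le Real.pi_pos.le]
  exact (continuous_apply j).comp_continuousOn hd

/-- Cauchy–Schwarz separates the coefficients, which are only in `L²`, from the continuous unknown.
Working with the squared norm leaves a plain integral on the right, ready for iteration and for
Grönwall's inequality. -/
theorem norm_volterra_sq_le (hm : ∀ i j, MemLp (m i j) 2 (volume.restrict (Ioo 0 π)))
    {d : ℝ → Fin 2 → ℂ} (hd : ContinuousOn d (Icc 0 π)) {x : ℝ} (hx : x ∈ Icc 0 π) :
    ‖fun i => ∫ t in (0 : ℝ)..x, ∑ j, m i j t * d t j‖ ^ 2 ≤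
      (∫ t in Ioo 0 π, (∑ i, ∑ j, ‖m i j t‖) ^ 2) * ∫ t in (0 : ℝ)..x, ‖d t‖ ^ 2 := by
  set F : ℝ → ℂ := fun t => ((∑ i, ∑ j, ‖m i j t‖ : ℝ) : ℂ)
  set G : ℝ → ℂ := fun t => ((‖d t‖ : ℝ) : ℂ)
  have hF : MemLp F 2 (volume.restrict (Ioo 0 π)) := by
    have : MemLp (fun t => ∑ i, ∑ j, ‖m i j t‖) 2 (volume.restrict (Ioo 0 π)) :=
      memLp_finsetSum _ fun i _ => memLp_finsetSum _ fun j _ => (hm i j).norm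
    exact this.ofReal
  have hG : MemLp G 2 (volume.restrict (Ioo 0 π)) := by
    have := (hd.norm.memLp_restrict_Ioo 2)
    exact this.ofReal
  have hFn : ∀ t, 0 ≤ ∑ i, ∑ j, ‖m i j t‖ := fun t => by positivity
  have key := norm_intervalIntegral_mul_sq_le hx hF hG
  have e1 : ∀ t, ‖F t‖ ^ 2 = (∑ i, ∑ j, ‖m i j t‖) ^ 2 := fun t => by
    simp only [F, Complex.norm_real, Real.norm_eq_abs, sq_abs]
  have e2 : ∀ t, ‖G t‖ ^ 2 = ‖d t‖ ^ 2 := fun t => by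
    simp only [G, Complex.norm_real, Real.norm_eq_abs, sq_abs]
  simp only [e1, e2] at key
  refine le_trans ?_ key
  gcongr
  rw [pi_norm_le_iff_of_nonneg (norm_nonneg _)]
  intro i
  have h0 : (∫ t in (0 : ℝ)..x, F t * G t) =
      ((∫ t in (0 : ℝ)..x, (∑ i, ∑ j, ‖m i j t‖) * ‖d t‖ : ℝ) : ℂ) := by
    rw [← intervalIntegral.integral_ofReal]
    simp [F, G]
  have hint : IntervalIntegrable (fun t => (∑ i, ∑ j, ‖m i j t‖) * ‖d t‖) volume 0 x := by
    have h1 : IntervalIntegrable (fun t => (∑ i, ∑ j, ‖m i j t‖)) volume 0 π := by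
      refine intervalIntegrable_iff.2 ?_
      refine integrable_finsetSum _ fun i _ => integrable_finsetSum _ fun j _ => ?_
      exact (intervalIntegrable_iff.1 ((hm i j).intervalIntegrable_Ioo Real.pi_pos.le)).norm
    have h2 := h1.mul_continuousOn (g := fun t => ‖d t‖)
      (by rw [uIcc_of_le Real.pi_pos.le]; exact hd.norm)
    exact h2.mono_set (by
      rw [uIcc_of_le hx.1, uIcc_of_le Real.pi_pos.le]; exact Icc_subset_Icc_right hx.2)
  rw [h0, Complex.norm_real, Real.norm_eq_abs, abs_of_nonneg
    (intervalIntegral.integral_nonneg hx.1 fun t _ => mul_nonneg (hFn t) (norm_nonneg _))]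
  refine intervalIntegral.norm_integral_le_of_norm_le hx.1 ?_ hint
  refine Eventually.of_forall fun t _ => ?_
  refine (norm_sum_le _ _).trans ?_
  calc ∑ j, ‖m i j t * d t j‖ ≤ ∑ j, ‖m i j t‖ * ‖d t‖ := by
        refine Finset.sum_le_sum fun j _ => ?_
        rw [norm_mul]
        gcongr
        exact norm_le_pi_norm _ _
    _ = (∑ j, ‖m i j t‖) * ‖d t‖ := by rw [Finset.sum_mul]
    _ ≤ _ := by
        refine mul_le_mul_of_nonneg_right ?_ (norm_nonneg _)
        exact Finset.single_le_sum (f := fun i => ∑ j, ‖m i j t‖)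
          (fun i _ => by positivity) (Finset.mem_univ i)

/-- Picard iteration: with `R` the squared `L²` norm of the coefficients, the `n`-th iterate
contracts squared distances at `x` by `(R x)ⁿ / n!`. Some iterate is therefore a contraction, and
its fixed point is also fixed by the map itself. -/
theorem exists_volterra (hm : ∀ i j, MemLp (m i j) 2 (volume.restrict (Ioo 0 π)))
    (c : Fin 2 → ℂ) : ∃ y : ℝ → Fin 2 → ℂ, Continuous y ∧
      ∀ x ∈ Icc 0 π, ∀ i, y x i = c i + ∫ t in (0 : ℝ)..x, ∑ j, m i j t * y t j := by
  have hpi := Real.pi_pos.le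
  set R := ∫ t in Ioo 0 π, (∑ i, ∑ j, ‖m i j t‖) ^ 2 with hR
  have hR0 : 0 ≤ R := integral_nonneg fun _ => by positivity
  let ext : C(Icc (0 : ℝ) π, Fin 2 → ℂ) → ℝ → Fin 2 → ℂ := fun f t => f (projIcc 0 π hpi t)
  have hext : ∀ f, Continuous (ext f) := fun f => f.continuous.comp continuous_projIcc
  let T : C(Icc (0 : ℝ) π, Fin 2 → ℂ) → C(Icc (0 : ℝ) π, Fin 2 → ℂ) := fun f =>
    ⟨fun x i => c i + ∫ t in (0 : ℝ)..x, ∑ j, m i j t * ext f t j, by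
      refine continuous_pi fun i => continuous_const.add ?_
      have h1 := intervalIntegral.continuousOn_primitive_interval' (a := (0 : ℝ))
        (intervalIntegrable_volterra hm (hext f).continuousOn i) (by simp)
      rw [uIcc_of_le hpi] at h1
      exact continuousOn_iff_continuous_domRestrict.1 h1⟩
  have hstep : ∀ f g : C(Icc (0 : ℝ) π, Fin 2 → ℂ), ∀ x : Icc (0 : ℝ) π,
      ‖T f x - T g x‖ ^ 2 ≤ R * ∫ t in (0 : ℝ)..x, ‖ext f t - ext g t‖ ^ 2 := by
    intro f g x
    have := norm_volterra_sq_le hm ((hext f).sub (hext g)).continuousOn x.2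
    convert! this using 3
    ext i
    have hs : ∀ f, IntervalIntegrable (fun t => ∑ j, m i j t * ext f t j) volume 0 x := fun f =>
      (intervalIntegrable_volterra hm (hext f).continuousOn i).mono_set (by
        rw [uIcc_of_le x.2.1, uIcc_of_le hpi]; exact Icc_subset_Icc_right x.2.2)
    simp only [T, ContinuousMap.coe_mk, Pi.sub_apply, add_sub_add_left_eq_sub]
    rw [← intervalIntegral.integral_sub (hs f) (hs g)]
    simp only [← Finset.sum_sub_distrib, mul_sub]
  have hiter : ∀ (n : ℕ) (f g : C(Icc (0 : ℝ) π, Fin 2 → ℂ)) (x : Icc (0 : ℝ) π),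
      ‖T^[n] f x - T^[n] g x‖ ^ 2 ≤ (R * x) ^ n / n.factorial * ‖f - g‖ ^ 2 := by
    intro n
    induction n with
    | zero =>
      intro f g x
      simp only [Function.iterate_zero, id_eq, pow_zero, Nat.factorial_zero, Nat.cast_one, div_one,
        one_mul]
      gcongr
      exact (f - g).norm_coe_le_norm x
    | succ n ih =>
      intro f g x
      rw [Function.iterate_succ_apply', Function.iterate_succ_apply']
      refine (hstep _ _ x).trans ?_
      have h1 : ∫ t in (0 : ℝ)..x, ‖ext (T^[n] f) t - ext (T^[n] g) t‖ ^ 2 ≤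
          ∫ t in (0 : ℝ)..x, (R * t) ^ n / n.factorial * ‖f - g‖ ^ 2 := by
        refine intervalIntegral.integral_mono_on x.2.1 ?_ ?_ ?_
        · exact (((hext _).sub (hext _)).norm.pow 2).intervalIntegrable _ _
        · exact Continuous.intervalIntegrable (by fun_prop) _ _
        · intro t ht
          have ht' : t ∈ Icc 0 π := ⟨ht.1, ht.2.trans x.2.2⟩
          have := ih f g ⟨t, ht'⟩
          simpa only [ext, projIcc_of_mem hpi ht'] using this
      have h2 : ∫ t in (0 : ℝ)..x, (R * t) ^ n / n.factorial * ‖f - g‖ ^ 2 =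
          R ^ n * x ^ (n + 1) / (n + 1).factorial * ‖f - g‖ ^ 2 := by
        rw [intervalIntegral.integral_mul_const]
        congr 1
        simp only [mul_pow, mul_div_assoc]
        rw [intervalIntegral.integral_const_mul, intervalIntegral.integral_div, integral_pow]
        rw [Nat.factorial_succ]
        push_cast
        have : (n.factorial : ℝ) ≠ 0 := by positivity
        field_simp
        simp
      rw [h2] at h1
      calc R * _ ≤ R * (R ^ n * x ^ (n + 1) / (n + 1).factorial * ‖f - g‖ ^ 2) := by gcongr
        _ = _ := by ring
  -- The estimate concerns squared distances, so `1/4` yields the Lipschitz constant `1/2`.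
  obtain ⟨n, hn⟩ : ∃ n : ℕ, (R * π) ^ n / n.factorial ≤ 1 / 4 :=
    ((FloorSemiring.tendsto_pow_div_factorial_atTop (R * π)).eventually
      (ge_mem_nhds (by norm_num : (0 : ℝ) < 1 / 4))).exists
  have hc : ContractingWith (1 / 2 : NNReal) (T^[n]) := by
    refine ⟨by norm_num, LipschitzWith.of_dist_le_mul fun f g => ?_⟩
    rw [ContinuousMap.dist_le (by positivity)]
    intro x
    rw [dist_eq_norm, dist_eq_norm]
    refine (abs_le_of_sq_le_sq' ?_ (by positivity)).2
    refine (hiter n f g x).trans ?_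
    have h1 : (R * x) ^ n / n.factorial ≤ 1 / 4 := by
      refine le_trans ?_ hn
      have h1 : 0 ≤ R * x := mul_nonneg hR0 x.2.1
      have := x.2.2
      gcongr
    calc _ ≤ 1 / 4 * ‖f - g‖ ^ 2 := by gcongr
      _ = _ := by push_cast; ring
  have hfix := hc.isFixedPt_fixedPoint_iterate
  set f := ContractingWith.fixedPoint _ hc
  refine ⟨ext f, hext f, fun x hx i => ?_⟩
  have h1 : T f ⟨x, hx⟩ i = f ⟨x, hx⟩ i := by rw [hfix]
  simp only [ext, projIcc_of_mem hpi hx]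
  exact h1.symm

theorem volterra_eq_zero (hm : ∀ i j, MemLp (m i j) 2 (volume.restrict (Ioo 0 π)))
    {d : ℝ → Fin 2 → ℂ} (hd : ContinuousOn d (Icc 0 π))
    (h : ∀ x ∈ Icc 0 π, ∀ i, d x i = ∫ t in (0 : ℝ)..x, ∑ j, m i j t * d t j) :
    ∀ x ∈ Icc 0 π, d x = 0 := by
  intro x hx
  have h1 := le_mul_exp_of_le_add_mul_integral (S := fun t => ‖d t‖ ^ 2) (a := 0)
    (b := ∫ t in Ioo 0 π, (∑ i, ∑ j, ‖m i j t‖) ^ 2) (hd.norm.pow 2) (integral_nonneg fun _ => by positivity) (fun x hx => by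
      rw [zero_add]
      have := norm_volterra_sq_le hm hd hx
      rwa [← funext (h x hx)] at this) x hx
  rw [zero_mul] at h1
  have h2 : ‖d x‖ = 0 := by
    have : ‖d x‖ ^ 2 = 0 := le_antisymm h1 (by positivity)
    simpa using this
  exact norm_eq_zero.1 h2

end Volterra

section System

variable {p q : ℝ → ℝ} {z : ℂ} {y w : ℝ → Fin 2 → ℂ}

/-- The coefficients of the system solved for `y'`. -/
noncomputable def sysCoeff (p q : ℝ → ℝ) (z : ℂ) (i j : Fin 2) (x : ℝ) : ℂ :=
  !![(q x : ℂ), -(p x + z); z - p x, -(q x : ℂ)] i j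

theorem memLp_sysCoeff (hp : MemLp p 2 (volume.restrict (Ioo 0 π)))
    (hq : MemLp q 2 (volume.restrict (Ioo 0 π))) (z : ℂ) (i j : Fin 2) :
    MemLp (sysCoeff p q z i j) 2 (volume.restrict (Ioo 0 π)) := by
  have hp' : MemLp (fun x => (p x : ℂ)) 2 (volume.restrict (Ioo 0 π)) := hp.ofReal
  have hq' : MemLp (fun x => (q x : ℂ)) 2 (volume.restrict (Ioo 0 π)) := hq.ofReal
  have hz : MemLp (fun _ : ℝ => z) 2 (volume.restrict (Ioo 0 π)) := memLp_const z
  fin_cases i <;> fin_cases j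
  · exact hq'
  · exact (hp'.add hz).neg
  · exact hz.sub hp'
  · exact hq'.neg

theorem _root_.AbsolutelyContinuousOnInterval.of_fin_two {y : ℝ → Fin 2 → ℂ} {a b : ℝ}
    (h0 : AbsolutelyContinuousOnInterval (fun x => y x 0) a b)
    (h1 : AbsolutelyContinuousOnInterval (fun x => y x 1) a b) :
    AbsolutelyContinuousOnInterval y a b := by
  unfold AbsolutelyContinuousOnInterval at h0 h1 ⊢
  have h3 := Tendsto.add h0 h1
  rw [add_zero] at h3
  refine squeeze_zero (fun t => Finset.sum_nonneg fun i _ => dist_nonneg) (fun t => ?_) h3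
  rw [← Finset.sum_add_distrib]
  refine Finset.sum_le_sum fun i _ => ?_
  refine (dist_pi_le_iff (by positivity)).2 fun j => ?_
  fin_cases j
  · exact le_add_of_nonneg_right dist_nonneg
  · exact le_add_of_nonneg_left dist_nonneg

/-- As `B⁻¹ = -B`, the system can be solved for `y'`. Afterwards each component is a scalar function
handled by the calculus of `HasAEDeriv`; the exceptional null sets of the two components merge into
one. -/
theorem isSolution_iff (hp : MemLp p 2 (volume.restrict (Ioo 0 π)))
    (hq : MemLp q 2 (volume.restrict (Ioo 0 π))) :
    IsSolution p q z y ↔ ContinuousOn y (Icc 0 π) ∧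
      ∀ i, HasAEDeriv (fun x => y x i) (fun x => ∑ j, sysCoeff p q z i j x * y x j) := by
  constructor
  · intro h
    have hc : ContinuousOn y (Icc 0 π) := by
      simpa [uIcc_of_le Real.pi_pos.le] using h.1.continuousOn
    refine ⟨hc, fun i => ⟨?_, intervalIntegrable_volterra (memLp_sysCoeff hp hq z) hc i, ?_⟩⟩
    · have h1 : LipschitzWith 1 (fun v : Fin 2 → ℂ => v i) := LipschitzWith.eval i
      exact h1.comp_absolutelyContinuousOnInterval h.1
    · filter_upwards [(ae_restrict_iff' measurableSet_Ioo).1 h.2] with x hx hx1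
      obtain ⟨h1, h2⟩ := hx hx1
      have h3 := hasDerivAt_pi.1 h1.hasDerivAt i
      convert! h3 using 1
      have e0 := congrFun h2 0
      have e1 := congrFun h2 1
      simp only [B, Omega, Pi.add_apply, Pi.smul_apply, Matrix.mulVec, dotProduct,
        Fin.sum_univ_two, Matrix.of_apply, Matrix.cons_val_zero, Matrix.cons_val_one,
        smul_eq_mul, Matrix.cons_val', Matrix.cons_val_fin_one] at e0 e1
      fin_cases i
      · simp [sysCoeff]; linear_combination e1
      · simp [sysCoeff]; linear_combination -e0
  · rintro ⟨hc, h⟩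
    refine ⟨?_, ?_⟩
    · exact .of_fin_two (h 0).1 (h 1).1
    · rw [ae_restrict_iff' measurableSet_Ioo]
      filter_upwards [(h 0).2.2, (h 1).2.2] with x h0 h1 hx
      have h2 : HasDerivAt y (fun i => ∑ j, sysCoeff p q z i j x * y x j) x := by
        rw [hasDerivAt_pi]
        intro i
        fin_cases i
        · exact h0 hx
        · exact h1 hx
      refine ⟨h2.differentiableAt, ?_⟩
      rw [h2.deriv]
      ext i
      fin_cases i <;> simp [B, Omega, sysCoeff, dotProduct, Fin.sum_univ_two] <;> ring

theorem exists_isSolution (hp : MemLp p 2 (volume.restrict (Ioo 0 π)))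
    (hq : MemLp q 2 (volume.restrict (Ioo 0 π))) (z : ℂ) (c : Fin 2 → ℂ) :
    ∃ y, IsSolution p q z y ∧ y 0 = c := by
  obtain ⟨y, hy, h⟩ := exists_volterra (memLp_sysCoeff hp hq z) c
  have h0 : y 0 = c := by ext i; simpa using h 0 (by simp [Real.pi_pos.le]) i
  refine ⟨y, (isSolution_iff hp hq).2 ⟨hy.continuousOn, fun i => ?_⟩, h0⟩
  refine hasAEDeriv_of_eq_add_integral
    (intervalIntegrable_volterra (memLp_sysCoeff hp hq z) hy.continuousOn i) fun x hx => ?_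
  rw [h x hx i, h0]

theorem IsSolution.sub (hp : MemLp p 2 (volume.restrict (Ioo 0 π)))
    (hq : MemLp q 2 (volume.restrict (Ioo 0 π))) (hy : IsSolution p q z y)
    (hw : IsSolution p q z w) : IsSolution p q z (fun x => y x - w x) := by
  rw [isSolution_iff hp hq] at hy hw ⊢
  refine ⟨hy.1.sub hw.1, fun i => ?_⟩
  convert! (hy.2 i).sub (hw.2 i) using 2 with x
  simp only [Fin.sum_univ_two, Pi.sub_apply]; ring

theorem IsSolution.smul (hp : MemLp p 2 (volume.restrict (Ioo 0 π)))
    (hq : MemLp q 2 (volume.restrict (Ioo 0 π))) (hy : IsSolution p q z y) (c : ℂ) :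
    IsSolution p q z (fun x => c • y x) := by
  rw [isSolution_iff hp hq] at hy ⊢
  refine ⟨hy.1.const_smul c, fun i => ?_⟩
  convert! (hy.2 i).const_mul c using 2 with x
  simp only [Fin.sum_univ_two, Pi.smul_apply, smul_eq_mul]; ring

/-- Because `p` and `q` are real, conjugation affects only the spectral parameter. At real
parameters this yields real solutions from real initial data. -/
theorem IsSolution.conj (hp : MemLp p 2 (volume.restrict (Ioo 0 π)))
    (hq : MemLp q 2 (volume.restrict (Ioo 0 π))) (hy : IsSolution p q z y) :
    IsSolution p q ((starRingEnd ℂ) z) (fun x i => (starRingEnd ℂ) (y x i)) := by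
  rw [isSolution_iff hp hq] at hy ⊢
  refine ⟨continuousOn_pi.2 fun i => ?_, fun i => ?_⟩
  · exact Complex.continuous_conj.comp_continuousOn ((continuous_apply i).comp_continuousOn hy.1)
  · convert! (hy.2 i).conj using 2 with x
    fin_cases i <;> simp [Fin.sum_univ_two, sysCoeff]

theorem IsSolution.eq_of_eq_zero (hp : MemLp p 2 (volume.restrict (Ioo 0 π)))
    (hq : MemLp q 2 (volume.restrict (Ioo 0 π))) (hy : IsSolution p q z y)
    (hw : IsSolution p q z w) (h0 : y 0 = w 0) : ∀ x ∈ Icc 0 π, y x = w x := by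
  have h := (isSolution_iff hp hq).1 (hy.sub hp hq hw)
  intro x hx
  have := volterra_eq_zero (memLp_sysCoeff hp hq z) h.1 (fun x hx i => by
    have := (h.2 i).eq_add_integral hx
    simpa [h0] using this) x hx
  exact sub_eq_zero.1 this

/-- Green's identity for two solutions with different parameters. -/
theorem IsSolution.green {ζ : ℂ} (hp : MemLp p 2 (volume.restrict (Ioo 0 π)))
    (hq : MemLp q 2 (volume.restrict (Ioo 0 π))) (hy : IsSolution p q z y)
    (hw : IsSolution p q ζ w) {x : ℝ} (hx : x ∈ Icc 0 π) :
    (z - ζ) * ∫ t in (0 : ℝ)..x, (y t 0 * w t 0 + y t 1 * w t 1) =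
      (y x 1 * w x 0 - y x 0 * w x 1) - (y 0 1 * w 0 0 - y 0 0 * w 0 1) := by
  have hy' := ((isSolution_iff hp hq).1 hy).2
  have hw' := ((isSolution_iff hp hq).1 hw).2
  -- In the derivative of the Wronskian the terms with `p` and `q` cancel, since `Ω` is symmetric;
  -- only the difference of the parameters survives.
  have h := (((hy' 1).mul (hw' 0)).sub ((hy' 0).mul (hw' 1))).eq_add_integral hx
  rw [h, add_sub_cancel_left, ← intervalIntegral.integral_const_mul]
  refine intervalIntegral.integral_congr fun t _ => ?_
  simp [sysCoeff, Fin.sum_univ_two]; ring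

theorem exists_isPhi (hp : MemLp p 2 (volume.restrict (Ioo 0 π)))
    (hq : MemLp q 2 (volume.restrict (Ioo 0 π))) : ∃ φ, IsPhi p q φ := by
  choose y hy using fun z => exists_isSolution hp hq z ![0, -1]
  exact ⟨fun x z => y z x, fun z => ⟨(hy z).1, (hy z).2⟩⟩

end System

end DiracBVP

/-! ### An energy estimate for a transport system on a characteristic triangle -/

namespace DiracBVP

/-- Interchange of the order of integration over a triangle. -/
theorem integral_integral_triangle_swap {k : ℝ → ℝ → ℝ} (hk : Continuous (Function.uncurry k))
    {x : ℝ} (hx : 0 ≤ x) :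
    ∫ u in (0 : ℝ)..x, ∫ v in (0 : ℝ)..u, k u v = ∫ v in (0 : ℝ)..x, ∫ u in v..x, k u v := by
  set F : ℝ → ℝ → ℝ := fun u v => {w : ℝ × ℝ | w.2 ≤ w.1}.indicator (Function.uncurry k) (u, v)
  have hms : MeasurableSet {w : ℝ × ℝ | w.2 ≤ w.1} :=
    (isClosed_le continuous_snd continuous_fst).measurableSet
  have hF : IntegrableOn (Function.uncurry F) (uIoc 0 x ×ˢ uIoc 0 x) := by
    refine Integrable.indicator ?_ hms
    have h1 : IntegrableOn (Function.uncurry k) (Icc (0 : ℝ) x ×ˢ Icc (0 : ℝ) x) :=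
      hk.continuousOn.integrableOn_compact (isCompact_Icc.prod isCompact_Icc)
    refine h1.mono_set (prod_mono ?_ ?_) <;>
    · rw [uIoc_of_le hx]; exact Ioc_subset_Icc_self
  have h0 := intervalIntegral_intervalIntegral_swap (F := F) (a := 0) (b := x) (c := 0) (d := x) hF
  have e1 : ∫ u in (0 : ℝ)..x, ∫ v in (0 : ℝ)..u, k u v =
      ∫ u in (0 : ℝ)..x, ∫ v in (0 : ℝ)..x, F u v := by
    refine intervalIntegral.integral_congr fun u hu => ?_
    rw [uIcc_of_le hx] at hu
    have i1 : IntervalIntegrable (k u) volume 0 u := by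
      exact (hk.comp (by fun_prop : Continuous fun v : ℝ => (u, v))).intervalIntegrable _ _
    have c1 : EqOn (k u) (F u) (uIoc 0 u) := by
      intro v hv
      rw [uIoc_of_le hu.1] at hv
      simp [F, hv.2]
    have c2 : EqOn (fun _ => (0 : ℝ)) (F u) (uIoc u x) := by
      intro v hv
      rw [uIoc_of_le hu.2] at hv
      simp [F, hv.1]
    have i2 : IntervalIntegrable (F u) volume 0 u := i1.congr c1
    have i3 : IntervalIntegrable (F u) volume u x :=
      (intervalIntegrable_const (c := (0 : ℝ))).congr c2
    change ∫ v in (0 : ℝ)..u, k u v = ∫ v in (0 : ℝ)..x, F u v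
    rw [← intervalIntegral.integral_add_adjacent_intervals i2 i3,
      ← intervalIntegral.integral_congr_ae (Eventually.of_forall c1),
      ← intervalIntegral.integral_congr_ae (Eventually.of_forall c2)]
    simp
  have e2 : ∫ v in (0 : ℝ)..x, ∫ u in v..x, k u v =
      ∫ v in (0 : ℝ)..x, ∫ u in (0 : ℝ)..x, F u v := by
    refine intervalIntegral.integral_congr_ae ?_
    refine Eventually.of_forall fun v hv => ?_
    rw [uIoc_of_le hx] at hv
    have i1 : IntervalIntegrable (fun u => k u v) volume v x := by
      exact (hk.comp (by fun_prop : Continuous fun u : ℝ => (u, v))).intervalIntegrable _ _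
    have c1 : EqOn (fun u => k u v) (fun u => F u v) (uIoc v x) := by
      intro u hu
      rw [uIoc_of_le hv.2] at hu
      simp [F, hu.1.le]
    have c2 : ∀ᵐ u : ℝ, u ∈ uIoc 0 v → 0 = F u v := by
      filter_upwards [(by simp [ae_iff, measure_singleton] : ∀ᵐ u : ℝ, u ≠ v)] with u hu hu1
      rw [uIoc_of_le hv.1.le] at hu1
      have : ¬ v ≤ u := not_le.2 (lt_of_le_of_ne hu1.2 hu)
      simp [F, this]
    have i2 : IntervalIntegrable (fun u => F u v) volume v x := i1.congr c1
    have i3 : IntervalIntegrable (fun u => F u v) volume 0 v :=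
      (intervalIntegrable_const (c := (0 : ℝ))).congr_ae
        ((ae_restrict_iff' measurableSet_uIoc).2 c2)
    rw [← intervalIntegral.integral_add_adjacent_intervals i3 i2,
      ← intervalIntegral.integral_congr_ae (Eventually.of_forall c1),
      ← intervalIntegral.integral_congr_ae c2]
    simp
  rw [e1, e2, h0]

theorem norm_add_sq_le_two (a b : ℂ) : ‖a + b‖ ^ 2 ≤ 2 * ‖a‖ ^ 2 + 2 * ‖b‖ ^ 2 := by
  have := norm_add_le a b
  have h2 : ‖a + b‖ ^ 2 ≤ (‖a‖ + ‖b‖) ^ 2 := by gcongr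
  nlinarith [sq_nonneg (‖a‖ - ‖b‖)]

theorem continuous_integral_symm {g : ℝ → ℝ → ℝ} (hg : Continuous (Function.uncurry g)) (x : ℝ) :
    Continuous fun v => ∫ σ in (-(x - v))..(x - v), g v σ := by
  have e : (fun v => ∫ σ in (-(x - v))..(x - v), g v σ) = fun v =>
      (∫ σ in (0 : ℝ)..(x - v), g v σ) - ∫ σ in (0 : ℝ)..(-(x - v)), g v σ := by
    ext v
    have := (hg.comp (by fun_prop : Continuous fun σ : ℝ => (v, σ)))
    exact (intervalIntegral.integral_interval_sub_left (this.intervalIntegrable _ _)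
      (this.intervalIntegrable _ _)).symm
  rw [e]
  exact (intervalIntegral.continuous_parametric_intervalIntegral_of_continuous hg
    (by fun_prop)).sub (intervalIntegral.continuous_parametric_intervalIntegral_of_continuous hg
    (by fun_prop))

/-- `L²` bound on a line segment for one transport equation. -/
theorem integral_norm_sq_transport_le {r f : ℝ → ℂ} {A G : ℝ → ℝ → ℂ}
    (hr : MemLp r 2 (volume.restrict (Ioo 0 π))) (hf : Continuous f)
    (hA : Continuous (Function.uncurry A)) (hG : Continuous (Function.uncurry G))
    (h : ∀ x ∈ Icc 0 π, ∀ τ, A x τ = f (τ + x) + ∫ v in (0 : ℝ)..x, r v * G v (τ + x - v))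
    {x u : ℝ} (hx : x ∈ Icc 0 π) (hu : u ∈ Icc 0 x) :
    ∫ τ in (-(x - u))..(x - u), ‖A u τ‖ ^ 2 ≤ 2 * (∫ s in (-x)..x, ‖f s‖ ^ 2) +
      2 * (∫ v in Ioo 0 π, ‖r v‖ ^ 2) *
        ∫ v in (0 : ℝ)..u, ∫ σ in (-(x - v))..(x - v), ‖G v σ‖ ^ 2 := by
  set R := ∫ v in Ioo 0 π, ‖r v‖ ^ 2
  have hR : 0 ≤ R := integral_nonneg fun _ => by positivity
  have huπ : u ∈ Icc 0 π := ⟨hu.1, hu.2.trans hx.2⟩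
  have hGc : ∀ τ, Continuous fun v => G v (τ + u - v) := fun τ =>
    hG.comp (by fun_prop : Continuous fun v : ℝ => (v, τ + u - v))
  have hGc2 : Continuous (Function.uncurry fun τ v => ‖G v (τ + u - v)‖ ^ 2) :=
    (hG.comp (by fun_prop : Continuous fun w : ℝ × ℝ => (w.2, w.1 + u - w.2))).norm.pow 2
  have hpt : ∀ τ, ‖A u τ‖ ^ 2 ≤ 2 * ‖f (τ + u)‖ ^ 2 +
      2 * R * ∫ v in (0 : ℝ)..u, ‖G v (τ + u - v)‖ ^ 2 := by
    intro τ
    rw [h u huπ τ]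
    refine (norm_add_sq_le_two _ _).trans ?_
    have := norm_intervalIntegral_mul_sq_le huπ hr ((hGc τ).continuousOn.memLp_restrict_Ioo 2)
    nlinarith
  have hle : -(x - u) ≤ x - u := by linarith [hu.2]
  have c1 : Continuous fun τ => ‖A u τ‖ ^ 2 :=
    (hA.comp (by fun_prop : Continuous fun τ : ℝ => (u, τ))).norm.pow 2
  have c2 : Continuous fun τ => 2 * ‖f (τ + u)‖ ^ 2 := by fun_prop
  have c3 : Continuous fun τ => ∫ v in (0 : ℝ)..u, ‖G v (τ + u - v)‖ ^ 2 :=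
    intervalIntegral.continuous_parametric_intervalIntegral_of_continuous' hGc2 0 u
  have c4 : Continuous fun τ => 2 * R * ∫ v in (0 : ℝ)..u, ‖G v (τ + u - v)‖ ^ 2 :=
    continuous_const.mul c3
  have h1 : ∫ τ in (-(x - u))..(x - u), ‖A u τ‖ ^ 2 ≤
      ∫ τ in (-(x - u))..(x - u), (2 * ‖f (τ + u)‖ ^ 2 +
        2 * R * ∫ v in (0 : ℝ)..u, ‖G v (τ + u - v)‖ ^ 2) :=
    intervalIntegral.integral_mono_on hle (c1.intervalIntegrable _ _)
      ((c2.add c4).intervalIntegrable _ _) fun τ _ => hpt τ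
  rw [intervalIntegral.integral_add (c2.intervalIntegrable _ _) (c4.intervalIntegrable _ _),
    intervalIntegral.integral_const_mul, intervalIntegral.integral_const_mul] at h1
  have h2 : ∫ τ in (-(x - u))..(x - u), ‖f (τ + u)‖ ^ 2 ≤ ∫ s in (-x)..x, ‖f s‖ ^ 2 := by
    rw [intervalIntegral.integral_comp_add_right (fun s => ‖f s‖ ^ 2)]
    refine intervalIntegral.integral_mono_interval ?_ ?_ ?_ ?_ ?_
    · linarith [hu.1]
    · linarith
    · linarith
    · exact Eventually.of_forall fun _ => by positivity
    · exact (hf.norm.pow 2).intervalIntegrable _ _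
  have h3 : ∫ τ in (-(x - u))..(x - u), ∫ v in (0 : ℝ)..u, ‖G v (τ + u - v)‖ ^ 2 ≤
      ∫ v in (0 : ℝ)..u, ∫ σ in (-(x - v))..(x - v), ‖G v σ‖ ^ 2 := by
    rw [intervalIntegral_intervalIntegral_swap (by
      exact (hGc2.continuousOn.integrableOn_compact
        (isCompact_uIcc.prod isCompact_uIcc)).mono_set
          (prod_mono uIoc_subset_uIcc uIoc_subset_uIcc))]
    refine intervalIntegral.integral_mono_on hu.1 ?_ ?_ ?_
    · refine Continuous.intervalIntegrable ?_ _ _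
      refine intervalIntegral.continuous_parametric_intervalIntegral_of_continuous' ?_ _ _
      exact hGc2.comp continuous_swap
    · refine Continuous.intervalIntegrable (continuous_integral_symm ?_ x) _ _
      exact hG.norm.pow 2
    · intro v hv
      have hg : Continuous fun σ => ‖G v σ‖ ^ 2 :=
        (hG.comp (by fun_prop : Continuous fun σ : ℝ => (v, σ))).norm.pow 2
      -- The shift by `u - v` carries the slice at height `u` of the triangle with vertex `(x, 0)`
      -- into its slice at height `v`.
      have e : ∀ τ, τ + u - v = τ + (u - v) := fun τ => by ring
      simp only [e]
      rw [intervalIntegral.integral_comp_add_right (fun s => ‖G v s‖ ^ 2)]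
      refine intervalIntegral.integral_mono_interval ?_ ?_ ?_ ?_ ?_
      · linarith [hv.2]
      · linarith
      · linarith
      · exact Eventually.of_forall fun _ => by positivity
      · exact hg.intervalIntegrable _ _
  nlinarith [mul_le_mul_of_nonneg_left h3 hR]

/-- The value at `(x, 0)` of a solution of the transport system differs from the free one by a
quantity controlled by the `L²` norm of the data on `(-x, x)`. -/
theorem norm_sub_sq_le_transport {r s f : ℝ → ℂ} {A G : ℝ → ℝ → ℂ}
    (hr : MemLp r 2 (volume.restrict (Ioo 0 π))) (hs : MemLp s 2 (volume.restrict (Ioo 0 π)))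
    (hf : Continuous f)
    (hA : Continuous (Function.uncurry A)) (hG : Continuous (Function.uncurry G))
    (h : ∀ x ∈ Icc 0 π, ∀ τ, A x τ = f (τ + x) + ∫ v in (0 : ℝ)..x, r v * G v (τ + x - v))
    (h' : ∀ x ∈ Icc 0 π, ∀ τ, G x τ = f (τ - x) + ∫ v in (0 : ℝ)..x, s v * A v (τ - x + v))
    {R : ℝ} (hrR : ∫ v in Ioo 0 π, ‖r v‖ ^ 2 ≤ R) (hsR : ∫ v in Ioo 0 π, ‖s v‖ ^ 2 ≤ R)
    {x : ℝ} (hx : x ∈ Icc 0 π) :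
    ‖A x 0 - f x‖ ^ 2 ≤ (R * (1 + π * R * (4 * Real.exp (2 * R * π)))) *
      ∫ t in (-x)..x, ‖f t‖ ^ 2 := by
  set N := ∫ t in (-x)..x, ‖f t‖ ^ 2 with hN
  have hN0 : 0 ≤ N := intervalIntegral.integral_nonneg (by linarith [hx.1]) fun _ _ => by positivity
  have hR : 0 ≤ R := le_trans (integral_nonneg fun _ => by positivity) hrR
  have hA2 : Continuous (Function.uncurry fun v σ => ‖A v σ‖ ^ 2) := hA.norm.pow 2
  have hG2 : Continuous (Function.uncurry fun v σ => ‖G v σ‖ ^ 2) := hG.norm.pow 2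
  -- These are energies on the slices of the triangle with base `(-x, x)` and vertex `(x, 0)`, the
  -- domain of dependence of the value at the vertex. Each is bounded by the data plus the integral
  -- of the other, so Grönwall's inequality applies to the sum.
  set SA : ℝ → ℝ := fun u => ∫ τ in (-(x - u))..(x - u), ‖A u τ‖ ^ 2
  set SG : ℝ → ℝ := fun u => ∫ τ in (-(x - u))..(x - u), ‖G u τ‖ ^ 2
  have hSA : Continuous SA := continuous_integral_symm hA2 x
  have hSG : Continuous SG := continuous_integral_symm hG2 x
  have nonneg : ∀ {g : ℝ → ℝ → ℂ} {u}, u ∈ Icc 0 x →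
      0 ≤ ∫ τ in (-(x - u))..(x - u), ‖g u τ‖ ^ 2 := fun {g u} hu =>
    intervalIntegral.integral_nonneg (by linarith [hu.2]) fun _ _ => by positivity
  have hSA0 : ∀ u ∈ Icc 0 x, 0 ≤ SA u := fun u hu => nonneg hu
  have hSG0 : ∀ u ∈ Icc 0 x, 0 ≤ SG u := fun u hu => nonneg hu
  have b1 : ∀ u ∈ Icc 0 x, SA u ≤ 2 * N + 2 * R * ∫ v in (0 : ℝ)..u, SG v := by
    intro u hu
    refine (integral_norm_sq_transport_le hr hf hA hG h hx hu).trans ?_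
    have : 0 ≤ ∫ v in (0 : ℝ)..u, SG v := intervalIntegral.integral_nonneg hu.1
      fun v hv => hSG0 v ⟨hv.1, hv.2.trans hu.2⟩
    gcongr
  have refl : ∀ (F : ℝ → ℝ) (c : ℝ), ∫ τ in (-c)..c, F (-τ) = ∫ τ in (-c)..c, F τ := by
    intro F c
    rw [intervalIntegral.integral_comp_neg]; simp
  have b2 : ∀ u ∈ Icc 0 x, SG u ≤ 2 * N + 2 * R * ∫ v in (0 : ℝ)..u, SA v := by
    intro u hu
    -- The reflection `τ ↦ -τ` interchanges the two directions of transport, so the estimate for `A`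
    -- also serves `G`.
    have := integral_norm_sq_transport_le (r := s) (f := fun t => f (-t))
      (A := fun x τ => G x (-τ)) (G := fun x τ => A x (-τ)) hs (by fun_prop)
      (hG.comp (by fun_prop : Continuous fun w : ℝ × ℝ => (w.1, -w.2)))
      (hA.comp (by fun_prop : Continuous fun w : ℝ × ℝ => (w.1, -w.2)))
      (fun x hx τ => by
        rw [h' x hx (-τ)]
        congr 1
        · congr 1; ring
        · refine intervalIntegral.integral_congr fun v _ => ?_
          congr 2; ring) hx hu
    simp only [refl (fun t => ‖f t‖ ^ 2), refl (fun t => ‖G u t‖ ^ 2),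
      fun v => refl (fun t => ‖A v t‖ ^ 2)] at this
    refine this.trans ?_
    have : 0 ≤ ∫ v in (0 : ℝ)..u, SA v := intervalIntegral.integral_nonneg hu.1
      fun v hv => hSA0 v ⟨hv.1, hv.2.trans hu.2⟩
    gcongr
  have gron := le_mul_exp_of_le_add_mul_integral (S := fun u => SA u + SG u) (L := x)
    (a := 4 * N) (b := 2 * R) (hSA.add hSG).continuousOn (by positivity) (fun u hu => by
      rw [intervalIntegral.integral_add (hSA.intervalIntegrable _ _) (hSG.intervalIntegrable _ _)]
      have := b1 u hu
      have := b2 u hu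
      linarith)
  have hSAle : ∀ u ∈ Icc 0 x, SA u ≤ 4 * N * Real.exp (2 * R * π) := by
    intro u hu
    have h1 := gron u hu
    have h2 := hSG0 u hu
    have h3 : Real.exp (2 * R * u) ≤ Real.exp (2 * R * π) := by
      have := hu.2.trans hx.2
      gcongr
    have h4 := mul_le_mul_of_nonneg_left h3 (by positivity : 0 ≤ 4 * N)
    linarith
  -- Only the trace of `G` on the edge `τ = x - v` of the triangle enters, and the slice energies do
  -- not see it. The second transport equation expresses this trace by `f` and by integrals of `A`
  -- along transversal characteristics; integrating over the edge turns these into an integral of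
  -- `A` over the whole triangle.
  have hdiff : A x 0 - f x = ∫ v in (0 : ℝ)..x, r v * G v (x - v) := by
    rw [h x hx 0]; simp
  have hGc : Continuous fun v => G v (x - v) :=
    hG.comp (by fun_prop : Continuous fun v : ℝ => (v, x - v))
  rw [hdiff]
  refine (norm_intervalIntegral_mul_sq_le hx hr (hGc.continuousOn.memLp_restrict_Ioo 2)).trans ?_
  have hk : Continuous (Function.uncurry fun u v => ‖A v (x - 2 * u + v)‖ ^ 2) :=
    (hA.comp (by fun_prop : Continuous fun w : ℝ × ℝ => (w.2, x - 2 * w.1 + w.2))).norm.pow 2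
  have hkc : Continuous fun u => ∫ v in (0 : ℝ)..u, ‖A v (x - 2 * u + v)‖ ^ 2 :=
    intervalIntegral.continuous_parametric_intervalIntegral_of_continuous hk continuous_id
  have hpt : ∀ u ∈ Icc 0 x, ‖G u (x - u)‖ ^ 2 ≤ 2 * ‖f (x - 2 * u)‖ ^ 2 +
      2 * R * ∫ v in (0 : ℝ)..u, ‖A v (x - 2 * u + v)‖ ^ 2 := by
    intro u hu
    have huπ : u ∈ Icc 0 π := ⟨hu.1, hu.2.trans hx.2⟩
    have hAc : Continuous fun v => A v (x - 2 * u + v) :=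
      hA.comp (by fun_prop : Continuous fun v : ℝ => (v, x - 2 * u + v))
    have e : x - u - u = x - 2 * u := by ring
    rw [h' u huπ (x - u), e]
    refine (norm_add_sq_le_two _ _).trans ?_
    have h1 := norm_intervalIntegral_mul_sq_le huπ hs (hAc.continuousOn.memLp_restrict_Ioo 2)
    have h2 : 0 ≤ ∫ v in (0 : ℝ)..u, ‖A v (x - 2 * u + v)‖ ^ 2 :=
      intervalIntegral.integral_nonneg hu.1 fun _ _ => by positivity
    have h3 := mul_le_mul_of_nonneg_right hsR h2
    linarith
  have hint : ∫ u in (0 : ℝ)..x, ‖G u (x - u)‖ ^ 2 ≤ N + 2 * R *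
      ∫ u in (0 : ℝ)..x, ∫ v in (0 : ℝ)..u, ‖A v (x - 2 * u + v)‖ ^ 2 := by
    have c1 : Continuous fun u => 2 * ‖f (x - 2 * u)‖ ^ 2 := by fun_prop
    have c2 := hkc.const_mul (2 * R)
    have c3 : Continuous fun u => ‖G u (x - u)‖ ^ 2 := hGc.norm.pow 2
    have h1 := intervalIntegral.integral_mono_on hx.1 (c3.intervalIntegrable (μ := volume) 0 x)
      ((c1.add c2).intervalIntegrable 0 x) hpt
    simp only [Pi.add_apply] at h1
    rw [intervalIntegral.integral_add (c1.intervalIntegrable _ _) (c2.intervalIntegrable _ _),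
      intervalIntegral.integral_const_mul, intervalIntegral.integral_const_mul,
      intervalIntegral.integral_comp_sub_mul (fun t => ‖f t‖ ^ 2) two_ne_zero] at h1
    have e : x - 2 * x = -x := by ring
    simp only [e, mul_zero, sub_zero, smul_eq_mul] at h1
    linarith
  have htri : ∫ u in (0 : ℝ)..x, ∫ v in (0 : ℝ)..u, ‖A v (x - 2 * u + v)‖ ^ 2 ≤
      ∫ v in (0 : ℝ)..x, 2⁻¹ * (4 * N * Real.exp (2 * R * π)) := by
    rw [integral_integral_triangle_swap hk hx.1]
    -- The substitution `τ = x + v - 2u` sweeps exactly the slice at height `v` and contributes the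
    -- factor `1/2`.
    have e1 : ∀ v, ∫ u in v..x, ‖A v (x - 2 * u + v)‖ ^ 2 = 2⁻¹ * SA v := by
      intro v
      have e : ∀ u, x - 2 * u + v = x + v - 2 * u := fun u => by ring
      simp only [e]
      rw [intervalIntegral.integral_comp_sub_mul (fun t => ‖A v t‖ ^ 2) two_ne_zero, smul_eq_mul]
      congr 2 <;> ring
    simp only [e1]
    refine intervalIntegral.integral_mono_on hx.1 ((hSA.const_mul _).intervalIntegrable _ _)
      (intervalIntegrable_const) fun v hv => ?_
    have := hSAle v hv
    linarith
  rw [intervalIntegral.integral_const, sub_zero, smul_eq_mul] at htri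
  have hfin : ∫ u in (0 : ℝ)..x, ‖G u (x - u)‖ ^ 2 ≤
      (1 + π * R * (4 * Real.exp (2 * R * π))) * N := by
    have h1 : x * (2⁻¹ * (4 * N * Real.exp (2 * R * π))) ≤
        π * (2⁻¹ * (4 * N * Real.exp (2 * R * π))) := by
      have := hx.2
      gcongr
    have h2 := mul_le_mul_of_nonneg_left (htri.trans h1) (by positivity : 0 ≤ 2 * R)
    linarith
  calc _ ≤ R * ∫ u in (0 : ℝ)..x, ‖G u (x - u)‖ ^ 2 := by
        refine mul_le_mul_of_nonneg_right hrR ?_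
        exact intervalIntegral.integral_nonneg hx.1 fun _ _ => by positivity
    _ ≤ R * ((1 + π * R * (4 * Real.exp (2 * R * π))) * N) := by gcongr
    _ = _ := by ring

end DiracBVP

/-! ### Functionals represented by kernels, and measures on two copies of the line -/

namespace DiracBVP

/-- A functional prescribed on a family of vectors, bounded on its linear combinations, is
represented by a vector. -/
theorem exists_inner_eq_of_forall_norm_sum_le {H ι : Type*} [NormedAddCommGroup H]
    [InnerProductSpace ℂ H] [CompleteSpace H] (v : ι → H) (w : ι → ℂ) (C : ℝ)
    (h : ∀ (s : Finset ι) (c : ι → ℂ), ‖∑ i ∈ s, c i * w i‖ ≤ C * ‖∑ i ∈ s, c i • v i‖) :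
    ∃ k : H, ∀ i, inner ℂ k (v i) = w i := by
  set L : (ι →₀ ℂ) →ₗ[ℂ] H := Finsupp.linearCombination ℂ v
  set W : (ι →₀ ℂ) →ₗ[ℂ] ℂ := Finsupp.linearCombination ℂ w
  have hLW : ∀ c, ‖W c‖ ≤ C * ‖L c‖ := fun c => by
    simpa [L, W, Finsupp.linearCombination_apply, Finsupp.sum] using h c.support c
  -- The assumed bound makes the functional well defined on the span; Hahn–Banach and Riesz then
  -- apply.
  have hwd : ∀ c d, L c = L d → W c = W d := fun c d hcd => by
    have := hLW (c - d)
    rw [map_sub L, hcd, sub_self, norm_zero, mul_zero] at this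
    have h0 := norm_le_zero_iff.1 this
    rwa [map_sub, sub_eq_zero] at h0
  choose pre hpre using fun y : LinearMap.range L => y.2
  let f : LinearMap.range L →ₗ[ℂ] ℂ :=
    { toFun := fun y => W (pre y)
      map_add' := fun x y => by
        rw [← map_add]; apply hwd; rw [map_add, hpre, hpre, hpre]; rfl
      map_smul' := fun a x => by
        rw [RingHom.id_apply, ← map_smul]; apply hwd; rw [map_smul, hpre, hpre]; rfl }
  obtain ⟨g, hg, -⟩ := exists_extension_norm_eq (LinearMap.range L)
    (f.mkContinuous C fun y => by
      have := hLW (pre y)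
      rwa [hpre] at this)
  refine ⟨(InnerProductSpace.toDual ℂ H).symm g, fun i => ?_⟩
  rw [InnerProductSpace.toDual_symm_apply]
  have h2 : L (Finsupp.single i 1) = v i := by simp [L]
  have h1 := hg ⟨L (Finsupp.single i 1), LinearMap.mem_range_self L _⟩
  calc g (v i) = g (L (Finsupp.single i 1)) := by rw [h2]
    _ = W (pre ⟨L (Finsupp.single i 1), LinearMap.mem_range_self L _⟩) := h1
    _ = W (Finsupp.single i 1) := hwd _ _ (hpre _)
    _ = w i := by simp [W]

theorem norm_toLp_sq {α : Type*} [MeasurableSpace α] {μ : Measure α} {f : α → ℂ}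
    (hf : MemLp f 2 μ) : ‖hf.toLp f‖ ^ 2 = ∫ a, ‖f a‖ ^ 2 ∂μ := by
  rw [@norm_sq_eq_re_inner ℂ, L2.inner_def]
  have : ∫ a, inner ℂ (hf.toLp f a) (hf.toLp f a) ∂μ = ∫ a, ((‖f a‖ ^ 2 : ℝ) : ℂ) ∂μ := by
    refine integral_congr_ae ?_
    filter_upwards [hf.coeFn_toLp] with a ha
    rw [ha, inner_self_eq_norm_sq_to_K]
    push_cast; rfl
  rw [this, integral_complex_ofReal]
  simp

/-- This produces kernels from inequalities between finite sums. The pairing is bilinear, so the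
kernel is the conjugate of the Riesz vector. -/
theorem exists_integral_mul_eq_of_forall_norm_sum_le {α ι : Type*} [MeasurableSpace α]
    {μ : Measure α} (v : ι → α → ℂ) (hv : ∀ i, MemLp (v i) 2 μ) (w : ι → ℂ) (C : ℝ)
    (h : ∀ (s : Finset ι) (c : ι → ℂ),
      ‖∑ i ∈ s, c i * w i‖ ^ 2 ≤ C * ∫ a, ‖∑ i ∈ s, c i * v i a‖ ^ 2 ∂μ) :
    ∃ k : α → ℂ, MemLp k 2 μ ∧ ∀ i, ∫ a, k a * v i a ∂μ = w i := by
  obtain ⟨k, hk⟩ := exists_inner_eq_of_forall_norm_sum_le (fun i => (hv i).toLp (v i)) w (√C)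
    (fun s c => by
      have hsum : MemLp (fun a => ∑ i ∈ s, c i * v i a) 2 μ :=
        memLp_finsetSum _ fun i _ => (hv i).const_mul (c i)
      have e : ∑ i ∈ s, c i • (hv i).toLp (v i) = hsum.toLp _ := by
        refine Lp.ext ?_
        have h1 := Lp.coeFn_finsetSum s (fun i => c i • (hv i).toLp (v i))
        refine h1.trans (EventuallyEq.trans ?_ hsum.coeFn_toLp.symm)
        have h2 : ∀ᵐ a ∂μ, ∀ i ∈ s, (c i • (hv i).toLp (v i)) a = c i * v i a := by
          rw [Finset.eventually_all]
          intro i _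
          filter_upwards [Lp.coeFn_smul (c i) ((hv i).toLp (v i)), (hv i).coeFn_toLp] with a h1 h2
          rw [h1, Pi.smul_apply, h2, smul_eq_mul]
        filter_upwards [h2] with a ha
        rw [Finset.sum_apply]
        exact Finset.sum_congr rfl ha
      rw [e]
      refine abs_le_of_sq_le_sq' ?_ (by positivity) |>.2
      rw [mul_pow, norm_toLp_sq]
      refine (h s c).trans ?_
      have h0 : 0 ≤ ∫ a, ‖∑ i ∈ s, c i * v i a‖ ^ 2 ∂μ := integral_nonneg fun _ => by positivity
      refine mul_le_mul_of_nonneg_right ?_ h0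
      rcases le_total 0 C with hC | hC
      · rw [Real.sq_sqrt hC]
      · exact hC.trans (sq_nonneg _))
  refine ⟨fun a => (starRingEnd ℂ) (k a), ?_, fun i => ?_⟩
  · exact (Lp.memLp k).star
  · rw [← hk i, L2.inner_def]
    refine integral_congr_ae ?_
    filter_upwards [(hv i).coeFn_toLp] with a ha
    rw [ha]; simp [mul_comm]

section PairMeasure

/-- The measure on `ℝ × Fin 2` with given restrictions to the two lines. -/
noncomputable def pairMeasure (ν₀ ν₁ : Measure ℝ) : Measure (ℝ × Fin 2) :=
  ν₀.map (fun t => (t, 0)) + ν₁.map (fun t => (t, 1))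

variable {ν₀ ν₁ : Measure ℝ}

theorem measurableEmbedding_pair (i : Fin 2) : MeasurableEmbedding fun t : ℝ => (t, i) :=
  measurableEmbedding_prod_mk_right i

instance [IsFiniteMeasure ν₀] [IsFiniteMeasure ν₁] : IsFiniteMeasure (pairMeasure ν₀ ν₁) := by
  unfold pairMeasure; infer_instance

theorem memLp_pairMeasure {f : ℝ × Fin 2 → ℂ} :
    MemLp f 2 (pairMeasure ν₀ ν₁) ↔
      MemLp (fun t => f (t, 0)) 2 ν₀ ∧ MemLp (fun t => f (t, 1)) 2 ν₁ := by
  rw [pairMeasure]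
  constructor
  · intro h
    exact ⟨(measurableEmbedding_pair 0).memLp_map_measure_iff.1 (h.left_of_add_measure),
      (measurableEmbedding_pair 1).memLp_map_measure_iff.1 (h.right_of_add_measure)⟩
  · rintro ⟨h0, h1⟩
    have hm : AEStronglyMeasurable f
        (ν₀.map (fun t => (t, (0 : Fin 2))) + ν₁.map (fun t => (t, (1 : Fin 2)))) :=
      aestronglyMeasurable_add_measure_iff.2
        ⟨(measurableEmbedding_pair 0).aestronglyMeasurable_map_iff.2 h0.1,
          (measurableEmbedding_pair 1).aestronglyMeasurable_map_iff.2 h1.1⟩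
    rw [memLp_two_iff_integrable_sq_norm hm, integrable_add_measure,
      (measurableEmbedding_pair 0).integrable_map_iff,
      (measurableEmbedding_pair 1).integrable_map_iff]
    exact ⟨(memLp_two_iff_integrable_sq_norm h0.1).1 h0,
      (memLp_two_iff_integrable_sq_norm h1.1).1 h1⟩

theorem integrable_pairMeasure {E : Type*} [NormedAddCommGroup E] {f : ℝ × Fin 2 → E} :
    Integrable f (pairMeasure ν₀ ν₁) ↔
      Integrable (fun t => f (t, 0)) ν₀ ∧ Integrable (fun t => f (t, 1)) ν₁ := by
  rw [pairMeasure, integrable_add_measure, (measurableEmbedding_pair 0).integrable_map_iff,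
    (measurableEmbedding_pair 1).integrable_map_iff]
  rfl

theorem integral_pairMeasure {E : Type*} [NormedAddCommGroup E] [NormedSpace ℝ E]
    {f : ℝ × Fin 2 → E} (h : Integrable f (pairMeasure ν₀ ν₁)) :
    ∫ w, f w ∂(pairMeasure ν₀ ν₁) = (∫ t, f (t, 0) ∂ν₀) + ∫ t, f (t, 1) ∂ν₁ := by
  rw [pairMeasure, integrable_add_measure] at h
  rw [pairMeasure, integral_add_measure h.1 h.2, (measurableEmbedding_pair 0).integral_map,
    (measurableEmbedding_pair 1).integral_map]

theorem ae_pairMeasure {P : ℝ × Fin 2 → Prop} :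
    (∀ᵐ w ∂(pairMeasure ν₀ ν₁), P w) ↔ (∀ᵐ t ∂ν₀, P (t, 0)) ∧ ∀ᵐ t ∂ν₁, P (t, 1) := by
  rw [pairMeasure, ae_add_measure_iff, (measurableEmbedding_pair 0).ae_map_iff,
    (measurableEmbedding_pair 1).ae_map_iff]

end PairMeasure

end DiracBVP

/-! ### Amplitudes of the Dirac system -/

namespace DiracBVP

/-- The amplitude `-φ₂ + iφ₁`, which is `exp(izx)` for the system without potential. -/
noncomputable def ampA (φ : ℝ → ℂ → Fin 2 → ℂ) (z : ℂ) (x : ℝ) : ℂ :=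
  -φ x z 1 + Complex.I * φ x z 0

/-- The amplitude `-φ₂ - iφ₁`, which is `exp(-izx)` for the system without potential. -/
noncomputable def ampB (φ : ℝ → ℂ → Fin 2 → ℂ) (z : ℂ) (x : ℝ) : ℂ :=
  -φ x z 1 - Complex.I * φ x z 0

/-- The exponential sum with coefficients `c` and frequencies in `s`. -/
noncomputable def expSum (s : Finset ℂ) (c : ℂ → ℂ) (t : ℝ) : ℂ :=
  ∑ z ∈ s, c z * Complex.exp (Complex.I * z * t)

theorem continuous_expSum (s : Finset ℂ) (c : ℂ → ℂ) : Continuous (expSum s c) := by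
  unfold expSum; fun_prop

/-- The companion of `norm_sub_sq_le_transport` for the second unknown, obtained by reflecting `τ`.
-/
theorem norm_sub_reflected_sq_le_transport {r s f : ℝ → ℂ} {A G : ℝ → ℝ → ℂ}
    (hr : MemLp r 2 (volume.restrict (Ioo 0 π))) (hs : MemLp s 2 (volume.restrict (Ioo 0 π)))
    (hf : Continuous f)
    (hA : Continuous (Function.uncurry A)) (hG : Continuous (Function.uncurry G))
    (h : ∀ x ∈ Icc 0 π, ∀ τ, A x τ = f (τ + x) + ∫ v in (0 : ℝ)..x, r v * G v (τ + x - v))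
    (h' : ∀ x ∈ Icc 0 π, ∀ τ, G x τ = f (τ - x) + ∫ v in (0 : ℝ)..x, s v * A v (τ - x + v))
    {R : ℝ} (hrR : ∫ v in Ioo 0 π, ‖r v‖ ^ 2 ≤ R) (hsR : ∫ v in Ioo 0 π, ‖s v‖ ^ 2 ≤ R)
    {x : ℝ} (hx : x ∈ Icc 0 π) :
    ‖G x 0 - f (-x)‖ ^ 2 ≤ (R * (1 + π * R * (4 * Real.exp (2 * R * π)))) *
      ∫ t in (-x)..x, ‖f t‖ ^ 2 := by
  have := norm_sub_sq_le_transport (r := s) (s := r) (f := fun t => f (-t))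
    (A := fun x τ => G x (-τ)) (G := fun x τ => A x (-τ)) hs hr (by fun_prop)
    (hG.comp (by fun_prop : Continuous fun w : ℝ × ℝ => (w.1, -w.2)))
    (hA.comp (by fun_prop : Continuous fun w : ℝ × ℝ => (w.1, -w.2)))
    (fun x hx τ => by
      rw [h' x hx (-τ)]
      congr 1
      · congr 1; ring
      · refine intervalIntegral.integral_congr fun v _ => ?_
        congr 2; ring)
    (fun x hx τ => by
      rw [h x hx (-τ)]
      congr 1
      · congr 1; ring
      · refine intervalIntegral.integral_congr fun v _ => ?_
        congr 2; ring) hsR hrR hx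
  simp only [neg_zero] at this
  rwa [intervalIntegral.integral_comp_neg (fun t => ‖f t‖ ^ 2), neg_neg] at this

section Amplitudes

variable {p q : ℝ → ℝ} {φ : ℝ → ℂ → Fin 2 → ℂ}

theorem IsPhi.continuousOn (hφ : IsPhi p q φ) (z : ℂ) :
    ContinuousOn (fun x => φ x z) (Icc 0 π) := by
  simpa [uIcc_of_le Real.pi_pos.le] using (hφ z).1.1.continuousOn

theorem IsPhi.continuousOn_apply (hφ : IsPhi p q φ) (z : ℂ) (i : Fin 2) :
    ContinuousOn (fun x => φ x z i) (Icc 0 π) :=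
  (continuous_apply i).comp_continuousOn (hφ.continuousOn z)

theorem IsPhi.ampA_continuousOn (hφ : IsPhi p q φ) (z : ℂ) :
    ContinuousOn (ampA φ z) (Icc 0 π) :=
  (hφ.continuousOn_apply z 1).neg.add (continuousOn_const.mul (hφ.continuousOn_apply z 0))

theorem IsPhi.ampB_continuousOn (hφ : IsPhi p q φ) (z : ℂ) :
    ContinuousOn (ampB φ z) (Icc 0 π) :=
  (hφ.continuousOn_apply z 1).neg.sub (continuousOn_const.mul (hφ.continuousOn_apply z 0))

theorem hasAEDeriv_cexp (k : ℂ) : HasAEDeriv (fun x : ℝ => Complex.exp (k * x))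
    (fun x : ℝ => k * Complex.exp (k * x)) := by
  refine hasAEDeriv_of_hasDerivAt (fun x => ?_) (by fun_prop)
  have h1 : HasDerivAt (fun x : ℝ => k * (x : ℂ)) k x := by
    simpa using (Complex.ofRealCLM.hasDerivAt (x := x)).const_mul k
  convert! h1.cexp using 1
  ring

/-- The amplitudes satisfy `A' = izA + (ip - q)B` and `B' = -izB - (ip + q)A`. An integrating factor
removes the oscillation, and multiplication by `exp(izτ)` moves the parameter into the variable `τ`.
The resulting equation has coefficients independent of `z`, so it passes to linear combinations over
`z`. -/
theorem IsPhi.ampA_mul_exp (hp : MemLp p 2 (volume.restrict (Ioo 0 π)))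
    (hq : MemLp q 2 (volume.restrict (Ioo 0 π))) (hφ : IsPhi p q φ) (z : ℂ) {x : ℝ}
    (hx : x ∈ Icc 0 π) (τ : ℝ) :
    ampA φ z x * Complex.exp (Complex.I * z * τ) =
      Complex.exp (Complex.I * z * (τ + x : ℝ)) + ∫ v in (0 : ℝ)..x,
        (Complex.I * p v - q v) *
          (ampB φ z v * Complex.exp (Complex.I * z * (τ + x - v : ℝ))) := by
  have hy := ((isSolution_iff hp hq).1 (hφ z).1).2
  have h := ((((hy 1).const_mul (-1)).add ((hy 0).const_mul Complex.I)).mul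
    (hasAEDeriv_cexp (-(Complex.I * z)))).eq_add_integral hx
  rw [(hφ z).2] at h
  have h2 : ampA φ z x * Complex.exp (-(Complex.I * z) * x) = 1 + ∫ v in (0 : ℝ)..x,
      (Complex.I * p v - q v) * (ampB φ z v * Complex.exp (-(Complex.I * z) * v)) := by
    convert! h using 1
    · simp [ampA]
    · congr 1
      · simp
      · refine intervalIntegral.integral_congr fun v _ => ?_
        simp only [ampB, sysCoeff, Fin.sum_univ_two, Matrix.of_apply, Matrix.cons_val_zero,
          Matrix.cons_val_one, Matrix.cons_val', Matrix.cons_val_fin_one]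
        linear_combination (z - p v : ℂ) * φ v z 0 *
          Complex.exp (-(Complex.I * z) * v) * Complex.I_mul_I
  have h3 := congrArg (fun w => w * Complex.exp (Complex.I * z * (τ + x : ℝ))) h2
  simp only [add_mul, one_mul, mul_assoc] at h3
  rw [← intervalIntegral.integral_mul_const] at h3
  convert! h3 using 1
  · rw [← Complex.exp_add]; congr 2; push_cast; ring
  · congr 1
    · congr 1; ring
    · refine intervalIntegral.integral_congr fun v _ => ?_
      simp only [mul_assoc]
      rw [← Complex.exp_add]; congr 4; push_cast; ring

theorem IsPhi.ampB_mul_exp (hp : MemLp p 2 (volume.restrict (Ioo 0 π)))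
    (hq : MemLp q 2 (volume.restrict (Ioo 0 π))) (hφ : IsPhi p q φ) (z : ℂ) {x : ℝ}
    (hx : x ∈ Icc 0 π) (τ : ℝ) :
    ampB φ z x * Complex.exp (Complex.I * z * τ) =
      Complex.exp (Complex.I * z * (τ - x : ℝ)) + ∫ v in (0 : ℝ)..x,
        (-Complex.I * p v - q v) *
          (ampA φ z v * Complex.exp (Complex.I * z * (τ - x + v : ℝ))) := by
  have hy := ((isSolution_iff hp hq).1 (hφ z).1).2
  have h := ((((hy 1).const_mul (-1)).sub ((hy 0).const_mul Complex.I)).mul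
    (hasAEDeriv_cexp (Complex.I * z))).eq_add_integral hx
  rw [(hφ z).2] at h
  have h2 : ampB φ z x * Complex.exp ((Complex.I * z) * x) = 1 + ∫ v in (0 : ℝ)..x,
      (-Complex.I * p v - q v) * (ampA φ z v * Complex.exp ((Complex.I * z) * v)) := by
    convert! h using 1
    · simp [ampB]
    · congr 1
      · simp
      · refine intervalIntegral.integral_congr fun v _ => ?_
        simp only [ampA, sysCoeff, Fin.sum_univ_two, Matrix.of_apply, Matrix.cons_val_zero,
          Matrix.cons_val_one, Matrix.cons_val', Matrix.cons_val_fin_one]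
        linear_combination (z - p v : ℂ) * φ v z 0 *
          Complex.exp ((Complex.I * z) * v) * Complex.I_mul_I
  have h3 := congrArg (fun w => w * Complex.exp (Complex.I * z * (τ - x : ℝ))) h2
  simp only [add_mul, one_mul, mul_assoc] at h3
  rw [← intervalIntegral.integral_mul_const] at h3
  convert! h3 using 1
  · rw [← Complex.exp_add]; congr 2; push_cast; ring
  · congr 1
    · congr 1; ring
    · refine intervalIntegral.integral_congr fun v _ => ?_
      simp only [mul_assoc]
      rw [← Complex.exp_add]; congr 4; push_cast; ring

/-- Combinations of the amplitudes times `exp(izτ)` solve a transport system whose data are the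
exponential sum and whose coefficients are `±ip - q`. The triangle estimate at `τ = 0` hence holds
with one constant for all frequencies and coefficients. -/
theorem exists_ampA_ampB_bound (hp : MemLp p 2 (volume.restrict (Ioo 0 π)))
    (hq : MemLp q 2 (volume.restrict (Ioo 0 π))) :
    ∃ C : ℝ, 0 ≤ C ∧ ∀ φ, IsPhi p q φ → ∀ (s : Finset ℂ) (c : ℂ → ℂ), ∀ x ∈ Icc 0 π,
      ‖(∑ z ∈ s, c z * ampA φ z x) - expSum s c x‖ ^ 2 ≤ C * ∫ t in (-x)..x, ‖expSum s c t‖ ^ 2 ∧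
      ‖(∑ z ∈ s, c z * ampB φ z x) - expSum s c (-x)‖ ^ 2 ≤
        C * ∫ t in (-x)..x, ‖expSum s c t‖ ^ 2 := by
  have hpi := Real.pi_pos.le
  set r : ℝ → ℂ := fun v => Complex.I * p v - q v
  set r' : ℝ → ℂ := fun v => -Complex.I * p v - q v
  have hp' : MemLp (fun x => (p x : ℂ)) 2 (volume.restrict (Ioo 0 π)) := hp.ofReal
  have hq' : MemLp (fun x => (q x : ℂ)) 2 (volume.restrict (Ioo 0 π)) := hq.ofReal
  have hr : MemLp r 2 (volume.restrict (Ioo 0 π)) := (hp'.const_mul _).sub hq'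
  have hr' : MemLp r' 2 (volume.restrict (Ioo 0 π)) := (hp'.const_mul _).sub hq'
  set R := max (∫ v in Ioo 0 π, ‖r v‖ ^ 2) (∫ v in Ioo 0 π, ‖r' v‖ ^ 2)
  have hR : 0 ≤ R := le_max_of_le_left (integral_nonneg fun _ => by positivity)
  refine ⟨R * (1 + π * R * (4 * Real.exp (2 * R * π))), by positivity, ?_⟩
  intro φ hφ s c x hx
  -- Clamping to `[0, π]` extends the amplitudes continuously to the line, as the transport estimate
  -- requires.
  set cl : ℝ → ℝ := fun x => (projIcc 0 π hpi x : ℝ)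
  have hcl : Continuous cl := continuous_subtype_val.comp continuous_projIcc
  have hclm : ∀ x, cl x ∈ Icc 0 π := fun x => (projIcc 0 π hpi x).2
  have hcle : ∀ x ∈ Icc 0 π, cl x = x := fun x hx => by simp [cl, projIcc_of_mem hpi hx]
  set A : ℝ → ℝ → ℂ := fun x τ => ∑ z ∈ s, c z * (ampA φ z (cl x) *
    Complex.exp (Complex.I * z * τ)) with hAdef
  set G : ℝ → ℝ → ℂ := fun x τ => ∑ z ∈ s, c z * (ampB φ z (cl x) *
    Complex.exp (Complex.I * z * τ)) with hGdef
  have cA : ∀ z, Continuous fun x => ampA φ z (cl x) := fun z =>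
    (hφ.ampA_continuousOn z).comp_continuous hcl hclm
  have cB : ∀ z, Continuous fun x => ampB φ z (cl x) := fun z =>
    (hφ.ampB_continuousOn z).comp_continuous hcl hclm
  have hA : Continuous (Function.uncurry A) := by
    refine continuous_finsetSum _ fun z _ => continuous_const.mul (((cA z).comp continuous_fst).mul
      (by fun_prop))
  have hG : Continuous (Function.uncurry G) := by
    refine continuous_finsetSum _ fun z _ => continuous_const.mul (((cB z).comp continuous_fst).mul
      (by fun_prop))
  have hint : ∀ (ρ : ℝ → ℂ), MemLp ρ 2 (volume.restrict (Ioo 0 π)) → ∀ g : ℝ → ℂ,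
      ContinuousOn g (Icc 0 π) → ∀ x ∈ Icc 0 π,
      IntervalIntegrable (fun v => ρ v * g v) volume 0 x := by
    intro ρ hρ g hg x hx
    refine ((hρ.intervalIntegrable_Ioo hpi).mul_continuousOn ?_).mono_set ?_
    · rwa [uIcc_of_le hpi]
    · rw [uIcc_of_le hx.1, uIcc_of_le hpi]; exact Icc_subset_Icc_right hx.2
  have h : ∀ x ∈ Icc 0 π, ∀ τ, A x τ = expSum s c (τ + x) +
      ∫ v in (0 : ℝ)..x, r v * G v (τ + x - v) := by
    intro x hx τ
    have e1 : ∫ v in (0 : ℝ)..x, r v * G v (τ + x - v) = ∑ z ∈ s, c z * ∫ v in (0 : ℝ)..x,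
        r v * (ampB φ z v * Complex.exp (Complex.I * z * (τ + x - v : ℝ))) := by
      simp only [← intervalIntegral.integral_const_mul]
      rw [← intervalIntegral.integral_finsetSum]
      · refine intervalIntegral.integral_congr fun v hv => ?_
        rw [uIcc_of_le hx.1] at hv
        simp only [hGdef, hcle v ⟨hv.1, hv.2.trans hx.2⟩, Finset.mul_sum]
        exact Finset.sum_congr rfl fun z _ => by ring
      · intro z _
        refine IntervalIntegrable.const_mul (hint r hr _ ?_ x hx) _
        exact (hφ.ampB_continuousOn z).mul (by fun_prop)
    rw [e1]
    simp only [hAdef, hcle x hx, expSum, ← Finset.sum_add_distrib]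
    refine Finset.sum_congr rfl fun z _ => ?_
    rw [hφ.ampA_mul_exp hp hq z hx τ]; ring
  have h' : ∀ x ∈ Icc 0 π, ∀ τ, G x τ = expSum s c (τ - x) +
      ∫ v in (0 : ℝ)..x, r' v * A v (τ - x + v) := by
    intro x hx τ
    have e1 : ∫ v in (0 : ℝ)..x, r' v * A v (τ - x + v) = ∑ z ∈ s, c z * ∫ v in (0 : ℝ)..x,
        r' v * (ampA φ z v * Complex.exp (Complex.I * z * (τ - x + v : ℝ))) := by
      simp only [← intervalIntegral.integral_const_mul]
      rw [← intervalIntegral.integral_finsetSum]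
      · refine intervalIntegral.integral_congr fun v hv => ?_
        rw [uIcc_of_le hx.1] at hv
        simp only [hAdef, hcle v ⟨hv.1, hv.2.trans hx.2⟩, Finset.mul_sum]
        exact Finset.sum_congr rfl fun z _ => by ring
      · intro z _
        refine IntervalIntegrable.const_mul (hint r' hr' _ ?_ x hx) _
        exact (hφ.ampA_continuousOn z).mul (by fun_prop)
    rw [e1]
    simp only [hGdef, hcle x hx, expSum, ← Finset.sum_add_distrib]
    refine Finset.sum_congr rfl fun z _ => ?_
    rw [hφ.ampB_mul_exp hp hq z hx τ]; ring
  have k1 := norm_sub_sq_le_transport hr hr' (continuous_expSum s c) hA hG h h'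
    (le_max_left _ _) (le_max_right _ _) hx
  have k2 := norm_sub_reflected_sq_le_transport hr hr' (continuous_expSum s c) hA hG h h'
    (le_max_left _ _) (le_max_right _ _) hx
  have e1 : A x 0 = ∑ z ∈ s, c z * ampA φ z x := by simp [hAdef, hcle x hx]
  have e2 : G x 0 = ∑ z ∈ s, c z * ampB φ z x := by simp [hGdef, hcle x hx]
  rw [e1] at k1
  rw [e2] at k2
  exact ⟨k1, k2⟩

end Amplitudes

end DiracBVP

/-! ### The transformation kernel and the transposed inverse -/

namespace DiracBVP

/-- Two copies of Lebesgue measure on `(0, X)`. -/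
noncomputable def twoMeasure (X : ℝ) : Measure (ℝ × Fin 2) :=
  pairMeasure (volume.restrict (Ioo 0 X)) (volume.restrict (Ioo 0 X))

instance (X : ℝ) : IsFiniteMeasure (twoMeasure X) := by unfold twoMeasure; infer_instance

theorem memLp_twoMeasure {f : ℝ × Fin 2 → ℂ} {X : ℝ} :
    MemLp f 2 (twoMeasure X) ↔
      ∀ i, MemLp (fun t => f (t, i)) 2 (volume.restrict (Ioo 0 X)) := by
  rw [twoMeasure, memLp_pairMeasure, Fin.forall_fin_two]

theorem integral_twoMeasure {E : Type*} [NormedAddCommGroup E] [NormedSpace ℝ E]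
    {f : ℝ × Fin 2 → E} {X : ℝ} (hX : 0 ≤ X) (h : Integrable f (twoMeasure X)) :
    ∫ w, f w ∂(twoMeasure X) = ∫ t in (0 : ℝ)..X, (f (t, 0) + f (t, 1)) := by
  rw [twoMeasure] at h ⊢
  rw [integral_pairMeasure h]
  rw [integrable_pairMeasure] at h
  rw [intervalIntegral.integral_of_le hX, integral_Ioc_eq_integral_Ioo, integral_add h.1 h.2]

theorem continuous_phi0 (z : ℂ) (i : Fin 2) : Continuous fun t : ℝ => phi0 t z i := by
  unfold phi0
  fin_cases i
  · simp; fun_prop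
  · simp; fun_prop

theorem memLp_twoMeasure_of_continuousOn {f : ℝ × Fin 2 → ℂ} {X : ℝ}
    (h : ∀ i, ContinuousOn (fun t => f (t, i)) (Icc 0 X)) : MemLp f 2 (twoMeasure X) :=
  memLp_twoMeasure.2 fun i => (h i).memLp_restrict_Ioo 2

theorem memLp_phi0 (z : ℂ) (X : ℝ) :
    MemLp (fun w : ℝ × Fin 2 => phi0 w.1 z w.2) 2 (twoMeasure X) :=
  memLp_twoMeasure_of_continuousOn fun i => (continuous_phi0 z i).continuousOn

theorem sum_phi0_zero (s : Finset ℂ) (c : ℂ → ℂ) (t : ℝ) :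
    ∑ z ∈ s, c z * phi0 t z 0 = -(Complex.I / 2) * (expSum s c t - expSum s c (-t)) := by
  simp only [expSum, ← Finset.sum_sub_distrib, Finset.mul_sum]
  refine Finset.sum_congr rfl fun z _ => ?_
  simp only [phi0, Matrix.cons_val_zero, Complex.sin]
  have e1 : Complex.I * z * ((-t : ℝ) : ℂ) = -(z * t) * Complex.I := by push_cast; ring
  have e2 : Complex.I * z * (t : ℂ) = z * t * Complex.I := by ring
  rw [e1, e2]; ring

theorem sum_phi0_one (s : Finset ℂ) (c : ℂ → ℂ) (t : ℝ) :
    ∑ z ∈ s, c z * phi0 t z 1 = -(1 / 2) * (expSum s c t + expSum s c (-t)) := by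
  simp only [expSum, ← Finset.sum_add_distrib, Finset.mul_sum]
  refine Finset.sum_congr rfl fun z _ => ?_
  simp only [phi0, Matrix.cons_val_one, Matrix.cons_val_fin_one, Complex.cos]
  have e1 : Complex.I * z * ((-t : ℝ) : ℂ) = -(z * t) * Complex.I := by push_cast; ring
  have e2 : Complex.I * z * (t : ℂ) = z * t * Complex.I := by ring
  rw [e1, e2]; ring

theorem norm_half_sub_sq_add_norm_half_add_sq (u v : ℂ) :
    ‖-(Complex.I / 2) * (u - v)‖ ^ 2 + ‖-(1 / 2 : ℂ) * (u + v)‖ ^ 2 =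
      (‖u‖ ^ 2 + ‖v‖ ^ 2) / 2 := by
  have h := parallelogram_law_with_norm ℝ u v
  rw [norm_mul, norm_mul, mul_pow, mul_pow]
  simp only [norm_neg, norm_div, Complex.norm_I, norm_one, Complex.norm_ofNat]
  nlinarith

theorem integral_symm_eq {g : ℝ → ℝ} (hg : Continuous g) (x : ℝ) :
    ∫ t in (-x)..x, g t = ∫ t in (0 : ℝ)..x, (g t + g (-t)) := by
  have hg' : Continuous fun t => g (-t) := hg.comp continuous_neg
  rw [intervalIntegral.integral_add (hg.intervalIntegrable _ _) (hg'.intervalIntegrable _ _),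
    intervalIntegral.integral_comp_neg (fun t => g t), neg_zero, add_comm,
    intervalIntegral.integral_add_adjacent_intervals] <;>
  exact hg.intervalIntegrable _ _

/-- Up to factors of modulus one, the components are the odd and even parts of the exponential sum,
and the parallelogram law recombines them with the factor `1/2`. So `L²` norms over two copies of
`(0, X)` become norms over `(-X, X)`. -/
theorem integral_norm_sq_sum_phi0 (s : Finset ℂ) (c : ℂ → ℂ) {X : ℝ} (hX : 0 ≤ X) :
    ∫ w, ‖∑ z ∈ s, c z * phi0 w.1 z w.2‖ ^ 2 ∂(twoMeasure X) =
      (∫ t in (-X)..X, ‖expSum s c t‖ ^ 2) / 2 := by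
  have hm : MemLp (fun w : ℝ × Fin 2 => ∑ z ∈ s, c z * phi0 w.1 z w.2) 2 (twoMeasure X) :=
    memLp_twoMeasure_of_continuousOn fun i => by
      refine Continuous.continuousOn ?_
      exact continuous_finsetSum _ fun z _ => continuous_const.mul (continuous_phi0 z i)
  have hi := (memLp_two_iff_integrable_sq_norm hm.1).1 hm
  rw [integral_twoMeasure hX hi, integral_symm_eq (by have := continuous_expSum s c; fun_prop),
    ← intervalIntegral.integral_div]
  refine intervalIntegral.integral_congr fun t _ => ?_
  simp only
  rw [sum_phi0_zero, sum_phi0_one, norm_half_sub_sq_add_norm_half_add_sq]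

theorem phi_eq_amp (φ : ℝ → ℂ → Fin 2 → ℂ) (x : ℝ) (z : ℂ) :
    φ x z 0 = -(Complex.I / 2) * (ampA φ z x - ampB φ z x) ∧
    φ x z 1 = -(1 / 2 : ℂ) * (ampA φ z x + ampB φ z x) := by
  constructor
  · simp only [ampA, ampB]; linear_combination φ x z 0 * Complex.I_mul_I
  · simp only [ampA, ampB]; ring

section

variable {p q : ℝ → ℝ}

theorem norm_sum_phi_sub_phi0_sq_le (hp : MemLp p 2 (volume.restrict (Ioo 0 π)))
    (hq : MemLp q 2 (volume.restrict (Ioo 0 π))) :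
    ∃ C : ℝ, 0 ≤ C ∧ ∀ φ, IsPhi p q φ → ∀ (s : Finset ℂ) (c : ℂ → ℂ), ∀ x ∈ Icc 0 π,
      ∀ i, ‖∑ z ∈ s, c z * (φ x z i - phi0 x z i)‖ ^ 2 ≤
        C * ∫ t in (-x)..x, ‖expSum s c t‖ ^ 2 := by
  obtain ⟨C, hC, h⟩ := exists_ampA_ampB_bound hp hq
  refine ⟨C, hC, fun φ hφ s c x hx => ?_⟩
  obtain ⟨h1, h2⟩ := h φ hφ s c x hx
  set Pa := (∑ z ∈ s, c z * ampA φ z x) - expSum s c x with hPa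
  set Pb := (∑ z ∈ s, c z * ampB φ z x) - expSum s c (-x) with hPb
  have key := norm_half_sub_sq_add_norm_half_add_sq Pa Pb
  have e0 : ∑ z ∈ s, c z * (φ x z 0 - phi0 x z 0) = -(Complex.I / 2) * (Pa - Pb) := by
    simp only [mul_sub, Finset.sum_sub_distrib, sum_phi0_zero]
    have : ∑ z ∈ s, c z * φ x z 0 = -(Complex.I / 2) *
        ((∑ z ∈ s, c z * ampA φ z x) - ∑ z ∈ s, c z * ampB φ z x) := by
      rw [← Finset.sum_sub_distrib, Finset.mul_sum]
      exact Finset.sum_congr rfl fun z _ => by rw [(phi_eq_amp φ x z).1]; ring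
    rw [this, hPa, hPb]; ring
  have e1 : ∑ z ∈ s, c z * (φ x z 1 - phi0 x z 1) = -(1 / 2 : ℂ) * (Pa + Pb) := by
    simp only [mul_sub, Finset.sum_sub_distrib, sum_phi0_one]
    have : ∑ z ∈ s, c z * φ x z 1 = -(1 / 2 : ℂ) *
        ((∑ z ∈ s, c z * ampA φ z x) + ∑ z ∈ s, c z * ampB φ z x) := by
      rw [← Finset.sum_add_distrib, Finset.mul_sum]
      exact Finset.sum_congr rfl fun z _ => by rw [(phi_eq_amp φ x z).2]; ring
    rw [this, hPa, hPb]; ring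
  rw [Fin.forall_fin_two, e0, e1]
  constructor
  · nlinarith [sq_nonneg ‖-(1 / 2 : ℂ) * (Pa + Pb)‖]
  · nlinarith [sq_nonneg ‖-(Complex.I / 2) * (Pa - Pb)‖]

/-- The functional sending `∑ c_z φ₀(·, z)` to `∑ c_z (φ - φ₀)(x, z)` is bounded in `L²` over `(0,
x)`; its representative is the row `i` of `K(x, ·)`. The constant `2C` absorbs the factor `1/2`
between the two norms. -/
theorem IsPhi.exists_kernel_row {φ : ℝ → ℂ → Fin 2 → ℂ}
    (hp : MemLp p 2 (volume.restrict (Ioo 0 π)))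
    (hq : MemLp q 2 (volume.restrict (Ioo 0 π))) (hφ : IsPhi p q φ) {x : ℝ} (hx : x ∈ Icc 0 π)
    (i : Fin 2) : ∃ κ : ℝ × Fin 2 → ℂ, MemLp κ 2 (twoMeasure x) ∧
      ∀ z, ∫ w, κ w * phi0 w.1 z w.2 ∂(twoMeasure x) = φ x z i - phi0 x z i := by
  obtain ⟨C, hC, h⟩ := norm_sum_phi_sub_phi0_sq_le hp hq
  refine exists_integral_mul_eq_of_forall_norm_sum_le (μ := twoMeasure x)
    (fun (z : ℂ) (w : ℝ × Fin 2) => phi0 w.1 z w.2) (fun z => memLp_phi0 z x)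
    (fun z => φ x z i - phi0 x z i) (2 * C) fun s c => ?_
  · rw [integral_norm_sq_sum_phi0 s c hx.1]
    have := h φ hφ s c x hx i
    linarith

theorem integral_twoMeasure_mul {κ v : ℝ × Fin 2 → ℂ} {X : ℝ} (hX : 0 ≤ X)
    (hκ : MemLp κ 2 (twoMeasure X)) (hv : MemLp v 2 (twoMeasure X)) :
    ∫ w, κ w * v w ∂(twoMeasure X) =
      ∫ t in (0 : ℝ)..X, (κ (t, 0) * v (t, 0) + κ (t, 1) * v (t, 1)) :=
  integral_twoMeasure hX (hκ.integrable_mul hv)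

theorem intervalIntegral_apply {f : ℝ → Fin 2 → ℂ} {a b : ℝ}
    (hf : ∀ i, IntervalIntegrable (fun t => f t i) volume a b) (i : Fin 2) :
    (∫ t in a..b, f t) i = ∫ t in a..b, f t i := by
  have h : IntervalIntegrable f volume a b :=
    ⟨integrable_pi_iff.2 fun i => (hf i).1, integrable_pi_iff.2 fun i => (hf i).2⟩
  exact ((ContinuousLinearMap.proj (R := ℂ) (φ := fun _ : Fin 2 => ℂ) i).intervalIntegral_comp_comm
    h).symm

/-- A kernel row, integrated against `φ₀`, in matrix notation. -/
theorem integral_mulVec_phi0_apply {K : ℝ → Matrix (Fin 2) (Fin 2) ℂ} {x : ℝ} (hx : 0 ≤ x)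
    (hK : ∀ i j, MemLp (fun t => K t i j) 2 (volume.restrict (Ioo 0 x))) (z : ℂ) (i : Fin 2) :
    (∫ t in (0 : ℝ)..x, (K t).mulVec (phi0 t z)) i =
      ∫ w, K w.1 i w.2 * phi0 w.1 z w.2 ∂(twoMeasure x) := by
  rw [integral_twoMeasure_mul hx (memLp_twoMeasure.2 fun j => hK i j) (memLp_phi0 z x),
    intervalIntegral_apply]
  · refine intervalIntegral.integral_congr fun t _ => ?_
    simp [Matrix.mulVec, dotProduct, Fin.sum_univ_two]
  · intro i
    simp only [Matrix.mulVec, dotProduct, Fin.sum_univ_two]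
    refine IntervalIntegrable.add ?_ ?_ <;>
    exact ((hK i _).intervalIntegrable_Ioo hx).mul_continuousOn (continuous_phi0 z _).continuousOn

theorem IsPhi.exists_transformationKernel {φ : ℝ → ℂ → Fin 2 → ℂ}
    (hp : MemLp p 2 (volume.restrict (Ioo 0 π)))
    (hq : MemLp q 2 (volume.restrict (Ioo 0 π))) (hφ : IsPhi p q φ) :
    ∃ K, IsTransformationKernel φ K := by
  have h := fun (x : Icc (0 : ℝ) π) (i : Fin 2) => hφ.exists_kernel_row hp hq x.2 i
  choose κ hκ hκz using h
  refine ⟨fun x t => if hx : x ∈ Icc 0 π then Matrix.of fun i j => κ ⟨x, hx⟩ i (t, j) else 0,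
    fun x hx => ?_⟩
  simp only [dif_pos hx]
  have hK : ∀ i j, MemLp (fun t => (Matrix.of fun i j => κ ⟨x, hx⟩ i (t, j)) i j) 2
      (volume.restrict (Ioo 0 x)) := fun i j => memLp_twoMeasure.1 (hκ ⟨x, hx⟩ i) j
  refine ⟨hK, fun z => ?_⟩
  ext i
  rw [Pi.add_apply, integral_mulVec_phi0_apply hx.1 hK]
  have := hκz ⟨x, hx⟩ i z
  simp only [Matrix.of_apply]
  rw [this]; ring

theorem IsTransformationKernel.apply {φ : ℝ → ℂ → Fin 2 → ℂ}
    {K : ℝ → ℝ → Matrix (Fin 2) (Fin 2) ℂ} (hK : IsTransformationKernel φ K) {x : ℝ}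
    (hx : x ∈ Icc 0 π) (z : ℂ) (i : Fin 2) :
    φ x z i = phi0 x z i + ∫ w, K x w.1 i w.2 * phi0 w.1 z w.2 ∂(twoMeasure x) := by
  have h := congrFun ((hK x hx).2 z) i
  rwa [Pi.add_apply, integral_mulVec_phi0_apply hx.1 (hK x hx).1] at h

/-- Exponential sums are controlled by the corresponding sums of the `φ(·, z)`. -/
theorem integral_norm_sq_expSum_le (hp : MemLp p 2 (volume.restrict (Ioo 0 π)))
    (hq : MemLp q 2 (volume.restrict (Ioo 0 π))) {φ : ℝ → ℂ → Fin 2 → ℂ} (hφ : IsPhi p q φ) :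
    ∃ C : ℝ, 0 ≤ C ∧ ∀ (s : Finset ℂ) (c : ℂ → ℂ), ∀ X ∈ Icc 0 π,
      ∫ t in (-X)..X, ‖expSum s c t‖ ^ 2 ≤
        C * ∫ w, ‖∑ z ∈ s, c z * φ w.1 z w.2‖ ^ 2 ∂(twoMeasure X) := by
  obtain ⟨C, hC, h⟩ := exists_ampA_ampB_bound hp hq
  refine ⟨4 * Real.exp (4 * C * π), by positivity, fun s c X hX => ?_⟩
  set f := expSum s c
  have hf : Continuous f := continuous_expSum s c
  set A : ℝ → ℂ := fun x => ∑ z ∈ s, c z * ampA φ z x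
  set G : ℝ → ℂ := fun x => ∑ z ∈ s, c z * ampB φ z x
  have hA : ContinuousOn A (Icc 0 X) := continuousOn_finsetSum _ fun z _ =>
    continuousOn_const.mul ((hφ.ampA_continuousOn z).mono (Icc_subset_Icc_right hX.2))
  have hG : ContinuousOn G (Icc 0 X) := continuousOn_finsetSum _ fun z _ =>
    continuousOn_const.mul ((hφ.ampB_continuousOn z).mono (Icc_subset_Icc_right hX.2))
  set e : ℝ → ℝ := fun x => ‖f x‖ ^ 2 + ‖f (-x)‖ ^ 2
  have he : Continuous e := by fun_prop
  set D : ℝ → ℝ := fun x => ‖A x‖ ^ 2 + ‖G x‖ ^ 2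
  have hD : ContinuousOn D (Icc 0 X) := (hA.norm.pow 2).add (hG.norm.pow 2)
  set E : ℝ → ℝ := fun x => ∫ t in (0 : ℝ)..x, e t
  have hE : Continuous E := intervalIntegral.continuous_primitive
    (fun a b => he.intervalIntegrable a b) 0
  have hEf : ∀ x, ∫ t in (-x)..x, ‖f t‖ ^ 2 = E x := fun x => integral_symm_eq (by fun_prop) x
  -- Here `e = E'`, and the amplitude estimate bounds `e` by the amplitudes and by `E` itself.
  -- Grönwall's inequality thus plays the role of inverting a Volterra operator.
  have hpt : ∀ x ∈ Icc 0 X, e x ≤ 2 * D x + 4 * C * E x := by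
    intro x hx
    obtain ⟨h1, h2⟩ := h φ hφ s c x ⟨hx.1, hx.2.trans hX.2⟩
    rw [hEf] at h1 h2
    have h3 := norm_add_sq_le_two (A x) (-(A x - f x))
    have h4 := norm_add_sq_le_two (G x) (-(G x - f (-x)))
    rw [norm_neg] at h3 h4
    have e3 : A x + -(A x - f x) = f x := by ring
    have e4 : G x + -(G x - f (-x)) = f (-x) := by ring
    rw [e3] at h3
    rw [e4] at h4
    simp only [e, D]
    linarith
  have hDi : ∀ x ∈ Icc 0 X, IntervalIntegrable D volume 0 x := fun x hx =>
    (hD.mono (Icc_subset_Icc_right hx.2)).intervalIntegrable_of_Icc hx.1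
  have hD0 : ∀ x, 0 ≤ D x := fun x => by positivity
  have hgr := le_mul_exp_of_le_add_mul_integral (S := E) (L := X)
    (a := 2 * ∫ t in (0 : ℝ)..X, D t) (b := 4 * C) hE.continuousOn (by positivity) (by
      intro x hx
      have h1 : E x ≤ ∫ t in (0 : ℝ)..x, (2 * D t + 4 * C * E t) :=
        intervalIntegral.integral_mono_on hx.1 (he.intervalIntegrable _ _)
          (((hDi x hx).const_mul 2).add ((hE.const_mul (4 * C)).intervalIntegrable _ _))
          fun t ht => hpt t ⟨ht.1, ht.2.trans hx.2⟩
      rw [intervalIntegral.integral_add ((hDi x hx).const_mul 2)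
        ((hE.const_mul (4 * C)).intervalIntegrable _ _), intervalIntegral.integral_const_mul,
        intervalIntegral.integral_const_mul] at h1
      have h2 : ∫ t in (0 : ℝ)..x, D t ≤ ∫ t in (0 : ℝ)..X, D t :=
        intervalIntegral.integral_mono_interval le_rfl hx.1 hx.2
          (Eventually.of_forall hD0) (hDi X ⟨hX.1, le_rfl⟩)
      linarith) X ⟨hX.1, le_rfl⟩
  have hm : MemLp (fun w : ℝ × Fin 2 => ∑ z ∈ s, c z * φ w.1 z w.2) 2 (twoMeasure X) :=
    memLp_twoMeasure_of_continuousOn fun i => continuousOn_finsetSum _ fun z _ =>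
      continuousOn_const.mul ((hφ.continuousOn_apply z i).mono (Icc_subset_Icc_right hX.2))
  have hDint : ∫ w, ‖∑ z ∈ s, c z * φ w.1 z w.2‖ ^ 2 ∂(twoMeasure X) =
      (∫ t in (0 : ℝ)..X, D t) / 2 := by
    rw [integral_twoMeasure hX.1 ((memLp_two_iff_integrable_sq_norm hm.1).1 hm),
      ← intervalIntegral.integral_div]
    refine intervalIntegral.integral_congr fun t _ => ?_
    simp only [D]
    rw [← norm_half_sub_sq_add_norm_half_add_sq (A t) (G t)]
    congr 3
    · simp only [A, G]
      rw [← Finset.sum_sub_distrib, Finset.mul_sum]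
      exact Finset.sum_congr rfl fun z _ => by rw [(phi_eq_amp φ t z).1]; ring
    · simp only [A, G]
      rw [← Finset.sum_add_distrib, Finset.mul_sum]
      exact Finset.sum_congr rfl fun z _ => by rw [(phi_eq_amp φ t z).2]; ring
  rw [hEf, hDint]
  have h5 : Real.exp (4 * C * X) ≤ Real.exp (4 * C * π) := by
    have := hX.2
    gcongr
  have h6 : 0 ≤ ∫ t in (0 : ℝ)..X, D t := intervalIntegral.integral_nonneg hX.1 fun t _ => hD0 t
  calc E X ≤ _ := hgr
    _ ≤ (2 * ∫ t in (0 : ℝ)..X, D t) * Real.exp (4 * C * π) := by gcongr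
    _ = _ := by ring

/-- The transposed inverse of the transformation operator: functionals in `φ₀` supported in
`(0, X)` are functionals in `φ` supported in `(0, X)`. -/
theorem IsPhi.exists_inverse_row (hp : MemLp p 2 (volume.restrict (Ioo 0 π)))
    (hq : MemLp q 2 (volume.restrict (Ioo 0 π))) {φ : ℝ → ℂ → Fin 2 → ℂ} (hφ : IsPhi p q φ)
    {X : ℝ} (hX : X ∈ Icc 0 π) {g : ℝ × Fin 2 → ℂ} (hg : MemLp g 2 (twoMeasure X)) :
    ∃ k : ℝ × Fin 2 → ℂ, MemLp k 2 (twoMeasure X) ∧ ∀ z,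
      ∫ w, k w * φ w.1 z w.2 ∂(twoMeasure X) = ∫ w, g w * phi0 w.1 z w.2 ∂(twoMeasure X) := by
  obtain ⟨C, hC, h⟩ := integral_norm_sq_expSum_le hp hq hφ
  refine exists_integral_mul_eq_of_forall_norm_sum_le (μ := twoMeasure X)
    (fun (z : ℂ) (w : ℝ × Fin 2) => φ w.1 z w.2) (fun z => ?_) _
    ((∫ w, ‖g w‖ ^ 2 ∂(twoMeasure X)) * (C / 2)) fun s c => ?_
  · exact memLp_twoMeasure_of_continuousOn fun i =>
      (hφ.continuousOn_apply z i).mono (Icc_subset_Icc_right hX.2)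
  -- The functional pairs `g` with the sum of the `φ₀`, whose norm is bounded by that of the
  -- corresponding sum of the `φ` over the same interval `(0, X)`. This is why the support is not
  -- enlarged.
  · have e : ∑ z ∈ s, c z * ∫ w, g w * phi0 w.1 z w.2 ∂(twoMeasure X) =
        ∫ w, g w * ∑ z ∈ s, c z * phi0 w.1 z w.2 ∂(twoMeasure X) := by
      simp only [← integral_const_mul]
      rw [← integral_finsetSum]
      · refine integral_congr_ae (Eventually.of_forall fun w => ?_)
        simp only [Finset.mul_sum]
        exact Finset.sum_congr rfl fun z _ => by ring
      · exact fun z _ => (hg.integrable_mul (memLp_phi0 z X)).const_mul _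
    have hm : MemLp (fun w : ℝ × Fin 2 => ∑ z ∈ s, c z * phi0 w.1 z w.2) 2 (twoMeasure X) :=
      memLp_finsetSum _ fun z _ => (memLp_phi0 z X).const_mul _
    rw [e]
    refine (norm_integral_mul_sq_le hg hm).trans ?_
    rw [integral_norm_sq_sum_phi0 s c hX.1, mul_assoc]
    refine mul_le_mul_of_nonneg_left ?_ (integral_nonneg fun _ => by positivity)
    have := h s c X hX
    linarith

theorem norm_phi0_le_one (t l : ℝ) (i : Fin 2) : ‖phi0 t l i‖ ≤ 1 := by
  fin_cases i
  · simp only [phi0, Fin.zero_eta, Matrix.cons_val_zero]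
    rw [← Complex.ofReal_mul, ← Complex.ofReal_sin, Complex.norm_real]
    exact Real.abs_sin_le_one _
  · simp only [phi0, Fin.mk_one, Matrix.cons_val_one, Matrix.cons_val_fin_one, norm_neg]
    rw [← Complex.ofReal_mul, ← Complex.ofReal_cos, Complex.norm_real]
    exact Real.abs_cos_le_one _

/-- An exponential with real frequency has modulus one, so the estimate behind the kernel, applied
to a single frequency, is uniform on the real line. -/
theorem IsPhi.exists_bound (hp : MemLp p 2 (volume.restrict (Ioo 0 π)))
    (hq : MemLp q 2 (volume.restrict (Ioo 0 π))) {φ : ℝ → ℂ → Fin 2 → ℂ} (hφ : IsPhi p q φ) :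
    ∃ M : ℝ, 0 ≤ M ∧ ∀ x ∈ Icc 0 π, ∀ (l : ℝ) (i : Fin 2), ‖φ x l i‖ ≤ M := by
  obtain ⟨C, hC, h⟩ := norm_sum_phi_sub_phi0_sq_le hp hq
  refine ⟨1 + √(C * (2 * π)), by positivity, fun x hx l i => ?_⟩
  have h1 := h φ hφ {(l : ℂ)} (fun _ => 1) x hx i
  have h2 : ∀ t : ℝ, ‖expSum {(l : ℂ)} (fun _ => 1) t‖ = 1 := fun t => by
    simp only [expSum, Finset.sum_singleton, one_mul]
    have : Complex.I * l * t = ((l * t : ℝ) : ℂ) * Complex.I := by push_cast; ring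
    rw [this, Complex.norm_exp_ofReal_mul_I]
  simp only [Finset.sum_singleton, one_mul, h2, one_pow, intervalIntegral.integral_const,
    smul_eq_mul, mul_one, sub_neg_eq_add] at h1
  have h3 : ‖φ x l i - phi0 x l i‖ ≤ √(C * (2 * π)) := by
    apply Real.le_sqrt_of_sq_le
    refine h1.trans ?_
    have := hx.2
    gcongr
    linarith
  have h4 := norm_add_le (phi0 x l i) (φ x l i - phi0 x l i)
  rw [add_sub_cancel] at h4
  linarith [norm_phi0_le_one x l i]

end

end DiracBVP

/-! ### Fourier transforms of square integrable functions on `(-2π, 2π)` -/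

namespace DiracBVP

/-- Lebesgue measure on `(-2π, 2π)`. -/
noncomputable def wideMeasure : Measure ℝ := volume.restrict (Ioo (-(2 * π)) (2 * π))

instance : IsFiniteMeasure wideMeasure := by unfold wideMeasure; infer_instance

/-- The Fourier transform of a function on `(-2π, 2π)`. -/
noncomputable def ft (g : ℝ → ℂ) (z : ℂ) : ℂ := ∫ s, g s * Complex.exp (Complex.I * z * s) ∂wideMeasure

/-- `f` is the Fourier transform of a square integrable function on `(-2π, 2π)`. -/
def IsFT (f : ℂ → ℂ) : Prop := ∃ g, MemLp g 2 wideMeasure ∧ ∀ z, f z = ft g z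

theorem ae_wideMeasure {P : ℝ → Prop} (h : ∀ s ∈ Ioo (-(2 * π)) (2 * π), P s) :
    ∀ᵐ s ∂wideMeasure, P s :=
  (ae_restrict_iff' measurableSet_Ioo).2 (Eventually.of_forall h)

theorem memLp_wideMeasure_of_continuous {f : ℝ → ℂ} (hf : Continuous f) (r : ENNReal) :
    MemLp f r wideMeasure := hf.continuousOn.memLp_restrict_Ioo r

theorem _root_.MeasureTheory.MemLp.mul_continuous_wide {g h : ℝ → ℂ} (hg : MemLp g 2 wideMeasure)
    (hh : Continuous h) : MemLp (fun s => h s * g s) 2 wideMeasure :=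
  hg.mul (memLp_wideMeasure_of_continuous hh ⊤)

theorem integrable_ft {g : ℝ → ℂ} (hg : MemLp g 2 wideMeasure) (z : ℂ) :
    Integrable (fun s => g s * Complex.exp (Complex.I * z * s)) wideMeasure :=
  hg.integrable_mul (memLp_wideMeasure_of_continuous (by fun_prop) 2)

theorem norm_cexp_I_mul_le (z : ℂ) {s : ℝ} (hs : s ∈ Ioo (-(2 * π)) (2 * π)) :
    ‖Complex.exp (Complex.I * z * s)‖ ≤ Real.exp (2 * π * ‖z‖) := by
  rw [Complex.norm_exp, Real.exp_le_exp]
  have h1 : (Complex.I * z * s).re ≤ ‖Complex.I * z * s‖ := Complex.re_le_norm _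
  refine h1.trans ?_
  rw [norm_mul, norm_mul, Complex.norm_I, one_mul, mul_comm, Complex.norm_real, Real.norm_eq_abs]
  have : |s| ≤ 2 * π := (abs_lt.2 hs).le
  gcongr

theorem norm_cexp_I_real (l s : ℝ) : ‖Complex.exp (Complex.I * l * s)‖ = 1 := by
  have : Complex.I * l * s = ((l * s : ℝ) : ℂ) * Complex.I := by push_cast; ring
  rw [this, Complex.norm_exp_ofReal_mul_I]

theorem hasDerivAt_ft {g : ℝ → ℂ} (hg : MemLp g 2 wideMeasure) (z : ℂ) :
    HasDerivAt (ft g) (ft (fun s => Complex.I * s * g s) z) z := by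
  have hi := hg.integrable (by norm_num : (1 : ENNReal) ≤ 2)
  have key := hasDerivAt_integral_of_dominated_loc_of_deriv_le (μ := wideMeasure) (𝕜 := ℂ)
    (F := fun z s => g s * Complex.exp (Complex.I * z * s))
    (F' := fun z s => (Complex.I * s * g s) * Complex.exp (Complex.I * z * s))
    (x₀ := z) (s := Metric.ball z 1)
    (bound := fun s => 2 * π * ‖g s‖ * Real.exp (2 * π * (‖z‖ + 1)))
    (Metric.ball_mem_nhds z one_pos)
    (Eventually.of_forall fun w => (integrable_ft hg w).1) (integrable_ft hg z)
    (integrable_ft (hg.mul_continuous_wide (h := fun s : ℝ => Complex.I * s) (by fun_prop)) z).1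
    (ae_wideMeasure fun s hs w hw => ?_) ((hi.norm.const_mul _).mul_const _)
    (Eventually.of_forall fun s w _ => ?_)
  · exact key.2
  · rw [norm_mul, norm_mul, norm_mul, Complex.norm_I, one_mul, Complex.norm_real]
    have h1 : ‖s‖ ≤ 2 * π := (abs_lt.2 hs).le
    have h2 : ‖w‖ ≤ ‖z‖ + 1 := by
      have := norm_sub_norm_le w z
      rw [mem_ball_iff_norm] at hw
      linarith
    have h3 : ‖Complex.exp (Complex.I * w * s)‖ ≤ Real.exp (2 * π * (‖z‖ + 1)) :=
      (norm_cexp_I_mul_le w hs).trans (by gcongr)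
    gcongr
  · have h1 : HasDerivAt (fun w : ℂ => Complex.I * w * s) (Complex.I * s) w := by
      simpa using ((hasDerivAt_id w).const_mul Complex.I).mul_const (s : ℂ)
    convert! (h1.cexp).const_mul (g s) using 1
    ring

theorem IsFT.exists_deriv {f : ℂ → ℂ} (hf : IsFT f) :
    ∃ f', IsFT f' ∧ ∀ z, HasDerivAt f (f' z) z := by
  obtain ⟨g, hg, h⟩ := hf
  refine ⟨ft (fun s => Complex.I * s * g s), ⟨_, hg.mul_continuous_wide
    (h := fun s : ℝ => Complex.I * s) (by fun_prop), fun _ => rfl⟩, fun z => ?_⟩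
  rw [funext h]
  exact hasDerivAt_ft hg z

theorem IsFT.exists_bound {f : ℂ → ℂ} (hf : IsFT f) : ∃ M : ℝ, 0 ≤ M ∧ ∀ l : ℝ, ‖f l‖ ≤ M := by
  obtain ⟨g, hg, h⟩ := hf
  refine ⟨∫ s, ‖g s‖ ∂wideMeasure, integral_nonneg fun _ => norm_nonneg _, fun l => ?_⟩
  rw [h, ft]
  refine (norm_integral_le_integral_norm _).trans (le_of_eq ?_)
  simp only [norm_mul, norm_cexp_I_real, mul_one]

theorem IsFT.tendsto {f : ℂ → ℂ} (hf : IsFT f) :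
    Tendsto (fun l : ℝ => f l) (cocompact ℝ) (𝓝 0) := by
  obtain ⟨g, hg, h⟩ := hf
  have h1 := Real.tendsto_integral_exp_smul_cocompact
    ((Ioo (-(2 * π)) (2 * π)).indicator g)
  -- The rescaling by `-(2π)⁻¹` adapts the frequency to the normalisation `exp(-2πils)` of the
  -- Riemann–Lebesgue lemma.
  have hc : Tendsto (fun l : ℝ => (-(2 * π)⁻¹) * l) (cocompact ℝ) (cocompact ℝ) :=
    (Homeomorph.mulLeft₀ (-(2 * π)⁻¹) (by simp [Real.pi_ne_zero])).isClosedEmbedding.tendsto_cocompact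
  have h2 := h1.comp hc
  refine h2.congr fun l => ?_
  rw [h, ft, wideMeasure, ← integral_indicator measurableSet_Ioo]
  refine integral_congr_ae (Eventually.of_forall fun s => ?_)
  simp only
  by_cases hs : s ∈ Ioo (-(2 * π)) (2 * π)
  · rw [indicator_of_mem hs, indicator_of_mem hs, Circle.smul_def, Real.fourierChar_apply,
      smul_eq_mul, mul_comm]
    congr 2
    push_cast
    have : (π : ℂ) ≠ 0 := by exact_mod_cast Real.pi_ne_zero
    field_simp
  · rw [indicator_of_notMem hs, indicator_of_notMem hs, smul_zero]

theorem integral_cexp_int (k : ℤ) : ∫ s, Complex.exp (Complex.I * k * s) ∂wideMeasure =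
    if k = 0 then 4 * π else 0 := by
  rw [wideMeasure, ← integral_Ioc_eq_integral_Ioo,
    ← intervalIntegral.integral_of_le (by linarith [Real.pi_pos])]
  split_ifs with hk
  · simp only [hk, Int.cast_zero, mul_zero, zero_mul, Complex.exp_zero,
      intervalIntegral.integral_const]
    rw [Complex.real_smul]; push_cast; ring
  · have hc : Complex.I * k ≠ 0 := mul_ne_zero Complex.I_ne_zero (by exact_mod_cast hk)
    rw [integral_exp_mul_complex hc]
    have e1 : Complex.I * k * ((2 * π : ℝ) : ℂ) = (k : ℂ) * (2 * π * Complex.I) := by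
      push_cast; ring
    have e2 : Complex.I * k * ((-(2 * π) : ℝ) : ℂ) = ((-k : ℤ) : ℂ) * (2 * π * Complex.I) := by
      push_cast; ring
    rw [e1, e2, Complex.exp_int_mul_two_pi_mul_I, Complex.exp_int_mul_two_pi_mul_I, sub_self,
      zero_div, Complex.ofReal_zero]

/-- Exponentials with integer frequencies stay orthogonal over two full periods. They are not
complete there, but only Bessel's inequality is needed. -/
theorem IsFT.summable {f : ℂ → ℂ} (hf : IsFT f) : Summable fun n : ℤ => ‖f n‖ ^ 2 := by
  obtain ⟨g, hg, h⟩ := hf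
  have hE : ∀ n : ℤ, MemLp (fun s : ℝ => (1 / √(4 * π) : ℝ) *
      Complex.exp (Complex.I * (-n : ℂ) * s)) 2 wideMeasure := fun n =>
    memLp_wideMeasure_of_continuous (by fun_prop) 2
  have hconj : ∀ (n : ℤ) (s : ℝ), (starRingEnd ℂ) ((1 / √(4 * π) : ℝ) *
      Complex.exp (Complex.I * (-n : ℂ) * s)) =
      (1 / √(4 * π) : ℝ) * Complex.exp (Complex.I * n * s) := by
    intro n s
    rw [map_mul, Complex.conj_ofReal, ← Complex.exp_conj]
    congr 2
    simp
  set E : ℤ → Lp ℂ 2 wideMeasure := fun n => (hE n).toLp _ with hEdef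
  have hinner : ∀ (n : ℤ) (u : Lp ℂ 2 wideMeasure), inner ℂ (E n) u =
      (1 / √(4 * π) : ℝ) * ∫ s, u s * Complex.exp (Complex.I * n * s) ∂wideMeasure := by
    intro n u
    rw [L2.inner_def, ← integral_const_mul]
    refine integral_congr_ae ?_
    filter_upwards [(hE n).coeFn_toLp] with s hs
    simp only [hEdef]
    rw [hs, RCLike.inner_apply, hconj]; ring
  have horth : Orthonormal ℂ E := by
    rw [orthonormal_iff_ite]
    intro m n
    rw [hinner]
    have e : ∫ s, E n s * Complex.exp (Complex.I * m * s) ∂wideMeasure =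
        (1 / √(4 * π) : ℝ) * ∫ s, Complex.exp (Complex.I * (m - n : ℤ) * s) ∂wideMeasure := by
      rw [← integral_const_mul]
      refine integral_congr_ae ?_
      filter_upwards [(hE n).coeFn_toLp] with s hs
      simp only [hEdef]
      rw [hs, mul_assoc, ← Complex.exp_add]
      congr 2; push_cast; ring
    rw [e, integral_cexp_int, ← mul_assoc, ← Complex.ofReal_mul]
    have hs : (1 / √(4 * π)) * (1 / √(4 * π)) = 1 / (4 * π) := by
      rw [div_mul_div_comm, Real.mul_self_sqrt (by positivity), one_mul]
    rw [hs]
    by_cases hmn : m = n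
    · have : (π : ℂ) ≠ 0 := by exact_mod_cast Real.pi_ne_zero
      simp [hmn, sub_self]; field_simp
    · rw [if_neg (sub_ne_zero.2 hmn), if_neg hmn, Complex.ofReal_zero, mul_zero]
  have hs := (horth.inner_products_summable (hg.toLp g)).mul_left (4 * π)
  refine hs.congr fun n => ?_
  rw [hinner, h, ft]
  have : ∫ s, (hg.toLp g) s * Complex.exp (Complex.I * n * s) ∂wideMeasure =
      ∫ s, g s * Complex.exp (Complex.I * n * s) ∂wideMeasure := by
    refine integral_congr_ae ?_
    filter_upwards [hg.coeFn_toLp] with s hs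
    rw [hs]
  rw [this, norm_mul, mul_pow, Complex.norm_real, Real.norm_eq_abs, sq_abs, div_pow,
    Real.sq_sqrt (by positivity)]
  have := Real.pi_ne_zero
  field_simp

theorem IsFT.add {f₁ f₂ : ℂ → ℂ} (h₁ : IsFT f₁) (h₂ : IsFT f₂) : IsFT fun z => f₁ z + f₂ z := by
  obtain ⟨g₁, hg₁, h₁⟩ := h₁
  obtain ⟨g₂, hg₂, h₂⟩ := h₂
  refine ⟨fun s => g₁ s + g₂ s, hg₁.add hg₂, fun z => ?_⟩
  change f₁ z + f₂ z = _
  rw [h₁, h₂, ft, ft, ← integral_add (integrable_ft hg₁ z) (integrable_ft hg₂ z), ft]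
  simp only [add_mul]

theorem IsFT.comp_neg {f : ℂ → ℂ} (hf : IsFT f) : IsFT fun z => f (-z) := by
  obtain ⟨g, hg, h⟩ := hf
  have hmp : MeasurePreserving (fun s : ℝ => -s) wideMeasure wideMeasure := by
    have := (Measure.measurePreserving_neg (volume : Measure ℝ)).restrict_preimage
      (s := Ioo (-(2 * π)) (2 * π)) measurableSet_Ioo
    simpa [wideMeasure] using this
  refine ⟨fun s => g (-s), hg.comp_measurePreserving hmp, fun z => ?_⟩
  change f (-z) = _
  rw [h, ft, ft, ← hmp.integral_comp (MeasurableEquiv.neg ℝ).measurableEmbedding]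
  refine integral_congr_ae (Eventually.of_forall fun s => ?_)
  simp

theorem isFT_of_memLp_Ioo {u : ℝ → ℂ} {X : ℝ} (hX : X ≤ 2 * π)
    (hu : MemLp u 2 (volume.restrict (Ioo 0 X))) :
    IsFT fun z => ∫ s in Ioo 0 X, u s * Complex.exp (Complex.I * z * s) := by
  have hsub : Ioo 0 X ⊆ Ioo (-(2 * π)) (2 * π) := Ioo_subset_Ioo (by linarith [Real.pi_pos]) hX
  refine ⟨(Ioo 0 X).indicator u, ?_, fun z => ?_⟩
  · rw [memLp_indicator_iff_restrict measurableSet_Ioo, wideMeasure,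
      Measure.restrict_restrict measurableSet_Ioo, inter_eq_left.2 hsub]
    exact hu
  · have e : ∀ s : ℝ, (Ioo 0 X).indicator u s * Complex.exp (Complex.I * z * s) =
        (Ioo 0 X).indicator (fun s : ℝ => u s * Complex.exp (Complex.I * z * s)) s := fun s => by
      by_cases hs : s ∈ Ioo 0 X <;> simp [hs]
    simp only [ft, wideMeasure, e]
    rw [setIntegral_indicator measurableSet_Ioo, inter_eq_right.2 hsub]

theorem phi0_eq_cexp (t : ℝ) (z : ℂ) :
    phi0 t z 0 = -(Complex.I / 2) * (Complex.exp (Complex.I * z * t) -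
      Complex.exp (Complex.I * (-z) * t)) ∧
    phi0 t z 1 = -(1 / 2) * (Complex.exp (Complex.I * z * t) +
      Complex.exp (Complex.I * (-z) * t)) := by
  have e1 : Complex.I * (-z) * t = -(z * t) * Complex.I := by ring
  have e2 : Complex.I * z * t = z * t * Complex.I := by ring
  rw [e1, e2]
  constructor
  · simp only [phi0, Matrix.cons_val_zero, Complex.sin]; ring
  · simp only [phi0, Matrix.cons_val_one, Matrix.cons_val_fin_one, Complex.cos]; ring

theorem integral_mul_phi0_eq {κ : ℝ × Fin 2 → ℂ} {X : ℝ} (hX : 0 ≤ X)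
    (hκ : MemLp κ 2 (twoMeasure X)) (z : ℂ) :
    ∫ w, κ w * phi0 w.1 z w.2 ∂(twoMeasure X) =
      (∫ s in Ioo 0 X, (-(Complex.I / 2) * κ (s, 0) - 1 / 2 * κ (s, 1)) *
        Complex.exp (Complex.I * z * s)) +
      ∫ s in Ioo 0 X, ((Complex.I / 2) * κ (s, 0) - 1 / 2 * κ (s, 1)) *
        Complex.exp (Complex.I * (-z) * s) := by
  have hκ' := memLp_twoMeasure.1 hκ
  have hi : ∀ (a b : ℂ) (z : ℂ), Integrable (fun s : ℝ => (a * κ (s, 0) - b * κ (s, 1)) *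
      Complex.exp (Complex.I * z * s)) (volume.restrict (Ioo 0 X)) := fun a b z =>
    (((hκ' 0).const_mul a).sub ((hκ' 1).const_mul b)).integrable_mul
      ((by fun_prop : Continuous fun s : ℝ => Complex.exp (Complex.I * z * s)).continuousOn
        |>.memLp_restrict_Ioo 2)
  rw [integral_twoMeasure_mul hX hκ (memLp_phi0 z X), intervalIntegral.integral_of_le hX,
    integral_Ioc_eq_integral_Ioo, ← integral_add (hi _ _ _) (hi _ _ _)]
  refine integral_congr_ae (Eventually.of_forall fun s => ?_)
  simp only [(phi0_eq_cexp s z).1, (phi0_eq_cexp s z).2]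
  ring

theorem isFT_integral_mul_phi0 {κ : ℝ × Fin 2 → ℂ} {X : ℝ} (hX : X ∈ Icc 0 π)
    (hκ : MemLp κ 2 (twoMeasure X)) :
    IsFT fun z => ∫ w, κ w * phi0 w.1 z w.2 ∂(twoMeasure X) := by
  have hκ' := memLp_twoMeasure.1 hκ
  have hX2 : X ≤ 2 * π := by linarith [hX.2, Real.pi_pos]
  simp only [integral_mul_phi0_eq hX.1 hκ]
  exact (isFT_of_memLp_Ioo hX2 (((hκ' 0).const_mul _).sub ((hκ' 1).const_mul _))).add
    (isFT_of_memLp_Ioo hX2 (((hκ' 0).const_mul _).sub ((hκ' 1).const_mul _))).comp_neg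

theorem IsFT.hasDerivAt_real {f f' : ℂ → ℂ} (h : ∀ z, HasDerivAt f (f' z) z) (l : ℝ) :
    HasDerivAt (fun l : ℝ => f l) (f' l) l := (h l).comp_ofReal

/-- Lipschitz and Taylor bounds on the real line. -/
theorem IsFT.exists_lipschitz {f : ℂ → ℂ} (hf : IsFT f) :
    ∃ M : ℝ, 0 ≤ M ∧ ∀ a b : ℝ, ‖f b - f a‖ ≤ M * |b - a| := by
  obtain ⟨f', hf', hd⟩ := hf.exists_deriv
  obtain ⟨M, hM, hb⟩ := hf'.exists_bound
  refine ⟨M, hM, fun a b => ?_⟩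
  exact convex_univ.norm_image_sub_le_of_norm_hasDerivWithin_le (f := fun l : ℝ => f l)
    (f' := fun l : ℝ => f' l)
    (fun x _ => (IsFT.hasDerivAt_real hd x).hasDerivWithinAt) (fun x _ => hb x) (mem_univ a)
    (mem_univ b)

/-- Keeping `f'(a)` in the linear term matters: along the integers `f'` is square summable, so its
product with square summable displacements is summable, which a mere Lipschitz bound would not give.
-/
theorem IsFT.exists_taylor {f f' : ℂ → ℂ} (hf' : IsFT f') (hd : ∀ z, HasDerivAt f (f' z) z) :
    ∃ M : ℝ, 0 ≤ M ∧ ∀ a b : ℝ, ‖f b - f a‖ ≤ ‖f' a‖ * |b - a| + M * |b - a| ^ 2 := by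
  obtain ⟨M, hM, hl⟩ := hf'.exists_lipschitz
  refine ⟨M, hM, fun a b => ?_⟩
  have h1 : ‖f b - f a‖ ≤ (‖f' a‖ + M * |b - a|) * |b - a| := by
    refine (convex_uIcc a b).norm_image_sub_le_of_norm_hasDerivWithin_le (f := fun l : ℝ => f l)
      (f' := fun l : ℝ => f' l)
      (fun x _ => (IsFT.hasDerivAt_real hd x).hasDerivWithinAt) (fun x hx => ?_) left_mem_uIcc
      right_mem_uIcc
    have h2 := hl a x
    have h3 : |x - a| ≤ |b - a| := abs_sub_left_of_mem_uIcc hx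
    have h4 := norm_add_le (f' a) (f' x - f' a)
    rw [add_sub_cancel] at h4
    nlinarith
  linarith

end DiracBVP

/-! ### The characteristic function and zeros of perturbed sines -/

namespace DiracBVP

/-- The characteristic function of the boundary value problem. -/
noncomputable def charFun (φ : ℝ → ℂ → Fin 2 → ℂ) (h₁ h₂ : ℝ) (z : ℂ) : ℂ :=
  (z + h₁) * φ π z 0 + h₂ * φ π z 1

section

variable {p q : ℝ → ℝ} {φ : ℝ → ℂ → Fin 2 → ℂ} {h₁ h₂ : ℝ}

theorem zero_mem_Icc_pi : (0 : ℝ) ∈ Icc 0 π := ⟨le_rfl, Real.pi_pos.le⟩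

theorem pi_mem_Icc_pi : π ∈ Icc 0 π := ⟨Real.pi_pos.le, le_rfl⟩

/-- By uniqueness for the initial value problem, a solution with vanishing first component at `0` is
the multiple `-(y 0 1)` of `φ(·, z)`, so only the condition at `π` is left. -/
theorem isEigenvalue_iff (hp : MemLp p 2 (volume.restrict (Ioo 0 π)))
    (hq : MemLp q 2 (volume.restrict (Ioo 0 π))) (hφ : IsPhi p q φ) (z : ℂ) :
    IsEigenvalue p q h₁ h₂ z ↔ charFun φ h₁ h₂ z = 0 := by
  constructor
  · rintro ⟨y, hy, h0, hbc, x, hx, hne⟩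
    have h := hy.eq_of_eq_zero hp hq ((hφ z).1.smul hp hq (-(y 0 1))) (by
      ext i
      fin_cases i
      · simp [(hφ z).2, h0]
      · simp [(hφ z).2])
    have hc : y 0 1 ≠ 0 := by
      intro hc
      apply hne
      rw [h x hx, hc]; simp
    rw [h π pi_mem_Icc_pi] at hbc
    simp only [Pi.smul_apply, smul_eq_mul] at hbc
    have : -(y 0 1) * charFun φ h₁ h₂ z = 0 := by
      rw [← hbc, charFun]; ring
    exact (mul_eq_zero.1 this).resolve_left (neg_ne_zero.2 hc)
  · intro h
    refine ⟨fun x => φ x z, (hφ z).1, by simp [(hφ z).2], h, 0, zero_mem_Icc_pi, ?_⟩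
    change φ 0 z ≠ 0
    rw [(hφ z).2]
    intro h
    simpa using congrFun h 1

theorem IsPhi.conj_eq (hp : MemLp p 2 (volume.restrict (Ioo 0 π)))
    (hq : MemLp q 2 (volume.restrict (Ioo 0 π))) (hφ : IsPhi p q φ) (l : ℝ) {x : ℝ}
    (hx : x ∈ Icc 0 π) (i : Fin 2) : (starRingEnd ℂ) (φ x l i) = φ x l i := by
  have h1 := (hφ l).1.conj hp hq
  rw [Complex.conj_ofReal] at h1
  have h2 := h1.eq_of_eq_zero hp hq (hφ l).1 (by
    ext i
    fin_cases i <;> simp [(hφ l).2]) x hx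
  exact congrFun h2 i

theorem IsPhi.integral_norm_sq_pos (hφ : IsPhi p q φ) (z : ℂ) :
    0 < ∫ x in (0 : ℝ)..π, (‖φ x z 0‖ ^ 2 + ‖φ x z 1‖ ^ 2) := by
  refine intervalIntegral.integral_pos Real.pi_pos ?_ (fun _ _ => by positivity)
    ⟨0, zero_mem_Icc_pi, ?_⟩
  · exact ((hφ.continuousOn_apply z 0).norm.pow 2).add ((hφ.continuousOn_apply z 1).norm.pow 2)
  · simp [(hφ z).2]

theorem IsPhi.normalizingNumber_pos (hφ : IsPhi p q φ) (hh₂ : 0 < h₂) (l : ℝ) :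
    0 < normalizingNumber φ h₂ l :=
  add_pos_of_pos_of_nonneg (hφ.integral_norm_sq_pos l) (by positivity)

/-- Green's identity for `φ` and its conjugate, with `φ₂(π)` eliminated through the boundary
condition, reads `(z - z̄)(h₂ ∫ |φ|² + |φ₁(π)|²) = 0`. The second factor is positive because `h₂ >
0`. -/
theorem IsPhi.im_eq_zero_of_charFun_eq_zero (hp : MemLp p 2 (volume.restrict (Ioo 0 π)))
    (hq : MemLp q 2 (volume.restrict (Ioo 0 π))) (hφ : IsPhi p q φ) (hh₂ : 0 < h₂) {z : ℂ}
    (hz : charFun φ h₁ h₂ z = 0) : z.im = 0 := by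
  have hg := (hφ z).1.green hp hq ((hφ z).1.conj hp hq) pi_mem_Icc_pi
  simp only [(hφ z).2, Complex.mul_conj] at hg
  have e : ∫ t in (0 : ℝ)..π, ((Complex.normSq (φ t z 0) : ℂ) + Complex.normSq (φ t z 1)) =
      ((∫ x in (0 : ℝ)..π, (‖φ x z 0‖ ^ 2 + ‖φ x z 1‖ ^ 2) : ℝ) : ℂ) := by
    rw [← intervalIntegral.integral_ofReal]
    refine intervalIntegral.integral_congr fun t _ => ?_
    simp [Complex.normSq_eq_norm_sq]
  rw [e] at hg
  set I := ∫ x in (0 : ℝ)..π, (‖φ x z 0‖ ^ 2 + ‖φ x z 1‖ ^ 2)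
  have hI : 0 < I := hφ.integral_norm_sq_pos z
  have hz' := congrArg (starRingEnd ℂ) hz
  simp only [charFun, map_add, map_mul, Complex.conj_ofReal, map_zero] at hz hz'
  have key : (z - (starRingEnd ℂ) z) * (h₂ * I + φ π z 0 * (starRingEnd ℂ) (φ π z 0)) = 0 := by
    simp at hg
    linear_combination (h₂ : ℂ) * hg + (starRingEnd ℂ) (φ π z 0) * hz - φ π z 0 * hz'
  rw [Complex.mul_conj, ← Complex.ofReal_mul, ← Complex.ofReal_add] at key
  have hpos : h₂ * I + Complex.normSq (φ π z 0) ≠ 0 :=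
    (add_pos_of_pos_of_nonneg (mul_pos hh₂ hI) (Complex.normSq_nonneg _)).ne'
  have h1 := (mul_eq_zero.1 key).resolve_right (by exact_mod_cast hpos)
  rw [Complex.sub_conj] at h1
  simpa using h1

/-- Pairing a kernel row with sines and cosines is a Fourier transform. The spectral asymptotics use
the kernel only in this form. -/
theorem IsPhi.exists_isFT (hp : MemLp p 2 (volume.restrict (Ioo 0 π)))
    (hq : MemLp q 2 (volume.restrict (Ioo 0 π))) (hφ : IsPhi p q φ) {x : ℝ} (hx : x ∈ Icc 0 π)
    (i : Fin 2) : ∃ f, IsFT f ∧ ∀ z, φ x z i = phi0 x z i + f z := by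
  obtain ⟨κ, hκ, h⟩ := hφ.exists_kernel_row hp hq hx i
  refine ⟨_, isFT_integral_mul_phi0 hx hκ, fun z => ?_⟩
  simp only [h]; ring

end

theorem two_mul_abs_le_abs_sin_pi_mul {ε : ℝ} (h : |ε| ≤ 1 / 2) : 2 * |ε| ≤ |Real.sin (π * ε)| := by
  have h1 := Real.mul_le_sin (x := π * |ε|) (by positivity) (by nlinarith [Real.pi_pos])
  have h2 : 2 / π * (π * |ε|) = 2 * |ε| := by
    have := Real.pi_ne_zero
    field_simp
  rw [h2] at h1
  refine h1.trans ?_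
  rcases abs_cases ε with ⟨h, _⟩ | ⟨h, _⟩
  · rw [h]; exact le_abs_self _
  · rw [h, mul_neg, Real.sin_neg]; exact neg_le_abs _

theorem sin_pi_mul_add_int (m : ℤ) (ε : ℝ) :
    Real.sin (π * (m + ε)) = (-1) ^ m * Real.sin (π * ε) := by
  have : π * (m + ε) = π * ε + m * π := by ring
  rw [this, Real.sin_add_int_mul_pi]

/-- Zeros of a small perturbation of `sin πl`. -/
theorem exists_zeros_sin_add {ρ ρ' : ℝ → ℝ} {L : ℝ}
    (hd : ∀ l, L < |l| → HasDerivAt ρ (ρ' l) l)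
    (h0 : Tendsto ρ (cocompact ℝ) (𝓝 0)) (h1 : Tendsto ρ' (cocompact ℝ) (𝓝 0)) :
    ∃ N : ℕ, L < N - 1 ∧
      (∀ m : ℤ, (N : ℤ) ≤ |m| → ∃ l : ℝ, |l - m| ≤ 1 / 4 ∧ Real.sin (π * l) + ρ l = 0) ∧
      (∀ m : ℤ, (N : ℤ) ≤ |m| → ∀ l l' : ℝ, |l - m| ≤ 1 / 4 → Real.sin (π * l) + ρ l = 0 →
        |l' - m| ≤ 1 / 4 → Real.sin (π * l') + ρ l' = 0 → l = l') ∧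
      ∀ l : ℝ, N - 1 / 2 ≤ |l| → Real.sin (π * l) + ρ l = 0 →
        ∃ m : ℤ, |l - m| ≤ 1 / 4 ∧ |l - m| ≤ |ρ m| := by
  have e0 : ∀ᶠ l in cocompact ℝ, |ρ l| < 1 / 2 := by
    have := h0.abs.eventually (gt_mem_nhds (by norm_num : |(0 : ℝ)| < 1 / 2))
    exact this
  have e1 : ∀ᶠ l in cocompact ℝ, |ρ' l| < 1 := by
    have := h1.abs.eventually (gt_mem_nhds (by norm_num : |(0 : ℝ)| < 1))
    exact this
  -- The bound `1/2` on `ρ` lies below `sin (π/4)`, which gives a sign change on each window of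
  -- radius `1/4`. The bound `1` on `ρ'` lies below `π/2`, a lower bound for `π |cos|` on the
  -- window, so Rolle's theorem excludes a second zero.
  obtain ⟨T, hT⟩ : ∃ T : ℝ, ∀ l : ℝ, T ≤ |l| → |ρ l| < 1 / 2 ∧ |ρ' l| < 1 := by
    have h := e0.and e1
    rw [← Metric.cobounded_eq_cocompact] at h
    obtain ⟨T, -, hT⟩ := (hasBasis_cobounded_norm (E := ℝ)).eventually_iff.1 h
    exact ⟨T, fun l hl => hT hl⟩
  obtain ⟨N, hN⟩ := exists_nat_gt (max T L + 1)
  have hNT : T + 1 < N := lt_of_le_of_lt (by gcongr; exact le_max_left _ _) hN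
  have hNL : L + 1 < N := lt_of_le_of_lt (by gcongr; exact le_max_right _ _) hN
  have win : ∀ (m : ℤ), (N : ℤ) ≤ |m| → ∀ l : ℝ, |l - m| ≤ 1 / 2 → T ≤ |l| ∧ L < |l| := by
    intro m hm l hl
    have hm' : (N : ℝ) ≤ |(m : ℝ)| := by exact_mod_cast hm
    have := abs_sub_abs_le_abs_sub (m : ℝ) l
    rw [abs_sub_comm] at this
    constructor <;> linarith
  have hsgn : ∀ m : ℤ, |((-1 : ℝ)) ^ m| = 1 := fun m => by simp [abs_zpow]
  have hcos : ∀ (m : ℤ) (l : ℝ), |l - m| ≤ 1 / 4 → 1 / 2 ≤ |Real.cos (π * l)| := by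
    intro m l hl
    have e : π * l = π * (l - m) + m * π := by ring
    rw [e, Real.cos_add_int_mul_pi, abs_mul, hsgn, one_mul]
    have h1 : Real.cos (π / 3) ≤ Real.cos |π * (l - m)| := by
      refine Real.cos_le_cos_of_nonneg_of_le_pi (abs_nonneg _) (by linarith [Real.pi_pos]) ?_
      rw [abs_mul, abs_of_pos Real.pi_pos]
      nlinarith [Real.pi_pos]
    rw [Real.cos_pi_div_three, Real.cos_abs] at h1
    exact h1.trans (le_abs_self _)
  refine ⟨N, by linarith, fun m hm => ?_, fun m hm l l' hl hl0 hl' hl0' => ?_, fun l hl hl0 => ?_⟩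
  · have hcont : ContinuousOn (fun ε : ℝ => (-1 : ℝ) ^ m * (Real.sin (π * (m + ε)) + ρ (m + ε)))
        (Icc (-(1 / 4)) (1 / 4)) := by
      intro ε hε
      have hw := (win m hm (m + ε) (by
        rw [add_sub_cancel_left]; exact (abs_le.2 hε).trans (by norm_num))).2
      have h2 : ContinuousAt (fun ε => ρ (m + ε)) ε :=
        ContinuousAt.comp (f := fun ε : ℝ => (m : ℝ) + ε) (g := ρ) (hd _ hw).continuousAt
          (by fun_prop)
      exact (continuousAt_const.mul ((by fun_prop : ContinuousAt
        (fun ε : ℝ => Real.sin (π * (m + ε))) ε).add h2)).continuousWithinAt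
    have hval : ∀ ε : ℝ, (-1 : ℝ) ^ m * (Real.sin (π * (m + ε)) + ρ (m + ε)) =
        Real.sin (π * ε) + (-1 : ℝ) ^ m * ρ (m + ε) := by
      intro ε
      rw [sin_pi_mul_add_int, mul_add, ← mul_assoc, ← mul_zpow]
      simp
    have hsmall : ∀ ε : ℝ, |ε| ≤ 1 / 4 → |(-1 : ℝ) ^ m * ρ (m + ε)| < 1 / 2 := by
      intro ε hε
      rw [abs_mul, hsgn, one_mul]
      exact (hT _ (win m hm (m + ε) (by rw [add_sub_cancel_left]; linarith)).1).1
    have hs : (1 / 2 : ℝ) ≤ Real.sin (π * (1 / 4)) := by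
      have := Real.mul_le_sin (x := π * (1 / 4)) (by positivity) (by nlinarith [Real.pi_pos])
      have h2 : 2 / π * (π * (1 / 4)) = 1 / 2 := by
        have := Real.pi_ne_zero
        field_simp; norm_num
      linarith
    have iv := intermediate_value_Icc (by norm_num : (-(1 / 4) : ℝ) ≤ 1 / 4) hcont
    obtain ⟨ε, hε, hε0⟩ := iv (show (0 : ℝ) ∈ _ by
      constructor
      · rw [hval, mul_neg, Real.sin_neg]
        have := abs_lt.1 (hsmall (-(1 / 4)) (by norm_num))
        linarith
      · rw [hval]
        have := abs_lt.1 (hsmall (1 / 4) (by norm_num))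
        linarith)
    refine ⟨m + ε, ?_, ?_⟩
    · rw [add_sub_cancel_left]; exact abs_le.2 hε
    · exact (mul_eq_zero.1 hε0).resolve_left (zpow_ne_zero _ (by norm_num))
  · have noroll : ∀ a b : ℝ, |a - m| ≤ 1 / 4 → |b - m| ≤ 1 / 4 → Real.sin (π * a) + ρ a = 0 →
        Real.sin (π * b) + ρ b = 0 → ¬ a < b := by
      intro a b ha hb ha0 hb0 hab
      have hin : ∀ t ∈ Icc a b, |t - m| ≤ 1 / 4 := by
        intro t ht
        rw [abs_le] at ha hb ⊢
        constructor <;> linarith [ht.1, ht.2]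
      have hder : ∀ t ∈ Icc a b, HasDerivAt (fun t => Real.sin (π * t) + ρ t)
          (Real.cos (π * t) * π + ρ' t) t := by
        intro t ht
        have h2 := hd t (win m hm t ((hin t ht).trans (by norm_num))).2
        have h3 : HasDerivAt (fun t : ℝ => π * t) π t := by
          simpa using (hasDerivAt_id t).const_mul π
        exact h3.sin.add h2
      obtain ⟨t, ht, ht0⟩ := exists_hasDerivAt_eq_zero hab
        (fun t ht => (hder t ht).continuousAt.continuousWithinAt) (by rw [ha0, hb0])
        (fun t ht => hder t (Ioo_subset_Icc_self ht))
      have ht' := Ioo_subset_Icc_self ht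
      have h2 := (hT t (win m hm t ((hin t ht').trans (by norm_num))).1).2
      have h3 := hcos m t (hin t ht')
      have h4 : |Real.cos (π * t) * π| = |ρ' t| := by
        have : Real.cos (π * t) * π = -ρ' t := by linarith
        rw [this, abs_neg]
      rw [abs_mul, abs_of_pos Real.pi_pos] at h4
      nlinarith [Real.pi_gt_three]
    exact le_antisymm (not_lt.1 (noroll l' l hl' hl hl0' hl0)) (not_lt.1 (noroll l l' hl hl' hl0 hl0'))
  · refine ⟨round l, ?_⟩
    have hr := abs_sub_round l
    set m := round l
    have hTl : T ≤ |l| := by linarith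
    have hs : |Real.sin (π * l)| = |ρ l| := by
      have : Real.sin (π * l) = -ρ l := by linarith
      rw [this, abs_neg]
    have e : l = m + (l - m) := by ring
    have hs2 : |Real.sin (π * l)| = |Real.sin (π * (l - m))| := by
      conv_lhs => rw [e]
      rw [sin_pi_mul_add_int, abs_mul, hsgn, one_mul]
    -- At a zero, `2|l - m| ≤ |sin πl| = |ρ l|` for the nearest integer `m`. Since `|ρ'| ≤ 1` in
    -- between, `|ρ l| ≤ |ρ m| + |l - m|`; absorbing one copy of `|l - m|` bounds the displacement
    -- by the value of `ρ` at the integer itself.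
    have h2 := two_mul_abs_le_abs_sin_pi_mul hr
    rw [← hs2, hs] at h2
    have hq : |l - m| ≤ 1 / 4 := by linarith [(hT l hTl).1]
    refine ⟨hq, ?_⟩
    have hmN : (N : ℤ) ≤ |m| := by
      by_contra hcon
      push Not at hcon
      have h3 : |m| ≤ (N : ℤ) - 1 := by omega
      have h4 : |(m : ℝ)| ≤ (N : ℝ) - 1 := by exact_mod_cast h3
      have := abs_sub_abs_le_abs_sub l (m : ℝ)
      linarith
    have hlip : |ρ l - ρ m| ≤ 1 * |l - m| := by
      refine (convex_uIcc (m : ℝ) l).norm_image_sub_le_of_norm_hasDerivWithin_le (f := ρ)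
        (f' := ρ') (fun x hx => ?_) (fun x hx => ?_) left_mem_uIcc right_mem_uIcc
      · have := abs_sub_left_of_mem_uIcc hx
        exact (hd x (win m hmN x (this.trans hr)).2).hasDerivWithinAt
      · have := abs_sub_left_of_mem_uIcc hx
        exact (hT x (win m hmN x (this.trans hr)).1).2.le
    have h3 : |ρ l| ≤ |ρ m| + |ρ l - ρ m| := by
      have := abs_add_le (ρ m) (ρ l - ρ m)
      rwa [add_sub_cancel] at this
    linarith

end DiracBVP

/-! ### Enumeration and asymptotics of the eigenvalues -/

namespace DiracBVP

/-- A set of reals that is locally finite and unbounded in both directions is enumerated by `ℤ`. -/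
theorem exists_strictMono_int_range_eq {Z : Set ℝ} (hfin : ∀ a b : ℝ, (Z ∩ Icc a b).Finite)
    (hup : ∀ a : ℝ, ∃ x ∈ Z, a < x) (hdown : ∀ a : ℝ, ∃ x ∈ Z, x < a) :
    ∃ ev : ℤ → ℝ, StrictMono ev ∧ range ev = Z := by
  classical
  have hI : ∀ a b : Z, (Icc a b).Finite := fun a b => by
    refine Set.Finite.of_finite_image (f := Subtype.val) ((hfin a b).subset ?_)
      Subtype.val_injective.injOn
    rintro _ ⟨x, hx, rfl⟩
    exact ⟨x.2, hx⟩
  let : LocallyFiniteOrder Z := LocallyFiniteOrder.ofFiniteIcc hI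
  have : Nonempty Z := let ⟨x, hx, _⟩ := hup 0; ⟨⟨x, hx⟩⟩
  have : NoMaxOrder Z := ⟨fun a => let ⟨x, hx, h⟩ := hup a; ⟨⟨x, hx⟩, h⟩⟩
  have : NoMinOrder Z := ⟨fun a => let ⟨x, hx, h⟩ := hdown a; ⟨⟨x, hx⟩, h⟩⟩
  let : SuccOrder Z := LinearLocallyFiniteOrder.succOrder Z
  let : PredOrder Z := LinearLocallyFiniteOrder.predOrder Z
  let e : Z ≃o ℤ := orderIsoIntOfLinearSuccPredArch
  refine ⟨fun n => (e.symm n : ℝ), fun m n hmn => e.symm.strictMono hmn, ?_⟩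
  ext x
  constructor
  · rintro ⟨n, rfl⟩; exact (e.symm n).2
  · intro hx; exact ⟨e ⟨x, hx⟩, by simp⟩

/-- An enumeration of a set with one point near each large integer is asymptotic to a shift. -/
theorem exists_shift_of_near_int {ev : ℤ → ℝ} (hev : StrictMono ev) {N : ℕ} {ρ : ℤ → ℝ}
    (h1 : ∀ m : ℤ, (N : ℤ) ≤ m → ∃ n, |ev n - m| ≤ 1 / 4)
    (h1u : ∀ m : ℤ, (N : ℤ) ≤ m → ∀ n n', |ev n - m| ≤ 1 / 4 → |ev n' - m| ≤ 1 / 4 → n = n')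
    (h2 : ∀ n, N - 1 / 2 ≤ ev n → ∃ m : ℤ, |ev n - m| ≤ 1 / 4 ∧ |ev n - m| ≤ |ρ m|) :
    ∃ (n₀ : ℕ) (k : ℤ), ∀ n : ℤ, (n₀ : ℤ) ≤ n →
      |ev n - (n + k : ℤ)| ≤ 1 / 4 ∧ |ev n - (n + k : ℤ)| ≤ |ρ (n + k)| := by
  have close : ∀ (x : ℝ) (a b : ℤ), |x - a| ≤ 1 / 4 → |x - b| ≤ 1 / 4 → a = b := by
    intro x a b ha hb
    have h : |(a : ℝ) - b| < 1 := by
      have := abs_sub_le (a : ℝ) x b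
      rw [abs_sub_comm (a : ℝ) x] at this
      linarith
    have h' : |a - b| < 1 := by exact_mod_cast h
    exact sub_eq_zero.1 (Int.abs_lt_one_iff.1 h')
  obtain ⟨n₁, hn₁⟩ := h1 N le_rfl
  set k : ℤ := N - n₁ with hk
  -- The point near the next integer has a larger index than `n`, so `ev (n + 1)` does not exceed
  -- it. It lies near some integer in this range, and uniqueness excludes the integer already used,
  -- so indices and integers advance together.
  have hind : ∀ n : ℤ, n₁ ≤ n → |ev n - (n + k : ℤ)| ≤ 1 / 4 := by
    intro n hn
    induction n, hn using Int.leInduction with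
    | base => rw [hk]; simpa using hn₁
    | succ n hn ih =>
      have hN : (N : ℤ) ≤ n + k := by omega
      have hNr : (N : ℝ) ≤ ((n + k : ℤ) : ℝ) := by exact_mod_cast hN
      obtain ⟨n', hn'⟩ := h1 (n + k + 1) (by omega)
      have ih' := abs_le.1 ih
      have hn'' := abs_le.1 hn'
      have hlt : n < n' := by
        rw [← hev.lt_iff_lt]
        push_cast at hn'' ih'
        linarith
      have hle : ev (n + 1) ≤ ev n' := hev.monotone (by omega)
      have hgt : ev n < ev (n + 1) := hev (by omega)
      obtain ⟨m, hm, -⟩ := h2 (n + 1) (by linarith)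
      have hm' := abs_le.1 hm
      have m1 : n + k ≤ m := by
        by_contra hcon
        have : m + 1 ≤ n + k := by omega
        have : (m : ℝ) + 1 ≤ ((n + k : ℤ) : ℝ) := by exact_mod_cast this
        linarith
      have m2 : m ≠ n + k := by
        rintro rfl
        have := h1u (n + k) hN n (n + 1) ih hm
        omega
      have m3 : m ≤ n + k + 1 := by
        by_contra hcon
        have : n + k + 1 + 1 ≤ m := by omega
        have : ((n + k + 1 : ℤ) : ℝ) + 1 ≤ m := by exact_mod_cast this
        linarith
      have : m = n + 1 + k := by omega
      rwa [this] at hm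
  refine ⟨n₁.toNat, k, fun n hn => ?_⟩
  have hn' : n₁ ≤ n := (Int.self_le_toNat n₁).trans hn
  have ha := hind n hn'
  refine ⟨ha, ?_⟩
  have hNr : (N : ℝ) ≤ ((n + k : ℤ) : ℝ) := by
    have : (N : ℤ) ≤ n + k := by omega
    exact_mod_cast this
  obtain ⟨m, hm, hm2⟩ := h2 n (by have := abs_le.1 ha; linarith)
  rwa [close _ _ _ ha hm]

section

variable {p q : ℝ → ℝ} {φ : ℝ → ℂ → Fin 2 → ℂ} {h₁ h₂ : ℝ}

theorem phi0_pi_real (l : ℝ) : phi0 π l 0 = (Real.sin (π * l) : ℝ) ∧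
    phi0 π l 1 = (-Real.cos (π * l) : ℝ) := by
  constructor
  · simp [phi0, mul_comm]
  · simp [phi0, mul_comm]

theorem tendsto_inv_add_cocompact (a : ℝ) :
    Tendsto (fun l : ℝ => (l + a)⁻¹) (cocompact ℝ) (𝓝 0) := by
  have h1 : Tendsto (fun l : ℝ => l + a) (cocompact ℝ) (cocompact ℝ) :=
    (Homeomorph.addRight a).isClosedEmbedding.tendsto_cocompact
  rw [← Metric.cobounded_eq_cocompact] at h1 ⊢
  exact tendsto_inv₀_cobounded.comp h1

/-- For real `|l| > |h₁|`, dividing by `l + h₁` leaves `sin πl + ρ(l)`, where `ρ` is a Fourier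
transform of an `L²` function plus a bounded multiple of `(l + h₁)⁻¹`. So `ρ` and `ρ'` vanish at
infinity, and both parts of `ρ` are square summable over the integers. -/
theorem exists_charFun_zeros (hp : MemLp p 2 (volume.restrict (Ioo 0 π)))
    (hq : MemLp q 2 (volume.restrict (Ioo 0 π))) (hφ : IsPhi p q φ) (h₁ h₂ : ℝ) :
    ∃ (N : ℕ) (ρ : ℤ → ℝ), Summable (fun m => ρ m ^ 2) ∧
      (∀ m : ℤ, (N : ℤ) ≤ |m| → ∃ l : ℝ, |l - m| ≤ 1 / 4 ∧ charFun φ h₁ h₂ l = 0) ∧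
      (∀ m : ℤ, (N : ℤ) ≤ |m| → ∀ l l' : ℝ, |l - m| ≤ 1 / 4 → charFun φ h₁ h₂ l = 0 →
        |l' - m| ≤ 1 / 4 → charFun φ h₁ h₂ l' = 0 → l = l') ∧
      ∀ l : ℝ, N - 1 / 2 ≤ |l| → charFun φ h₁ h₂ l = 0 →
        ∃ m : ℤ, |l - m| ≤ 1 / 4 ∧ |l - m| ≤ |ρ m| := by
  obtain ⟨f₀, hf₀, e₀⟩ := hφ.exists_isFT hp hq pi_mem_Icc_pi 0
  obtain ⟨f₁, hf₁, e₁⟩ := hφ.exists_isFT hp hq pi_mem_Icc_pi 1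
  obtain ⟨f₀', hf₀', d₀⟩ := hf₀.exists_deriv
  obtain ⟨f₁', hf₁', d₁⟩ := hf₁.exists_deriv
  have re_deriv : ∀ {f f' : ℂ → ℂ}, (∀ z, HasDerivAt f (f' z) z) → ∀ l : ℝ,
      HasDerivAt (fun l : ℝ => (f l).re) (f' l).re l := fun h l => (h l).real_of_complex
  have re_eq : ∀ l : ℝ, ((f₀ l).re : ℂ) = f₀ l ∧ ((f₁ l).re : ℂ) = f₁ l := by
    intro l
    have c0 := hφ.conj_eq hp hq l pi_mem_Icc_pi 0
    have c1 := hφ.conj_eq hp hq l pi_mem_Icc_pi 1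
    rw [e₀, (phi0_pi_real l).1, map_add, Complex.conj_ofReal, add_right_inj] at c0
    rw [e₁, (phi0_pi_real l).2, map_add, Complex.conj_ofReal, add_right_inj] at c1
    exact ⟨Complex.conj_eq_iff_re.1 c0, Complex.conj_eq_iff_re.1 c1⟩
  set g : ℝ → ℝ := fun l => h₂ * (-Real.cos (π * l) + (f₁ l).re) with hg
  set g' : ℝ → ℝ := fun l => h₂ * (Real.sin (π * l) * π + (f₁' l).re) with hg'
  set ρ : ℝ → ℝ := fun l => (f₀ l).re + g l * (l + h₁)⁻¹ with hρ
  set ρ' : ℝ → ℝ := fun l => (f₀' l).re + (g' l * (l + h₁)⁻¹ + g l * (-1 / (l + h₁) ^ 2)) with hρ'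
  have hgd : ∀ l, HasDerivAt g (g' l) l := by
    intro l
    have h3 : HasDerivAt (fun t : ℝ => π * t) π l := by
      simpa using (hasDerivAt_id l).const_mul π
    have := (h3.cos.neg.add (re_deriv d₁ l)).const_mul h₂
    convert! this using 1
    simp only [hg']
    ring
  have ne : ∀ l : ℝ, |h₁| < |l| → l + h₁ ≠ 0 := by
    intro l hl h0
    have : l = -h₁ := by linarith
    rw [this, abs_neg] at hl
    exact lt_irrefl _ hl
  have hd : ∀ l, |h₁| < |l| → HasDerivAt ρ (ρ' l) l := fun l hl =>
    (re_deriv d₀ l).add ((hgd l).mul (((hasDerivAt_id l).add_const h₁).fun_inv (ne l hl)))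
  obtain ⟨M₁, hM₁, b₁⟩ := hf₁.exists_bound
  obtain ⟨M₁', hM₁', b₁'⟩ := hf₁'.exists_bound
  have gb : ∀ l, |g l| ≤ |h₂| * (1 + M₁) := by
    intro l
    rw [hg, abs_mul]
    gcongr
    refine (abs_add_le _ _).trans ?_
    rw [abs_neg]
    exact add_le_add (Real.abs_cos_le_one _) ((Complex.abs_re_le_norm _).trans (b₁ l))
  have gb' : ∀ l, |g' l| ≤ |h₂| * (π + M₁') := by
    intro l
    rw [hg', abs_mul]
    gcongr
    refine (abs_add_le _ _).trans ?_
    refine add_le_add ?_ ((Complex.abs_re_le_norm _).trans (b₁' l))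
    rw [abs_mul, abs_of_pos Real.pi_pos]
    nlinarith [Real.abs_sin_le_one (π * l), Real.pi_pos]
  have tinv := tendsto_inv_add_cocompact h₁
  have retend : ∀ {f : ℂ → ℂ}, IsFT f → Tendsto (fun l : ℝ => (f l).re) (cocompact ℝ) (𝓝 0) := by
    intro f hf
    have := (Complex.continuous_re.tendsto 0).comp hf.tendsto
    rw [Complex.zero_re] at this
    exact this
  have bt : ∀ (u v : ℝ → ℝ) (C : ℝ), (∀ l, |u l| ≤ C) → Tendsto v (cocompact ℝ) (𝓝 0) →
      Tendsto (fun l => u l * v l) (cocompact ℝ) (𝓝 0) := by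
    intro u v C hu hv
    have h3 : Tendsto (fun l => C * |v l|) (cocompact ℝ) (𝓝 0) := by
      simpa using hv.abs.const_mul C
    refine squeeze_zero_norm (fun l => ?_) h3
    rw [Real.norm_eq_abs, abs_mul]
    exact mul_le_mul_of_nonneg_right (hu l) (abs_nonneg _)
  have t0 : Tendsto ρ (cocompact ℝ) (𝓝 0) := by
    simpa using (retend hf₀).add (bt g _ _ gb tinv)
  have t1 : Tendsto ρ' (cocompact ℝ) (𝓝 0) := by
    have h3 : Tendsto (fun l : ℝ => -1 / (l + h₁) ^ 2) (cocompact ℝ) (𝓝 0) := by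
      have := (tinv.pow 2).neg
      simp only [ne_eq, OfNat.ofNat_ne_zero, not_false_eq_true, zero_pow, neg_zero] at this
      refine this.congr fun l => ?_
      simp [neg_div]
    simpa using (retend hf₀').add ((bt g' _ _ gb' tinv).add (bt g _ _ gb h3))
  obtain ⟨N, hN, A, U, E⟩ := exists_zeros_sin_add hd t0 t1
  have hiff : ∀ l : ℝ, |h₁| < |l| → (charFun φ h₁ h₂ l = 0 ↔ Real.sin (π * l) + ρ l = 0) := by
    intro l hl
    have e : charFun φ h₁ h₂ l = (((l + h₁) * (Real.sin (π * l) + ρ l) : ℝ) : ℂ) := by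
      rw [charFun, e₀, e₁, (phi0_pi_real l).1, (phi0_pi_real l).2, ← (re_eq l).1, ← (re_eq l).2]
      have h3 : (l + h₁) * (Real.sin (π * l) + ρ l) =
          (l + h₁) * (Real.sin (π * l) + (f₀ l).re) + g l := by
        have := ne l hl
        simp only [hρ]; field_simp; ring
      rw [h3, hg]
      push_cast; ring
    rw [e, Complex.ofReal_eq_zero, mul_eq_zero]
    exact or_iff_right (ne l hl)
  have hbig : ∀ (m : ℤ) (l : ℝ), (N : ℤ) ≤ |m| → |l - m| ≤ 1 / 4 → |h₁| < |l| := by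
    intro m l hm hl
    have hm' : (N : ℝ) ≤ |(m : ℝ)| := by exact_mod_cast hm
    have := abs_sub_abs_le_abs_sub (m : ℝ) l
    rw [abs_sub_comm] at this
    linarith
  refine ⟨N, fun m => ρ m, ?_, ?_, ?_, ?_⟩
  · have s1 := (hf₀.summable).mul_left 2
    have s2 : Summable fun m : ℤ => 2 * (|h₂| * (1 + M₁)) ^ 2 * ((m + h₁)⁻¹) ^ 2 := by
      refine Summable.mul_left _ ?_
      have := (Real.summable_one_div_int_add_rpow h₁ 2).2 one_lt_two
      refine this.congr fun m => ?_
      rw [Real.rpow_two, sq_abs, one_div, inv_pow]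
    refine Summable.of_nonneg_of_le (fun _ => sq_nonneg _) (fun m => ?_) (s1.add s2)
    have h3 : ρ m ^ 2 ≤ 2 * (f₀ (m : ℝ)).re ^ 2 + 2 * (g m * (m + h₁)⁻¹) ^ 2 := by
      simp only [hρ]
      nlinarith [sq_nonneg ((f₀ (m : ℝ)).re - g m * (m + h₁)⁻¹)]
    have h4 : (f₀ (m : ℝ)).re ^ 2 ≤ ‖f₀ m‖ ^ 2 := by
      rw [← sq_abs]
      have := Complex.abs_re_le_norm (f₀ (m : ℝ))
      rw [Complex.ofReal_intCast] at *
      gcongr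
    have h5 : (g m * (m + h₁)⁻¹) ^ 2 ≤ (|h₂| * (1 + M₁)) ^ 2 * ((m + h₁)⁻¹) ^ 2 := by
      rw [mul_pow]
      refine mul_le_mul_of_nonneg_right ?_ (sq_nonneg _)
      rw [← sq_abs]
      have := gb m
      gcongr
    linarith
  · intro m hm
    obtain ⟨l, hl, h0⟩ := A m hm
    exact ⟨l, hl, (hiff l (hbig m l hm hl)).2 h0⟩
  · intro m hm l l' hl h0 hl' h0'
    exact U m hm l l' hl ((hiff l (hbig m l hm hl)).1 h0) hl' ((hiff l' (hbig m l' hm hl')).1 h0')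
  · intro l hl h0
    exact E l hl ((hiff l (by linarith)).1 h0)

theorem IsPhi.differentiable_charFun (hp : MemLp p 2 (volume.restrict (Ioo 0 π)))
    (hq : MemLp q 2 (volume.restrict (Ioo 0 π))) (hφ : IsPhi p q φ) :
    Differentiable ℂ (charFun φ h₁ h₂) := by
  obtain ⟨f₀, hf₀, e₀⟩ := hφ.exists_isFT hp hq pi_mem_Icc_pi 0
  obtain ⟨f₁, hf₁, e₁⟩ := hφ.exists_isFT hp hq pi_mem_Icc_pi 1
  obtain ⟨f₀', hf₀', d₀⟩ := hf₀.exists_deriv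
  obtain ⟨f₁', hf₁', d₁⟩ := hf₁.exists_deriv
  have c0 : Differentiable ℂ f₀ := fun z => (d₀ z).differentiableAt
  have c1 : Differentiable ℂ f₁ := fun z => (d₁ z).differentiableAt
  unfold charFun
  simp only [e₀, e₁, phi0, Matrix.cons_val_zero, Matrix.cons_val_one, Matrix.cons_val_fin_one]
  fun_prop

/-- An accumulation point of zeros would make the entire function vanish identically, contradicting
the location of its large zeros. -/
theorem finite_charFun_zeros (hp : MemLp p 2 (volume.restrict (Ioo 0 π)))
    (hq : MemLp q 2 (volume.restrict (Ioo 0 π))) (hφ : IsPhi p q φ) (a b : ℝ) :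
    ({l : ℝ | charFun φ h₁ h₂ l = 0} ∩ Icc a b).Finite := by
  by_contra hinf
  obtain ⟨x, -, hx⟩ := Set.Infinite.exists_accPt_of_subset_isCompact hinf isCompact_Icc
    inter_subset_right
  have hfr : ∃ᶠ z in 𝓝[≠] (x : ℂ), charFun φ h₁ h₂ z = 0 := by
    have h1 : ∃ᶠ l in 𝓝[≠] x, charFun φ h₁ h₂ (l : ℝ) = 0 :=
      (accPt_iff_frequently_nhdsNE.1 hx).mono fun l hl => hl.1
    have h2 : Tendsto (fun l : ℝ => (l : ℂ)) (𝓝[≠] x) (𝓝[≠] (x : ℂ)) := by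
      refine tendsto_nhdsWithin_iff.2 ⟨?_, ?_⟩
      · exact (Complex.continuous_ofReal.tendsto x).mono_left nhdsWithin_le_nhds
      · filter_upwards [self_mem_nhdsWithin] with l hl
        simpa using hl
    exact h2.frequently h1
  have han : AnalyticOnNhd ℂ (charFun φ h₁ h₂) univ :=
    (hφ.differentiable_charFun hp hq).differentiableOn.analyticOnNhd isOpen_univ
  have hz := han.eqOn_zero_of_preconnected_of_frequently_eq_zero isPreconnected_univ (mem_univ _) hfr
  obtain ⟨N, ρ, -, -, -, E⟩ := exists_charFun_zeros hp hq hφ h₁ h₂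
  -- The half-integer `N + 1/2` is in the range where zeros lie within `1/4` of an integer, which it
  -- does not.
  obtain ⟨m, hm, -⟩ := E (N + 1 / 2) (by rw [abs_of_nonneg (by positivity)]; linarith)
    (hz (mem_univ _))
  rw [abs_le] at hm
  have h1 : (N : ℝ) < m := by linarith [hm.2]
  have h2 : (m : ℝ) < N + 1 := by linarith [hm.1]
  have h1' : (N : ℤ) < m := by exact_mod_cast h1
  have h2' : m < (N : ℤ) + 1 := by exact_mod_cast h2
  omega

theorem exists_isEigenvalueEnumeration (hp : MemLp p 2 (volume.restrict (Ioo 0 π)))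
    (hq : MemLp q 2 (volume.restrict (Ioo 0 π))) (h₁ : ℝ) (hh₂ : 0 < h₂) :
    ∃ ev, IsEigenvalueEnumeration p q h₁ h₂ ev := by
  obtain ⟨φ, hφ⟩ := exists_isPhi hp hq
  obtain ⟨N, ρ, -, A, -, -⟩ := exists_charFun_zeros hp hq hφ h₁ h₂
  obtain ⟨ev, hev, hr⟩ := exists_strictMono_int_range_eq
    (Z := {l : ℝ | charFun φ h₁ h₂ l = 0}) (finite_charFun_zeros hp hq hφ) (fun a => by
      obtain ⟨M, hM⟩ := exists_nat_gt (a + 1)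
      obtain ⟨l, hl, h0⟩ := A (N + M : ℕ) (by rw [abs_of_nonneg (by positivity)]; push_cast; omega)
      refine ⟨l, h0, ?_⟩
      rw [abs_le] at hl
      push_cast at hl
      have : (0 : ℝ) ≤ N := by positivity
      linarith) (fun a => by
      obtain ⟨M, hM⟩ := exists_nat_gt (-a + 1)
      obtain ⟨l, hl, h0⟩ := A (-(N + M : ℕ)) (by
        rw [abs_neg, abs_of_nonneg (by positivity)]; push_cast; omega)
      refine ⟨l, h0, ?_⟩
      rw [abs_le] at hl
      push_cast at hl
      have : (0 : ℝ) ≤ N := by positivity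
      linarith)
  refine ⟨ev, hev, fun z => ?_⟩
  rw [isEigenvalue_iff hp hq hφ]
  constructor
  · intro hz
    have him := hφ.im_eq_zero_of_charFun_eq_zero hp hq hh₂ hz
    have hz' : z = (z.re : ℂ) := by
      apply Complex.ext <;> simp [him]
    have : z.re ∈ range ev := by
      rw [hr, mem_ofPred_eq, ← hz']; exact hz
    obtain ⟨n, hn⟩ := this
    exact ⟨n, by rw [hn]; exact hz'⟩
  · rintro ⟨n, rfl⟩
    have : ev n ∈ {l : ℝ | charFun φ h₁ h₂ l = 0} := hr ▸ mem_range_self n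
    exact this

theorem IsEigenvalueEnumeration.charFun_eq_zero_iff {ev : ℤ → ℝ}
    (hp : MemLp p 2 (volume.restrict (Ioo 0 π)))
    (hq : MemLp q 2 (volume.restrict (Ioo 0 π))) (hφ : IsPhi p q φ)
    (hev : IsEigenvalueEnumeration p q h₁ h₂ ev) (l : ℝ) :
    charFun φ h₁ h₂ l = 0 ↔ ∃ n, l = ev n := by
  rw [← isEigenvalue_iff hp hq hφ, hev.2]
  simp only [Complex.ofReal_inj]

/-- The negative end is reduced to the positive one by passing to `n ↦ -ev (-n)`. No count of the
zeros in the middle is made, so the two shifts `k` and `k'` remain unrelated; the convergence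
arguments tolerate this. -/
theorem IsEigenvalueEnumeration.exists_asymptotics {ev : ℤ → ℝ}
    (hp : MemLp p 2 (volume.restrict (Ioo 0 π)))
    (hq : MemLp q 2 (volume.restrict (Ioo 0 π))) (hφ : IsPhi p q φ)
    (hev : IsEigenvalueEnumeration p q h₁ h₂ ev) :
    ∃ (ρ : ℤ → ℝ) (n₀ : ℕ) (k k' : ℤ), Summable (fun m => ρ m ^ 2) ∧
      (∀ n : ℤ, (n₀ : ℤ) ≤ n → |ev n - (n + k : ℤ)| ≤ |ρ (n + k)|) ∧
      (∀ n : ℤ, n ≤ -(n₀ : ℤ) → |ev n - (n + k' : ℤ)| ≤ |ρ (n + k')|) := by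
  obtain ⟨N, ρ, hρ, A, U, E⟩ := exists_charFun_zeros hp hq hφ h₁ h₂
  have hz : ∀ n, charFun φ h₁ h₂ (ev n) = 0 := fun n =>
    (hev.charFun_eq_zero_iff hp hq hφ _).2 ⟨n, rfl⟩
  obtain ⟨n₁, k, hk⟩ := exists_shift_of_near_int (ev := ev) (N := N) (ρ := ρ) hev.1
    (fun m hm => by
      obtain ⟨l, hl, h0⟩ := A m (hm.trans (le_abs_self m))
      obtain ⟨n, rfl⟩ := (hev.charFun_eq_zero_iff hp hq hφ l).1 h0
      exact ⟨n, hl⟩)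
    (fun m hm n n' hn hn' =>
      hev.1.injective (U m (hm.trans (le_abs_self m)) _ _ hn (hz n) hn' (hz n')))
    (fun n hn => E _ (hn.trans (le_abs_self _)) (hz n))
  obtain ⟨n₂, k', hk'⟩ := exists_shift_of_near_int (ev := fun n => -ev (-n)) (N := N)
    (ρ := fun m => ρ (-m)) (fun a b hab => neg_lt_neg (hev.1 (neg_lt_neg hab)))
    (fun m hm => by
      obtain ⟨l, hl, h0⟩ := A (-m) (by rw [abs_neg]; exact hm.trans (le_abs_self m))
      obtain ⟨n, rfl⟩ := (hev.charFun_eq_zero_iff hp hq hφ l).1 h0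
      refine ⟨-n, ?_⟩
      rw [neg_neg, ← abs_neg]
      convert hl using 2
      push_cast; ring)
    (fun m hm n n' hn hn' => by
      have e : ∀ n : ℤ, |-ev (-n) - m| = |ev (-n) - (-m : ℤ)| := fun n => by
        rw [← abs_neg]; congr 1; push_cast; ring
      rw [e] at hn hn'
      have := hev.1.injective (U (-m) (by rw [abs_neg]; exact hm.trans (le_abs_self m)) _ _ hn
        (hz _) hn' (hz _))
      exact neg_injective this)
    (fun n hn => by
      obtain ⟨m, h3, h4⟩ := E (ev (-n)) (hn.trans (neg_le_abs _)) (hz _)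
      have e : |-ev (-n) - ((-m : ℤ) : ℝ)| = |ev (-n) - m| := by
        rw [← abs_neg]; congr 1; push_cast; ring
      exact ⟨-m, by rwa [e], by rwa [e, neg_neg]⟩)
  refine ⟨ρ, max n₁ n₂, k, -k', hρ, fun n hn => (hk n ?_).2, fun n hn => ?_⟩
  · push_cast at hn; exact (le_max_left _ _).trans hn
  · have h3 := (hk' (-n) (by
      push_cast at hn
      have := le_max_right (n₁ : ℤ) n₂
      omega)).2
    rw [neg_neg] at h3
    have e : |-ev n - ((-n + k' : ℤ) : ℝ)| = |ev n - ((n + -k' : ℤ) : ℝ)| := by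
      rw [← abs_neg]; congr 1; push_cast; ring
    have e2 : -(-n + k') = n + -k' := by ring
    rwa [e, e2] at h3

end

end DiracBVP

/-! ### Asymptotics of the normalizing numbers -/

namespace DiracBVP

variable {p q : ℝ → ℝ} {φ : ℝ → ℂ → Fin 2 → ℂ} {h₁ h₂ : ℝ} {ev : ℤ → ℝ}

/-- The integer attached to the index `n` when the two halves of `ℤ` are shifted separately. -/
def shiftIndex (k k' n : ℤ) : ℤ := n + if 0 ≤ n then k else k'

theorem summable_comp_shiftIndex {u : ℤ → ℝ} (hu : Summable u) (h0 : ∀ n, 0 ≤ u n) (k k' : ℤ) :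
    Summable fun n => u (shiftIndex k k' n) := by
  have h1 : Summable fun n : ℤ => u (n + k) := hu.comp_injective (add_left_injective k)
  have h2 : Summable fun n : ℤ => u (n + k') := hu.comp_injective (add_left_injective k')
  refine Summable.of_nonneg_of_le (fun n => h0 _) (fun n => ?_) (h1.add h2)
  unfold shiftIndex
  split_ifs
  · exact le_add_of_nonneg_right (h0 _)
  · exact le_add_of_nonneg_left (h0 _)

theorem IsEigenvalueEnumeration.exists_shift (hp : MemLp p 2 (volume.restrict (Ioo 0 π)))
    (hq : MemLp q 2 (volume.restrict (Ioo 0 π))) (hφ : IsPhi p q φ)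
    (hev : IsEigenvalueEnumeration p q h₁ h₂ ev) :
    ∃ k k' : ℤ, Summable fun n => (ev n - shiftIndex k k' n) ^ 2 := by
  obtain ⟨ρ, n₀, k, k', hρ, h1, h2⟩ := hev.exists_asymptotics hp hq hφ
  refine ⟨k, k', Summable.of_norm_bounded_eventually
    (summable_comp_shiftIndex hρ (fun _ => sq_nonneg _) k k') ?_⟩
  have hfin : (Set.Icc (-(n₀ : ℤ) - 1) n₀).Finite := Set.finite_Icc _ _
  filter_upwards [hfin.compl_mem_cofinite] with n hn
  rw [Real.norm_eq_abs, abs_of_nonneg (sq_nonneg _)]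
  refine sq_le_sq.2 ?_
  rw [mem_compl_iff, mem_Icc, not_and_or, not_le, not_le] at hn
  rcases hn with hn | hn
  · have h3 : ¬ 0 ≤ n := by omega
    simpa only [shiftIndex, if_neg h3] using h2 n (by omega)
  · have h3 : 0 ≤ n := by omega
    simpa only [shiftIndex, if_pos h3] using h1 n (by omega)

/-- A Fourier transform is Lipschitz on the real line, so square summable displacements of the nodes
preserve square summability. -/
theorem IsFT.summable_comp {f : ℂ → ℂ} (hf : IsFT f) {k k' : ℤ}
    (hev : Summable fun n => (ev n - shiftIndex k k' n) ^ 2) :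
    Summable fun n => ‖f (ev n)‖ ^ 2 := by
  obtain ⟨M, hM, h⟩ := hf.exists_lipschitz
  have h1 := summable_comp_shiftIndex hf.summable (fun _ => sq_nonneg _) k k'
  refine Summable.of_nonneg_of_le (fun _ => sq_nonneg _) (fun n => ?_)
    ((h1.mul_left 2).add (hev.mul_left (2 * M ^ 2)))
  have h2 := h (shiftIndex k k' n) (ev n)
  have h3 : ‖f (ev n)‖ ≤ ‖f (shiftIndex k k' n)‖ + M * |ev n - shiftIndex k k' n| := by
    have := norm_le_norm_add_norm_sub' (f (ev n)) (f (shiftIndex k k' n))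
    refine this.trans (add_le_add le_rfl ?_)
    simpa using h2
  have h4 : (M * |ev n - shiftIndex k k' n|) ^ 2 = M ^ 2 * (ev n - shiftIndex k k' n) ^ 2 := by
    rw [mul_pow, sq_abs]
  have h5 := pow_le_pow_left₀ (norm_nonneg _) h3 2
  nlinarith [sq_nonneg (‖f (shiftIndex k k' n)‖ - M * |ev n - shiftIndex k k' n|)]

theorem abs_sin_pi_mul_le (m : ℤ) (l : ℝ) : |Real.sin (π * l)| ≤ π * |l - m| := by
  have h := sin_pi_mul_add_int m (l - m)
  rw [add_sub_cancel] at h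
  rw [h, abs_mul, abs_zpow, abs_neg, abs_one, one_zpow, one_mul]
  refine (Real.abs_sin_le_abs).trans ?_
  rw [abs_mul, abs_of_pos Real.pi_pos]

theorem IsPhi.mul_self_eq (hp : MemLp p 2 (volume.restrict (Ioo 0 π)))
    (hq : MemLp q 2 (volume.restrict (Ioo 0 π))) (hφ : IsPhi p q φ) (l : ℝ) {x : ℝ}
    (hx : x ∈ Icc 0 π) (i : Fin 2) : φ x l i * φ x l i = ((‖φ x l i‖ ^ 2 : ℝ) : ℂ) := by
  have := Complex.mul_conj (φ x l i)
  rw [hφ.conj_eq hp hq l hx i, Complex.normSq_eq_norm_sq] at this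
  exact this

theorem IsPhi.ofReal_integral_norm_sq (hp : MemLp p 2 (volume.restrict (Ioo 0 π)))
    (hq : MemLp q 2 (volume.restrict (Ioo 0 π))) (hφ : IsPhi p q φ) (l : ℝ) :
    ((∫ x in (0 : ℝ)..π, (‖φ x l 0‖ ^ 2 + ‖φ x l 1‖ ^ 2) : ℝ) : ℂ) =
      ∫ x in (0 : ℝ)..π, (φ x l 0 * φ x l 0 + φ x l 1 * φ x l 1) := by
  rw [← intervalIntegral.integral_ofReal]
  refine intervalIntegral.integral_congr fun t ht => ?_
  rw [uIcc_of_le Real.pi_pos.le] at ht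
  simp only [hφ.mul_self_eq hp hq l ht, Complex.ofReal_add]

theorem IsPhi.continuous_real (hp : MemLp p 2 (volume.restrict (Ioo 0 π)))
    (hq : MemLp q 2 (volume.restrict (Ioo 0 π))) (hφ : IsPhi p q φ) {x : ℝ} (hx : x ∈ Icc 0 π)
    (i : Fin 2) : Continuous fun l : ℝ => φ x l i := by
  obtain ⟨f, hf, e⟩ := hφ.exists_isFT hp hq hx i
  obtain ⟨f', -, d⟩ := hf.exists_deriv
  have hc : Continuous f := continuous_iff_continuousAt.2 fun z => (d z).continuousAt
  have h0 : Continuous fun l : ℝ => phi0 x l i := by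
    fin_cases i <;> simp [phi0] <;> fun_prop
  simp only [e]
  exact h0.add (hc.comp Complex.continuous_ofReal)

theorem IsPhi.tendsto_integral_mul (hp : MemLp p 2 (volume.restrict (Ioo 0 π)))
    (hq : MemLp q 2 (volume.restrict (Ioo 0 π))) (hφ : IsPhi p q φ) (l : ℝ) :
    Tendsto (fun μ : ℝ => ∫ x in (0 : ℝ)..π, (φ x μ 0 * φ x l 0 + φ x μ 1 * φ x l 1)) (𝓝 l)
      (𝓝 (∫ x in (0 : ℝ)..π, (φ x l 0 * φ x l 0 + φ x l 1 * φ x l 1))) := by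
  obtain ⟨M, hM, hb⟩ := hφ.exists_bound hp hq
  have hmem : ∀ x ∈ uIoc (0 : ℝ) π, x ∈ Icc 0 π := fun x hx => by
    rw [uIoc_of_le Real.pi_pos.le] at hx; exact Ioc_subset_Icc_self hx
  refine intervalIntegral.tendsto_integral_filter_of_dominated_convergence
    (fun _ => M * M + M * M) (Eventually.of_forall fun μ => ?_)
    (Eventually.of_forall fun μ => Eventually.of_forall fun x hx => ?_)
    intervalIntegrable_const (Eventually.of_forall fun x hx => ?_)
  · have hc : ContinuousOn (fun x => φ x μ 0 * φ x l 0 + φ x μ 1 * φ x l 1) (Icc 0 π) :=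
      ((hφ.continuousOn_apply μ 0).mul (hφ.continuousOn_apply l 0)).add
        ((hφ.continuousOn_apply μ 1).mul (hφ.continuousOn_apply l 1))
    exact (hc.mono hmem).aestronglyMeasurable measurableSet_uIoc
  · refine (norm_add_le _ _).trans (add_le_add ?_ ?_) <;> rw [norm_mul] <;>
      exact mul_le_mul (hb x (hmem x hx) _ _) (hb x (hmem x hx) _ _) (norm_nonneg _) hM
  · have h : ∀ i, Tendsto (fun μ : ℝ => φ x μ i) (𝓝 l) (𝓝 (φ x l i)) := fun i =>
      (hφ.continuous_real hp hq (hmem x hx) i).tendsto l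
    exact ((h 0).mul_const _).add ((h 1).mul_const _)

/-- This is Green's identity divided by `μ - l`, in the limit `μ → l`. -/
theorem IsPhi.integral_sq_eq (hp : MemLp p 2 (volume.restrict (Ioo 0 π)))
    (hq : MemLp q 2 (volume.restrict (Ioo 0 π))) (hφ : IsPhi p q φ) (l : ℝ) {d₀ d₁ : ℂ}
    (h₀ : HasDerivAt (fun μ : ℝ => φ π μ 0) d₀ l) (h₁ : HasDerivAt (fun μ : ℝ => φ π μ 1) d₁ l) :
    ∫ x in (0 : ℝ)..π, (φ x l 0 * φ x l 0 + φ x l 1 * φ x l 1) =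
      d₁ * φ π l 0 - d₀ * φ π l 1 := by
  have hd := (h₁.mul_const (φ π l 0)).sub (h₀.mul_const (φ π l 1))
  rw [hasDerivAt_iff_tendsto_slope] at hd
  refine tendsto_nhds_unique
    ((hφ.tendsto_integral_mul hp hq l).mono_left nhdsWithin_le_nhds) (hd.congr' ?_)
  filter_upwards [self_mem_nhdsWithin] with μ hμ
  have hg := (hφ μ).1.green hp hq (hφ l).1 pi_mem_Icc_pi
  simp only [(hφ _).2] at hg
  have hne : (μ : ℂ) - l ≠ 0 := sub_ne_zero.2 (by exact_mod_cast hμ)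
  rw [slope_def_module, Complex.real_smul]
  push_cast
  rw [inv_mul_eq_iff_eq_mul₀ hne, hg]
  simp
  ring

/-- With `φ(π, l) = (sin πl + f₀, -cos πl + f₁)` in `IsPhi.integral_sq_eq`, the leading part of the
integral is exactly `π`. Every other term, including the boundary term, is a bounded factor times
one of `f₀`, `f₁`, `f₀'`, `f₁'`, `sin πl`, all square summable along the eigenvalues. Reciprocals
inherit this because `α_n π ≥ 1` for all but finitely many `n`. -/
theorem summable_sq_one_div_normalizingNumber_sub
    (hp : MemLp p 2 (volume.restrict (Ioo 0 π)))
    (hq : MemLp q 2 (volume.restrict (Ioo 0 π))) (hφ : IsPhi p q φ) (hh₂ : 0 < h₂) {k k' : ℤ}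
    (hev : Summable fun n => (ev n - shiftIndex k k' n) ^ 2) :
    Summable fun n => (1 / normalizingNumber φ h₂ (ev n) - 1 / π) ^ 2 := by
  obtain ⟨f₀, hf₀, e₀⟩ := hφ.exists_isFT hp hq pi_mem_Icc_pi 0
  obtain ⟨f₁, hf₁, e₁⟩ := hφ.exists_isFT hp hq pi_mem_Icc_pi 1
  obtain ⟨f₀', hf₀', d₀⟩ := hf₀.exists_deriv
  obtain ⟨f₁', hf₁', d₁⟩ := hf₁.exists_deriv
  obtain ⟨M, hM, hb⟩ := hφ.exists_bound hp hq
  have hb : ∀ (l : ℝ) i, ‖φ π l i‖ ≤ M := hb π pi_mem_Icc_pi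
  have key : ∀ l : ℝ, |normalizingNumber φ h₂ l - π| ≤
      (π * ‖f₀ l‖ + M * ‖f₁' l‖) + (π * ‖f₁ l‖ + M * ‖f₀' l‖) +
        M / h₂ * (|Real.sin (π * l)| + ‖f₀ l‖) := by
    intro l
    have h3 : HasDerivAt (fun t : ℝ => π * t) π l := by
      simpa using (hasDerivAt_id l).const_mul π
    have q0 : ∀ μ : ℝ, φ π μ 0 = (Real.sin (π * μ) : ℂ) + f₀ μ := fun μ => by
      rw [e₀, (phi0_pi_real μ).1]
    have q1 : ∀ μ : ℝ, φ π μ 1 = -(Real.cos (π * μ) : ℂ) + f₁ μ := fun μ => by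
      rw [e₁, (phi0_pi_real μ).2]; push_cast; rfl
    have D0 : HasDerivAt (fun μ : ℝ => φ π μ 0) ((Real.cos (π * l) * π : ℝ) + f₀' l) l := by
      simp only [q0]
      exact h3.sin.ofReal_comp.add (IsFT.hasDerivAt_real d₀ l)
    have D1 : HasDerivAt (fun μ : ℝ => φ π μ 1) (-((-Real.sin (π * l) * π : ℝ) : ℂ) + f₁' l) l := by
      simp only [q1]
      exact h3.cos.ofReal_comp.neg.add (IsFT.hasDerivAt_real d₁ l)
    have hI := hφ.integral_sq_eq hp hq l D0 D1
    rw [← hφ.ofReal_integral_norm_sq hp hq l] at hI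
    set I := ∫ x in (0 : ℝ)..π, (‖φ x l 0‖ ^ 2 + ‖φ x l 1‖ ^ 2)
    have hsc : (Real.sin (π * l) : ℂ) ^ 2 + (Real.cos (π * l) : ℂ) ^ 2 = 1 := by
      exact_mod_cast Real.sin_sq_add_cos_sq (π * l)
    have hI2 : ((I - π : ℝ) : ℂ) = (π * Real.sin (π * l) * f₀ l + φ π l 0 * f₁' l) +
        (-(π * Real.cos (π * l) * f₁ l) - φ π l 1 * f₀' l) := by
      push_cast at hI ⊢
      push_cast at hsc q0 q1
      rw [hI, q0, q1]
      linear_combination (π : ℂ) * hsc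
    have hsin : ‖(Real.sin (π * l) : ℂ)‖ ≤ 1 := by
      rw [Complex.norm_real]; exact Real.abs_sin_le_one _
    have hcos : ‖(Real.cos (π * l) : ℂ)‖ ≤ 1 := by
      rw [Complex.norm_real]; exact Real.abs_cos_le_one _
    have hpi : ‖(π : ℂ)‖ = π := by rw [Complex.norm_real, Real.norm_eq_abs, abs_of_pos Real.pi_pos]
    have hI3 : |I - π| ≤ (π * ‖f₀ l‖ + M * ‖f₁' l‖) + (π * ‖f₁ l‖ + M * ‖f₀' l‖) := by
      rw [← Real.norm_eq_abs, ← Complex.norm_real, hI2]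
      refine (norm_add_le _ _).trans (add_le_add ((norm_add_le _ _).trans (add_le_add ?_ ?_))
        ((norm_sub_le _ _).trans (add_le_add ?_ ?_)))
      · rw [norm_mul, norm_mul, hpi]
        gcongr
        nlinarith [Real.pi_pos]
      · rw [norm_mul]; gcongr; exact hb l 0
      · rw [norm_neg, norm_mul, norm_mul, hpi]
        gcongr
        nlinarith [Real.pi_pos]
      · rw [norm_mul]; gcongr; exact hb l 1
    have hB : |1 / h₂ * ‖φ π l 0‖ ^ 2| ≤ M / h₂ * (|Real.sin (π * l)| + ‖f₀ l‖) := by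
      rw [abs_of_nonneg (by positivity)]
      have h4 : ‖φ π l 0‖ ≤ |Real.sin (π * l)| + ‖f₀ l‖ := by
        rw [q0]
        refine (norm_add_le _ _).trans (add_le_add ?_ le_rfl)
        rw [Complex.norm_real, Real.norm_eq_abs]
      calc 1 / h₂ * ‖φ π l 0‖ ^ 2 = 1 / h₂ * (‖φ π l 0‖ * ‖φ π l 0‖) := by ring
        _ ≤ 1 / h₂ * (M * (|Real.sin (π * l)| + ‖f₀ l‖)) := by
          gcongr
          exact hb l 0
        _ = _ := by ring
    have : normalizingNumber φ h₂ l - π = (I - π) + 1 / h₂ * ‖φ π l 0‖ ^ 2 := by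
      simp only [normalizingNumber]; ring
    rw [this]
    exact (abs_add_le _ _).trans (add_le_add hI3 hB)
  -- square summability is stable under linear combinations
  have add : ∀ {u v : ℤ → ℝ} (a b : ℝ), Summable (fun n => u n ^ 2) → Summable (fun n => v n ^ 2) →
      Summable fun n => (a * u n + b * v n) ^ 2 := by
    intro u v a b hu hv
    refine Summable.of_nonneg_of_le (fun _ => sq_nonneg _) (fun n => ?_)
      ((hu.mul_left (2 * a ^ 2)).add (hv.mul_left (2 * b ^ 2)))
    nlinarith [sq_nonneg (a * u n - b * v n)]
  have s0 := hf₀.summable_comp hev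
  have s1 := hf₁.summable_comp hev
  have s0' := hf₀'.summable_comp hev
  have s1' := hf₁'.summable_comp hev
  have ss : Summable fun n => |Real.sin (π * ev n)| ^ 2 := by
    refine Summable.of_nonneg_of_le (fun _ => sq_nonneg _) (fun n => ?_) (hev.mul_left (π ^ 2))
    rw [← sq_abs (ev n - _), ← mul_pow]
    exact pow_le_pow_left₀ (abs_nonneg _) (abs_sin_pi_mul_le _ _) 2
  have S1 := add 1 1 (add π M s0 s1') (add π M s1 s0')
  have S2 := add 1 (M / h₂) S1 (add 1 1 ss s0)
  have S : Summable fun n => (normalizingNumber φ h₂ (ev n) - π) ^ 2 := by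
    refine Summable.of_nonneg_of_le (fun _ => sq_nonneg _) (fun n => ?_) S2
    rw [← sq_abs]
    refine pow_le_pow_left₀ (abs_nonneg _) ((key (ev n)).trans (le_of_eq ?_)) 2
    ring
  have hev2 : ∀ᶠ n in cofinite, (normalizingNumber φ h₂ (ev n) - π) ^ 2 < 1 :=
    S.tendsto_cofinite_zero.eventually_lt_const one_pos
  refine Summable.of_norm_bounded_eventually S ?_
  filter_upwards [hev2] with n hn
  have hpos := hφ.normalizingNumber_pos hh₂ (ev n)
  set α := normalizingNumber φ h₂ (ev n)
  have h5 : |α - π| < 1 := abs_lt_of_sq_lt_sq (by simpa using hn) zero_le_one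
  have h6 : 1 ≤ α * π := by
    have := (abs_lt.1 h5).1
    nlinarith [Real.pi_gt_three]
  have h7 : 1 / α - 1 / π = (π - α) / (α * π) := by
    have := Real.pi_ne_zero
    field_simp
  rw [Real.norm_eq_abs, abs_of_nonneg (sq_nonneg _), h7, div_pow]
  rw [div_le_iff₀ (by positivity)]
  have : 1 ≤ (α * π) ^ 2 := one_le_pow₀ h6
  nlinarith [sq_nonneg (α - π)]

theorem exists_abs_le_of_summable_sub_sq {c : ℤ → ℝ} {a : ℝ}
    (hc : Summable fun n => (c n - a) ^ 2) : ∃ C : ℝ, 0 ≤ C ∧ ∀ n, |c n| ≤ C := by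
  refine ⟨|a| + 1 + ∑' n, (c n - a) ^ 2, ?_, fun n => ?_⟩
  · have : 0 ≤ ∑' n, (c n - a) ^ 2 := tsum_nonneg fun n => sq_nonneg (c n - a)
    positivity
  · have h1 := hc.le_tsum n (fun _ _ => sq_nonneg _)
    have h2 : |c n| ≤ |a| + |c n - a| := by
      have := abs_add_le a (c n - a)
      rwa [add_sub_cancel] at this
    rw [← sq_abs] at h1
    nlinarith [sq_nonneg (|c n - a| - 1)]

end DiracBVP

/-! ### Weak convergence of the exponential sums -/

namespace DiracBVP

theorem tendsto_finset_Icc_neg_natCast :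
    Tendsto (fun N : ℕ => Finset.Icc (-(N : ℤ)) N) atTop atTop :=
  Finset.tendsto_Icc_neg_atTop_atTop.comp tendsto_natCast_atTop_atTop

section WeakLimit

variable {α : Type*} [MeasurableSpace α] {μ : Measure α}

/-- A weakly convergent sequence in `L²` is bounded and has a limit in `L²`. -/
theorem exists_weak_limit {u : ℕ → α → ℂ} (hu : ∀ N, MemLp (u N) 2 μ)
    (h : ∀ g, MemLp g 2 μ → ∃ l, Tendsto (fun N => ∫ a, u N a * g a ∂μ) atTop (𝓝 l)) :
    (∃ A, MemLp A 2 μ ∧ ∀ g, MemLp g 2 μ →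
      Tendsto (fun N => ∫ a, u N a * g a ∂μ) atTop (𝓝 (∫ a, A a * g a ∂μ))) ∧
    ∃ C : ℝ, ∀ N, ∫ a, ‖u N a‖ ^ 2 ∂μ ≤ C := by
  set T : ℕ → StrongDual ℂ (Lp ℂ 2 μ) := fun N =>
    InnerProductSpace.toDual ℂ (Lp ℂ 2 μ) ((hu N).star.toLp _) with hT
  have hTe : ∀ N (g : Lp ℂ 2 μ), T N g = ∫ a, u N a * g a ∂μ := by
    intro N g
    rw [hT, InnerProductSpace.toDual_apply_apply, L2.inner_def]
    refine integral_congr_ae ?_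
    filter_upwards [(hu N).star.coeFn_toLp] with a ha
    rw [ha]
    simp [mul_comm]
  have hconv : ∀ g : Lp ℂ 2 μ, ∃ l, Tendsto (fun N => T N g) atTop (𝓝 l) := fun g => by
    simp only [hTe]
    exact h g (Lp.memLp g)
  choose f hf using hconv
  constructor
  -- By Banach–Steinhaus the pointwise limit of the functionals is continuous; Riesz represents it,
  -- and a conjugation returns to the bilinear pairing.
  · set L := continuousLinearMapOfTendsto T (f := f) (tendsto_pi_nhds.2 hf)
    refine ⟨fun a => (starRingEnd ℂ) ((InnerProductSpace.toDual ℂ (Lp ℂ 2 μ)).symm L a),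
      (Lp.memLp _).star, fun g hg => ?_⟩
    have h1 := hf (hg.toLp g)
    have h2 : f (hg.toLp g) = inner ℂ ((InnerProductSpace.toDual ℂ (Lp ℂ 2 μ)).symm L)
        (hg.toLp g) := by
      rw [InnerProductSpace.toDual_symm_apply]; rfl
    have h3 : f (hg.toLp g) =
        ∫ a, (starRingEnd ℂ) ((InnerProductSpace.toDual ℂ (Lp ℂ 2 μ)).symm L a) * g a ∂μ := by
      rw [h2, L2.inner_def]
      refine integral_congr_ae ?_
      filter_upwards [hg.coeFn_toLp] with a ha
      rw [ha]
      simp [mul_comm]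
    rw [← h3]
    refine h1.congr fun N => ?_
    rw [hTe]
    refine integral_congr_ae ?_
    filter_upwards [hg.coeFn_toLp] with a ha
    rw [ha]
  · obtain ⟨C, hC⟩ := banach_steinhaus (g := T) fun g => by
      obtain ⟨C, hC⟩ := (hf g).norm.bddAbove_range
      exact ⟨C, fun N => hC ⟨N, rfl⟩⟩
    refine ⟨C ^ 2, fun N => ?_⟩
    have h1 := norm_toLp_sq (hu N).star
    have h2 : ∫ a, ‖star (u N) a‖ ^ 2 ∂μ = ∫ a, ‖u N a‖ ^ 2 ∂μ := by simp
    rw [← h2, ← h1]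
    refine pow_le_pow_left₀ (norm_nonneg _) ?_ 2
    have := hC N
    rwa [hT, LinearIsometryEquiv.norm_map] at this

end WeakLimit

/-- Telescoping: shifting the index changes the partial sums of a null sequence convergently. -/
theorem exists_tendsto_sum_shift_sub {f : ℤ → ℂ} (hf : Tendsto f cofinite (𝓝 0)) (k : ℤ) :
    ∃ l, Tendsto (fun N : ℕ => ∑ j ∈ Finset.range N, (f (j + k) - f j)) atTop (𝓝 l) := by
  have step : ∀ k : ℤ, Tendsto (fun N : ℕ => ∑ j ∈ Finset.range N, (f (j + (k + 1)) - f (j + k)))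
      atTop (𝓝 (0 - f k)) := by
    intro k
    have e : ∀ N : ℕ, ∑ j ∈ Finset.range N, (f (j + (k + 1)) - f (j + k)) = f (N + k) - f k := by
      intro N
      have := Finset.sum_range_sub (fun j : ℕ => f (j + k)) N
      simp only [Nat.cast_add, Nat.cast_one, Nat.cast_zero, zero_add] at this
      rw [← this]
      refine Finset.sum_congr rfl fun j _ => ?_
      congr 2; ring
    simp only [e]
    refine Tendsto.sub_const (hf.comp ?_) _
    have hinj : Function.Injective fun N : ℕ => (N : ℤ) + k := fun a b h => by
      have : (a : ℤ) = b := by simpa using h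
      exact_mod_cast this
    rw [← Nat.cofinite_eq_atTop]
    exact hinj.tendsto_cofinite
  induction k using Int.induction_on with
  | zero => exact ⟨0, by simp⟩
  | succ i ih =>
    obtain ⟨l, hl⟩ := ih
    refine ⟨_, (hl.add (step i)).congr fun N => ?_⟩
    rw [← Finset.sum_add_distrib]
    exact Finset.sum_congr rfl fun j _ => by ring
  | pred i ih =>
    obtain ⟨l, hl⟩ := ih
    refine ⟨_, (hl.sub (step (-i - 1))).congr fun N => ?_⟩
    rw [← Finset.sum_sub_distrib]
    refine Finset.sum_congr rfl fun j _ => ?_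
    rw [sub_add_cancel]
    ring

theorem sum_Icc_neg_eq (b : ℤ → ℂ) (N : ℕ) :
    ∑ n ∈ Finset.Icc (-(N : ℤ)) N, b n =
      (∑ j ∈ Finset.range (N + 1), b j) + ∑ j ∈ Finset.range N, b (-(j + 1)) := by
  induction N with
  | zero => simp
  | succ N ih =>
    push_cast
    rw [Finset.sum_Icc_succ_eq_add_endpoints, ih, Finset.sum_range_succ _ (N + 1),
      Finset.sum_range_succ (fun j : ℕ => b (-(j + 1))) N]
    push_cast
    ring

/-- Each half of `ℤ` is moved rigidly, so the difference telescopes at the far ends, where `f` tends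
to zero. The limit need not vanish; convergence is what allows an arbitrary increasing numbering of
the eigenvalues. -/
theorem exists_tendsto_sum_shiftIndex_sub {f : ℤ → ℂ} (hf : Tendsto f cofinite (𝓝 0))
    (k k' : ℤ) :
    ∃ l, Tendsto (fun N : ℕ => ∑ n ∈ Finset.Icc (-(N : ℤ)) N, (f (shiftIndex k k' n) - f n))
      atTop (𝓝 l) := by
  obtain ⟨l₁, h₁⟩ := exists_tendsto_sum_shift_sub hf k
  have hneg : Tendsto (fun n : ℤ => f (-(n + 1))) cofinite (𝓝 0) := by
    refine hf.comp (Function.Injective.tendsto_cofinite fun a b h => ?_)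
    have : -(a + 1) = -(b + 1) := h
    omega
  obtain ⟨l₂, h₂⟩ := exists_tendsto_sum_shift_sub hneg (-k')
  refine ⟨l₁ + l₂, (((tendsto_add_atTop_iff_nat 1).2 h₁).add h₂).congr fun N => ?_⟩
  rw [sum_Icc_neg_eq]
  refine congrArg₂ (· + ·) ?_ ?_
  · refine Finset.sum_congr rfl fun j _ => ?_
    rw [shiftIndex, if_pos (Int.natCast_nonneg j)]
  · refine Finset.sum_congr rfl fun j _ => ?_
    have h3 : ¬ (0 : ℤ) ≤ -(j + 1) := by omega
    rw [shiftIndex, if_neg h3]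
    congr 2
    ring

/-- The exponential sums whose limit generates the spectral kernel. -/
noncomputable def trigSum (c : ℤ → ℝ) (ev : ℤ → ℝ) (N : ℕ) (s : ℝ) : ℂ :=
  ∑ n ∈ Finset.Icc (-(N : ℤ)) N, (c n * Complex.exp (Complex.I * ev n * s) -
    1 / π * Complex.exp (Complex.I * n * s))

theorem continuous_trigSum (c : ℤ → ℝ) (ev : ℤ → ℝ) (N : ℕ) : Continuous (trigSum c ev N) := by
  unfold trigSum
  fun_prop

theorem memLp_trigSum (c : ℤ → ℝ) (ev : ℤ → ℝ) (N : ℕ) :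
    MemLp (trigSum c ev N) 2 wideMeasure :=
  memLp_wideMeasure_of_continuous (continuous_trigSum c ev N) 2

theorem integral_trigSum_mul (c : ℤ → ℝ) (ev : ℤ → ℝ) (N : ℕ) {g : ℝ → ℂ}
    (hg : MemLp g 2 wideMeasure) :
    ∫ s, trigSum c ev N s * g s ∂wideMeasure =
      ∑ n ∈ Finset.Icc (-(N : ℤ)) N, (c n * ft g (ev n) - 1 / π * ft g n) := by
  have hi : ∀ z : ℂ, Integrable (fun s : ℝ => g s * Complex.exp (Complex.I * z * s)) wideMeasure :=
    integrable_ft hg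
  have e : ∀ s, trigSum c ev N s * g s = ∑ n ∈ Finset.Icc (-(N : ℤ)) N,
      ((c n : ℂ) * (g s * Complex.exp (Complex.I * (ev n : ℂ) * s)) -
        1 / π * (g s * Complex.exp (Complex.I * (n : ℂ) * s))) := by
    intro s
    rw [trigSum, Finset.sum_mul]
    exact Finset.sum_congr rfl fun n _ => by ring
  simp only [e]
  have hi2 : ∀ n : ℤ, Integrable (fun s : ℝ =>
      (c n : ℂ) * (g s * Complex.exp (Complex.I * (ev n : ℂ) * s)) -
        1 / π * (g s * Complex.exp (Complex.I * (n : ℂ) * s))) wideMeasure :=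
    fun n => ((hi _).const_mul _).sub ((hi _).const_mul _)
  rw [integral_finsetSum _ fun n _ => hi2 n]
  refine Finset.sum_congr rfl fun n _ => ?_
  rw [integral_sub ((hi _).const_mul _) ((hi _).const_mul _), integral_const_mul,
    integral_const_mul]
  rfl

/-- Compared with the values at the shifted integers `m`, the series converges absolutely: `(c_n -
1/π) f(λ_n)` is a product of two square summable sequences, and `f(λ_n) - f(m)` is at most `|f'(m)|
|λ_n - m| + M |λ_n - m|²`. Returning from `m` to `n` is the telescoping part. -/
theorem exists_tendsto_sum_ft {c ev : ℤ → ℝ} {k k' : ℤ}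
    (hev : Summable fun n => (ev n - shiftIndex k k' n) ^ 2)
    (hc : Summable fun n => (c n - 1 / π) ^ 2) {f : ℂ → ℂ} (hf : IsFT f) :
    ∃ l, Tendsto (fun N : ℕ => ∑ n ∈ Finset.Icc (-(N : ℤ)) N, (c n * f (ev n) - 1 / π * f n))
      atTop (𝓝 l) := by
  obtain ⟨f', hf', hd⟩ := hf.exists_deriv
  obtain ⟨M, hM, ht⟩ := hf'.exists_taylor hd
  have h1 : Summable fun n => (c n : ℂ) * f (ev n) - 1 / π * f (shiftIndex k k' n) := by
    refine Summable.of_norm_bounded (((hc.add (hf.summable_comp hev)).add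
      (((summable_comp_shiftIndex hf'.summable (fun _ => sq_nonneg _) k k').add hev).add
        (hev.mul_left M)))) fun n => ?_
    have e : (c n : ℂ) * f (ev n) - 1 / π * f (shiftIndex k k' n) =
        ((c n - 1 / π : ℝ) : ℂ) * f (ev n) +
          ((1 / π : ℝ) : ℂ) * (f (ev n) - f (shiftIndex k k' n)) := by
      push_cast; ring
    rw [e]
    refine (norm_add_le _ _).trans (add_le_add ?_ ?_)
    · rw [norm_mul, Complex.norm_real, Real.norm_eq_abs, ← sq_abs (c n - _)]
      nlinarith [sq_nonneg (|c n - 1 / π| - ‖f (ev n)‖), sq_nonneg |c n - 1 / π|,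
        sq_nonneg ‖f (ev n)‖]
    · rw [norm_mul, Complex.norm_real, Real.norm_eq_abs, abs_of_pos (by positivity)]
      have h2 := ht (shiftIndex k k' n) (ev n)
      push_cast at h2
      have h3 : 1 / π ≤ 1 := by
        rw [div_le_one Real.pi_pos]; linarith [Real.pi_gt_three]
      refine (mul_le_of_le_one_left (norm_nonneg _) h3).trans (h2.trans ?_)
      rw [← sq_abs (ev n - _)]
      nlinarith [sq_nonneg (‖f' (shiftIndex k k' n)‖ - |ev n - shiftIndex k k' n|),
        sq_nonneg ‖f' (shiftIndex k k' n)‖, sq_nonneg |ev n - shiftIndex k k' n|]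
  have hf0 : Tendsto (fun n : ℤ => f n) cofinite (𝓝 0) := by
    have := hf.summable.tendsto_cofinite_zero
    rw [tendsto_zero_iff_norm_tendsto_zero]
    have h2 := this.sqrt
    simpa using h2
  obtain ⟨l, hl⟩ := exists_tendsto_sum_shiftIndex_sub hf0 k k'
  refine ⟨_, ((h1.hasSum.comp tendsto_finset_Icc_neg_natCast).add
    (hl.const_mul (1 / (π : ℂ)))).congr fun N => ?_⟩
  rw [Function.comp_apply, Finset.mul_sum, ← Finset.sum_add_distrib]
  exact Finset.sum_congr rfl fun n _ => by ring

theorem exists_trigSum_limit {c ev : ℤ → ℝ} {k k' : ℤ}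
    (hev : Summable fun n => (ev n - shiftIndex k k' n) ^ 2)
    (hc : Summable fun n => (c n - 1 / π) ^ 2) :
    (∃ A, MemLp A 2 wideMeasure ∧ ∀ g, MemLp g 2 wideMeasure →
      Tendsto (fun N => ∫ s, trigSum c ev N s * g s ∂wideMeasure) atTop
        (𝓝 (∫ s, A s * g s ∂wideMeasure))) ∧
    ∃ C : ℝ, ∀ N, ∫ s, ‖trigSum c ev N s‖ ^ 2 ∂wideMeasure ≤ C := by
  refine exists_weak_limit (memLp_trigSum c ev) fun g hg => ?_
  obtain ⟨l, hl⟩ := exists_tendsto_sum_ft hev hc ⟨g, hg, fun _ => rfl⟩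
  exact ⟨l, hl.congr fun N => (integral_trigSum_mul c ev N hg).symm⟩

section Translate

variable {e : ℝ ≃ᵐ ℝ} {a b : ℝ}

theorem MeasurePreserving.restrict_image_Ioo (he : MeasurePreserving e volume volume) :
    MeasurePreserving e (volume.restrict (Ioo a b)) (volume.restrict (e '' Ioo a b)) :=
  he.restrict_image_emb e.measurableEmbedding _

theorem memLp_comp_of_mapsTo (he : MeasurePreserving e volume volume)
    (hm : MapsTo e (Ioo a b) (Ioo (-(2 * π)) (2 * π))) {A : ℝ → ℂ} (hA : MemLp A 2 wideMeasure) :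
    MemLp (fun t => A (e t)) 2 (volume.restrict (Ioo a b)) :=
  (hA.mono_measure (Measure.restrict_mono_set _ hm.image_subset)).comp_measurePreserving
    (MeasurePreserving.restrict_image_Ioo he)

/-- Pairings on an interval, transported by a measure preserving change of variables. -/
theorem exists_integral_comp_mul_eq (he : MeasurePreserving e volume volume)
    (hm : MapsTo e (Ioo a b) (Ioo (-(2 * π)) (2 * π))) {g : ℝ → ℂ}
    (hg : MemLp g 2 (volume.restrict (Ioo a b))) :
    ∃ G, MemLp G 2 wideMeasure ∧ ∀ A : ℝ → ℂ,
      ∫ t in Ioo a b, A (e t) * g t = ∫ s, A s * G s ∂wideMeasure := by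
  have hs : MeasurableSet (e '' Ioo a b) := e.measurableEmbedding.measurableSet_image.2
    measurableSet_Ioo
  have hr := MeasurePreserving.restrict_image_Ioo (a := a) (b := b) he
  have hr' := hr.symm
  refine ⟨(e '' Ioo a b).indicator (g ∘ e.symm), ?_, fun A => ?_⟩
  · rw [memLp_indicator_iff_restrict hs, wideMeasure, Measure.restrict_restrict hs,
      inter_eq_left.2 hm.image_subset]
    exact hg.comp_measurePreserving hr'
  · have h1 : ∀ s, A s * (e '' Ioo a b).indicator (g ∘ e.symm) s =
        (e '' Ioo a b).indicator (fun s => A s * g (e.symm s)) s := fun s => by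
      by_cases h : s ∈ e '' Ioo a b <;> simp [h]
    simp only [h1]
    rw [integral_indicator hs, wideMeasure, Measure.restrict_restrict hs,
      inter_eq_left.2 hm.image_subset, ← hr.integral_comp e.measurableEmbedding]
    simp

theorem integral_norm_sq_comp_le (he : MeasurePreserving e volume volume)
    (hm : MapsTo e (Ioo a b) (Ioo (-(2 * π)) (2 * π))) {A : ℝ → ℂ} (hA : MemLp A 2 wideMeasure) :
    ∫ t in Ioo a b, ‖A (e t)‖ ^ 2 ≤ ∫ s, ‖A s‖ ^ 2 ∂wideMeasure := by
  have hr := MeasurePreserving.restrict_image_Ioo (a := a) (b := b) he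
  rw [hr.integral_comp e.measurableEmbedding (fun s => ‖A s‖ ^ 2)]
  exact integral_mono_measure (Measure.restrict_mono_set _ hm.image_subset)
    (Eventually.of_forall fun _ => by positivity) ((memLp_two_iff_integrable_sq_norm hA.1).1 hA)

end Translate

end DiracBVP

/-! ### Existence and uniform bounds for the spectral kernel -/

namespace DiracBVP

variable {p q : ℝ → ℝ} {φ : ℝ → ℂ → Fin 2 → ℂ} {h₁ h₂ : ℝ} {ev : ℤ → ℝ}

/-- The amplitude of the exponentials in `phi0`. -/
noncomputable def phi0Coef (i : Fin 2) : ℂ := ![-(Complex.I / 2), -(1 / 2)] i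

/-- The parity of the component of `phi0`. -/
def phi0Sign (i : Fin 2) : ℂ := ![-1, 1] i

theorem phi0_eq_coef (t : ℝ) (z : ℂ) (i : Fin 2) : phi0 t z i =
    phi0Coef i * (Complex.exp (Complex.I * z * t) +
      phi0Sign i * Complex.exp (Complex.I * z * (-t : ℝ))) := by
  have e : Complex.I * z * (-t : ℝ) = Complex.I * (-z) * t := by push_cast; ring
  rw [e]
  fin_cases i
  · simp only [Fin.zero_eta, phi0Coef, phi0Sign, Matrix.cons_val_zero]
    rw [(phi0_eq_cexp t z).1]; ring
  · simp only [Fin.mk_one, phi0Coef, phi0Sign, Matrix.cons_val_one, Matrix.cons_val_fin_one]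
    rw [(phi0_eq_cexp t z).2]; ring

theorem norm_phi0Coef (i : Fin 2) : ‖phi0Coef i‖ = 1 / 2 := by
  fin_cases i <;> simp [phi0Coef]

theorem norm_phi0Sign (i : Fin 2) : ‖phi0Sign i‖ = 1 := by
  fin_cases i <;> simp [phi0Sign]

/-- The kernel `∑ γ_i(σ) γ_j(τ) A(σx + τt)` generated by a function of one variable. -/
noncomputable def reflectKernel (A : ℝ → ℂ) (i j : Fin 2) (x t : ℝ) : ℂ :=
  phi0Coef i * phi0Coef j * (A (x + t) + phi0Sign j * A (x - t) +
    phi0Sign i * A (-x + t) + phi0Sign i * phi0Sign j * A (-x - t))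

theorem phi0_mul_phi0 (x t : ℝ) (z : ℂ) (i j : Fin 2) : phi0 x z i * phi0 t z j =
    reflectKernel (fun s => Complex.exp (Complex.I * z * s)) i j x t := by
  have e : ∀ a b : ℝ, Complex.exp (Complex.I * z * (a + b : ℝ)) =
      Complex.exp (Complex.I * z * a) * Complex.exp (Complex.I * z * b) := fun a b => by
    rw [← Complex.exp_add]; congr 1; push_cast; ring
  rw [phi0_eq_coef, phi0_eq_coef, reflectKernel, sub_eq_add_neg, sub_eq_add_neg]
  simp only [e]
  ring

theorem reflectKernel_sum {ι : Type*} (s : Finset ι) (a b : ι → ℂ) (f g : ι → ℝ → ℂ)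
    (i j : Fin 2) (x t : ℝ) :
    reflectKernel (fun y => ∑ n ∈ s, (a n * f n y - b n * g n y)) i j x t =
      ∑ n ∈ s, (a n * reflectKernel (f n) i j x t - b n * reflectKernel (g n) i j x t) := by
  simp only [reflectKernel, Finset.mul_sum, ← Finset.sum_add_distrib]
  exact Finset.sum_congr rfl fun n _ => by ring

/-- Products of sines and cosines are combinations of `exp(iz(±x ± t))`, so a partial sum is
determined by one function of a single variable in `(-2π, 2π)`. Convergence is needed only for that
function. -/
theorem partialF_apply (N : ℕ) (x t : ℝ) (i j : Fin 2) : partialF φ h₂ ev N x t i j =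
    reflectKernel (trigSum (fun n => 1 / normalizingNumber φ h₂ (ev n)) ev N) i j x t := by
  have := reflectKernel_sum (Finset.Icc (-(N : ℤ)) N)
    (fun n => ((1 / normalizingNumber φ h₂ (ev n) : ℝ) : ℂ)) (fun _ => 1 / (π : ℂ))
    (fun n s => Complex.exp (Complex.I * ev n * s)) (fun n s => Complex.exp (Complex.I * n * s))
    i j x t
  refine Eq.trans ?_ this.symm
  rw [partialF, Matrix.sum_apply]
  refine Finset.sum_congr rfl fun n _ => ?_
  rw [← phi0_mul_phi0 x t (ev n : ℂ), ← phi0_mul_phi0 x t (n : ℂ)]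
  simp [Matrix.vecMulVec_apply]

theorem integral_add_four {α E : Type*} [MeasurableSpace α] {ν : Measure α}
    [NormedAddCommGroup E] [NormedSpace ℝ E] {u₁ u₂ u₃ u₄ : α → E} (k₁ : Integrable u₁ ν)
    (k₂ : Integrable u₂ ν) (k₃ : Integrable u₃ ν) (k₄ : Integrable u₄ ν) :
    ∫ t, (u₁ t + u₂ t + u₃ t + u₄ t) ∂ν =
      (∫ t, u₁ t ∂ν) + (∫ t, u₂ t ∂ν) + (∫ t, u₃ t ∂ν) + ∫ t, u₄ t ∂ν := by
  have k₁₂ : Integrable (fun t => u₁ t + u₂ t) ν := k₁.add k₂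
  have k₁₂₃ : Integrable (fun t => u₁ t + u₂ t + u₃ t) ν := k₁₂.add k₃
  rw [integral_add k₁₂₃ k₄, integral_add k₁₂ k₃, integral_add k₁ k₂]

/-- The changes of variables `t ↦ ± x ± t`. -/
theorem measurePreserving_addLeft (x : ℝ) :
    MeasurePreserving (MeasurableEquiv.addLeft x) volume volume :=
  measurePreserving_add_left volume x

theorem measurePreserving_subLeft (x : ℝ) :
    MeasurePreserving (MeasurableEquiv.subLeft x) volume volume :=
  volume.measurePreserving_sub_left x

theorem mapsTo_addLeft {x : ℝ} (hx : |x| ≤ π) :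
    MapsTo (MeasurableEquiv.addLeft x) (Ioo 0 π) (Ioo (-(2 * π)) (2 * π)) := fun t ht => by
  have := abs_le.1 hx
  change x + t ∈ _
  constructor <;> linarith [ht.1, ht.2]

theorem mapsTo_subLeft {x : ℝ} (hx : |x| ≤ π) :
    MapsTo (MeasurableEquiv.subLeft x) (Ioo 0 π) (Ioo (-(2 * π)) (2 * π)) := fun t ht => by
  have := abs_le.1 hx
  change x - t ∈ _
  constructor <;> linarith [ht.1, ht.2]

section

variable {x : ℝ}

theorem memLp_comp_addLeft (hx : |x| ≤ π) {A : ℝ → ℂ} (hA : MemLp A 2 wideMeasure) :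
    MemLp (fun t => A (x + t)) 2 (volume.restrict (Ioo 0 π)) :=
  memLp_comp_of_mapsTo (measurePreserving_addLeft x) (mapsTo_addLeft hx) hA

theorem memLp_comp_subLeft (hx : |x| ≤ π) {A : ℝ → ℂ} (hA : MemLp A 2 wideMeasure) :
    MemLp (fun t => A (x - t)) 2 (volume.restrict (Ioo 0 π)) :=
  memLp_comp_of_mapsTo (measurePreserving_subLeft x) (mapsTo_subLeft hx) hA

theorem abs_le_pi_of_mem (hx : x ∈ Icc 0 π) : |x| ≤ π ∧ |-x| ≤ π := by
  rw [abs_neg, abs_of_nonneg hx.1]; exact ⟨hx.2, hx.2⟩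

theorem memLp_reflectKernel (hx : x ∈ Icc 0 π) {A : ℝ → ℂ} (hA : MemLp A 2 wideMeasure)
    (i j : Fin 2) : MemLp (fun t => reflectKernel A i j x t) 2 (volume.restrict (Ioo 0 π)) := by
  obtain ⟨hx1, hx2⟩ := abs_le_pi_of_mem hx
  exact ((((memLp_comp_addLeft hx1 hA).add ((memLp_comp_subLeft hx1 hA).const_mul _)).add
    ((memLp_comp_addLeft hx2 hA).const_mul _)).add
      ((memLp_comp_subLeft hx2 hA).const_mul _)).const_mul _

/-- The substitutions `t ↦ ±x ± t` preserve measure and map into `(-2π, 2π)`, so they can be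
transposed onto `g`. The function `G` does not depend on `A`, hence weak convergence passes from `A`
to the kernel at each fixed `x`. -/
theorem exists_integral_reflectKernel_mul (hx : x ∈ Icc 0 π) (i j : Fin 2) {g : ℝ → ℂ}
    (hg : MemLp g 2 (volume.restrict (Ioo 0 π))) :
    ∃ G, MemLp G 2 wideMeasure ∧ ∀ A, MemLp A 2 wideMeasure →
      ∫ t in Ioo 0 π, reflectKernel A i j x t * g t = ∫ s, A s * G s ∂wideMeasure := by
  obtain ⟨hx1, hx2⟩ := abs_le_pi_of_mem hx
  obtain ⟨G₁, hG₁, e₁⟩ := exists_integral_comp_mul_eq (measurePreserving_addLeft x)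
    (mapsTo_addLeft hx1) hg
  obtain ⟨G₂, hG₂, e₂⟩ := exists_integral_comp_mul_eq (measurePreserving_subLeft x)
    (mapsTo_subLeft hx1) hg
  obtain ⟨G₃, hG₃, e₃⟩ := exists_integral_comp_mul_eq (measurePreserving_addLeft (-x))
    (mapsTo_addLeft hx2) hg
  obtain ⟨G₄, hG₄, e₄⟩ := exists_integral_comp_mul_eq (measurePreserving_subLeft (-x))
    (mapsTo_subLeft hx2) hg
  refine ⟨fun s => phi0Coef i * phi0Coef j * (G₁ s + phi0Sign j * G₂ s + phi0Sign i * G₃ s +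
    phi0Sign i * phi0Sign j * G₄ s), (((hG₁.add (hG₂.const_mul _)).add (hG₃.const_mul _)).add
      (hG₄.const_mul _)).const_mul _, fun A hA => ?_⟩
  have I₁ : Integrable (fun t => A (x + t) * g t) (volume.restrict (Ioo 0 π)) :=
    (memLp_comp_addLeft hx1 hA).integrable_mul hg
  have I₂ : Integrable (fun t => A (x - t) * g t) (volume.restrict (Ioo 0 π)) :=
    (memLp_comp_subLeft hx1 hA).integrable_mul hg
  have I₃ : Integrable (fun t => A (-x + t) * g t) (volume.restrict (Ioo 0 π)) :=
    (memLp_comp_addLeft hx2 hA).integrable_mul hg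
  have I₄ : Integrable (fun t => A (-x - t) * g t) (volume.restrict (Ioo 0 π)) :=
    (memLp_comp_subLeft hx2 hA).integrable_mul hg
  have J₁ : Integrable (fun s => A s * G₁ s) wideMeasure := hA.integrable_mul hG₁
  have J₂ : Integrable (fun s => A s * G₂ s) wideMeasure := hA.integrable_mul hG₂
  have J₃ : Integrable (fun s => A s * G₃ s) wideMeasure := hA.integrable_mul hG₃
  have J₄ : Integrable (fun s => A s * G₄ s) wideMeasure := hA.integrable_mul hG₄
  have eL : ∀ t, reflectKernel A i j x t * g t = phi0Coef i * phi0Coef j * (A (x + t) * g t +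
      phi0Sign j * (A (x - t) * g t) + phi0Sign i * (A (-x + t) * g t) +
      phi0Sign i * phi0Sign j * (A (-x - t) * g t)) := fun t => by
    simp only [reflectKernel]; ring
  have eR : ∀ s, A s * (phi0Coef i * phi0Coef j * (G₁ s + phi0Sign j * G₂ s + phi0Sign i * G₃ s +
      phi0Sign i * phi0Sign j * G₄ s)) = phi0Coef i * phi0Coef j * (A s * G₁ s +
      phi0Sign j * (A s * G₂ s) + phi0Sign i * (A s * G₃ s) +
      phi0Sign i * phi0Sign j * (A s * G₄ s)) := fun s => by ring
  have split : ∀ {ν : Measure ℝ} {u₁ u₂ u₃ u₄ : ℝ → ℂ} (a b c d : ℂ), Integrable u₁ ν →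
      Integrable u₂ ν → Integrable u₃ ν → Integrable u₄ ν →
      ∫ t, d * (u₁ t + a * u₂ t + b * u₃ t + c * u₄ t) ∂ν =
        d * ((∫ t, u₁ t ∂ν) + a * (∫ t, u₂ t ∂ν) + b * (∫ t, u₃ t ∂ν) + c * ∫ t, u₄ t ∂ν) := by
    intro ν u₁ u₂ u₃ u₄ a b c d k₁ k₂ k₃ k₄
    have k₂' := k₂.const_mul a
    have k₃' := k₃.const_mul b
    have k₄' := k₄.const_mul c
    rw [integral_const_mul, integral_add_four k₁ k₂' k₃' k₄', integral_const_mul,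
      integral_const_mul, integral_const_mul]
  simp only [eL, eR]
  rw [split _ _ _ _ I₁ I₂ I₃ I₄, split _ _ _ _ J₁ J₂ J₃ J₄, ← e₁, ← e₂, ← e₃, ← e₄]
  rfl

theorem integral_norm_sq_reflectKernel_le (hx : x ∈ Icc 0 π) {A : ℝ → ℂ}
    (hA : MemLp A 2 wideMeasure) (i j : Fin 2) :
    ∫ t in Ioo 0 π, ‖reflectKernel A i j x t‖ ^ 2 ≤ ∫ s, ‖A s‖ ^ 2 ∂wideMeasure := by
  obtain ⟨hx1, hx2⟩ := abs_le_pi_of_mem hx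
  have sq : ∀ {u : ℝ → ℂ}, MemLp u 2 (volume.restrict (Ioo 0 π)) →
      Integrable (fun t => ‖u t‖ ^ 2) (volume.restrict (Ioo 0 π)) := fun hu =>
    (memLp_two_iff_integrable_sq_norm hu.1).1 hu
  have I₁ := sq (memLp_comp_addLeft hx1 hA)
  have I₂ := sq (memLp_comp_subLeft hx1 hA)
  have I₃ := sq (memLp_comp_addLeft hx2 hA)
  have I₄ := sq (memLp_comp_subLeft hx2 hA)
  have b₁ := integral_norm_sq_comp_le (measurePreserving_addLeft x) (mapsTo_addLeft hx1) hA
  have b₂ := integral_norm_sq_comp_le (measurePreserving_subLeft x) (mapsTo_subLeft hx1) hA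
  have b₃ := integral_norm_sq_comp_le (measurePreserving_addLeft (-x)) (mapsTo_addLeft hx2) hA
  have b₄ := integral_norm_sq_comp_le (measurePreserving_subLeft (-x)) (mapsTo_subLeft hx2) hA
  have hle : ∀ t, ‖reflectKernel A i j x t‖ ^ 2 ≤ 1 / 4 * (‖A (x + t)‖ ^ 2 + ‖A (x - t)‖ ^ 2 +
      ‖A (-x + t)‖ ^ 2 + ‖A (-x - t)‖ ^ 2) := by
    intro t
    have h1 : ‖reflectKernel A i j x t‖ ≤ 1 / 2 * (1 / 2) * (‖A (x + t)‖ + ‖A (x - t)‖ +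
        ‖A (-x + t)‖ + ‖A (-x - t)‖) := by
      rw [reflectKernel, norm_mul, norm_mul, norm_phi0Coef, norm_phi0Coef]
      refine mul_le_mul_of_nonneg_left ?_ (by norm_num)
      refine (norm_add_le _ _).trans (add_le_add ((norm_add_le _ _).trans (add_le_add
        ((norm_add_le _ _).trans (add_le_add le_rfl ?_)) ?_)) ?_) <;>
      simp [norm_phi0Sign]
    have h2 := pow_le_pow_left₀ (norm_nonneg _) h1 2
    nlinarith [sq_nonneg (‖A (x + t)‖ - ‖A (x - t)‖), sq_nonneg (‖A (x + t)‖ - ‖A (-x + t)‖),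
      sq_nonneg (‖A (x + t)‖ - ‖A (-x - t)‖), sq_nonneg (‖A (x - t)‖ - ‖A (-x + t)‖),
      sq_nonneg (‖A (x - t)‖ - ‖A (-x - t)‖), sq_nonneg (‖A (-x + t)‖ - ‖A (-x - t)‖)]
  refine (integral_mono (sq (memLp_reflectKernel hx hA i j))
    ((((I₁.add I₂).add I₃).add I₄).const_mul (1 / 4)) hle).trans ?_
  rw [integral_const_mul]
  have e4 := integral_add_four I₁ I₂ I₃ I₄
  refine (mul_le_mul_of_nonneg_left e4.le (by norm_num)).trans ?_
  have b₁' : ∫ t in Ioo 0 π, ‖A (x + t)‖ ^ 2 ≤ _ := b₁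
  have b₂' : ∫ t in Ioo 0 π, ‖A (x - t)‖ ^ 2 ≤ _ := b₂
  have b₃' : ∫ t in Ioo 0 π, ‖A (-x + t)‖ ^ 2 ≤ _ := b₃
  have b₄' : ∫ t in Ioo 0 π, ‖A (-x - t)‖ ^ 2 ≤ _ := b₄
  linarith

end

theorem intervalIntegral_pi_eq {E : Type*} [NormedAddCommGroup E] [NormedSpace ℝ E] (f : ℝ → E)
    {X : ℝ} (hX : 0 ≤ X) : ∫ t in (0 : ℝ)..X, f t = ∫ t in Ioo 0 X, f t := by
  rw [intervalIntegral.integral_of_le hX, integral_Ioc_eq_integral_Ioo]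

theorem exists_isSpectralKernel {k k' : ℤ}
    (hev : Summable fun n => (ev n - shiftIndex k k' n) ^ 2)
    (hc : Summable fun n => (1 / normalizingNumber φ h₂ (ev n) - 1 / π) ^ 2) :
    ∃ F, IsSpectralKernel φ h₂ ev F := by
  obtain ⟨⟨A, hA, hlim⟩, -⟩ := exists_trigSum_limit hev hc
  -- A measurable representative makes the kernel jointly measurable and meaningful for every `x`;
  -- the pairings do not notice the change.
  set A' := hA.1.mk A
  have hAA' : A =ᵐ[wideMeasure] A' := hA.1.ae_eq_mk
  have hA' : MemLp A' 2 wideMeasure := (memLp_congr_ae hAA').1 hA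
  have hm : Measurable A' := hA.1.stronglyMeasurable_mk.measurable
  refine ⟨fun x t => Matrix.of fun i j => reflectKernel A' i j x t, fun i j => ?_,
    fun x hx i j => ⟨memLp_reflectKernel hx hA' i j, fun g hg => ?_⟩⟩
  · refine Measurable.aestronglyMeasurable ?_
    simp only [Matrix.of_apply, reflectKernel]
    fun_prop
  · obtain ⟨G, hG, e⟩ := exists_integral_reflectKernel_mul hx i j hg
    simp only [partialF_apply, Matrix.of_apply]
    simp only [intervalIntegral_pi_eq _ Real.pi_pos.le]
    rw [e A' hA']
    simp only [e _ (memLp_trigSum _ _ _)]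
    have h1 := hlim G hG
    have h2 : ∫ s, A s * G s ∂wideMeasure = ∫ s, A' s * G s ∂wideMeasure :=
      integral_congr_ae (hAA'.mul EventuallyEq.rfl)
    rwa [h2] at h1

theorem exists_bound_partialF {k k' : ℤ}
    (hev : Summable fun n => (ev n - shiftIndex k k' n) ^ 2)
    (hc : Summable fun n => (1 / normalizingNumber φ h₂ (ev n) - 1 / π) ^ 2) :
    ∃ C : ℝ, 0 ≤ C ∧ ∀ N, ∀ x ∈ Icc 0 π, ∀ i j,
      ∫ t in Ioo 0 π, ‖partialF φ h₂ ev N x t i j‖ ^ 2 ≤ C := by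
  obtain ⟨-, C, hC⟩ := exists_trigSum_limit hev hc
  refine ⟨C, (integral_nonneg fun _ => by positivity).trans (hC 0), fun N x hx i j => ?_⟩
  simp only [partialF_apply]
  exact (integral_norm_sq_reflectKernel_le hx (memLp_trigSum _ _ _) i j).trans (hC N)

theorem memLp_partialF (N : ℕ) {x : ℝ} (hx : x ∈ Icc 0 π) (i j : Fin 2) :
    MemLp (fun t => partialF φ h₂ ev N x t i j) 2 (volume.restrict (Ioo 0 π)) := by
  simp only [partialF_apply]
  exact memLp_reflectKernel hx (memLp_trigSum _ _ _) i j

/-- Weak limits do not increase the norm. -/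
theorem integral_norm_sq_le_of_tendsto {α : Type*} [MeasurableSpace α] {μ : Measure α}
    {u : ℕ → α → ℂ} {f : α → ℂ} (hu : ∀ N, MemLp (u N) 2 μ) (hf : MemLp f 2 μ) {C : ℝ}
    (hC : 0 ≤ C) (hb : ∀ N, ∫ a, ‖u N a‖ ^ 2 ∂μ ≤ C)
    (h : ∀ g, MemLp g 2 μ → Tendsto (fun N => ∫ a, u N a * g a ∂μ) atTop
      (𝓝 (∫ a, f a * g a ∂μ))) : ∫ a, ‖f a‖ ^ 2 ∂μ ≤ C := by
  set I := ∫ a, ‖f a‖ ^ 2 ∂μ with hI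
  have hI0 : 0 ≤ I := integral_nonneg fun _ => by positivity
  have h1 := (h _ hf.star).norm.pow 2
  have e : ∫ a, f a * star f a ∂μ = (I : ℂ) := by
    rw [hI, ← integral_complex_ofReal]
    refine integral_congr_ae (Eventually.of_forall fun a => ?_)
    have := Complex.mul_conj (f a)
    rw [Complex.normSq_eq_norm_sq] at this
    exact this
  rw [e, Complex.norm_real, Real.norm_eq_abs, sq_abs] at h1
  have h2 : I ^ 2 ≤ C * I := by
    refine le_of_tendsto h1 (Eventually.of_forall fun N => ?_)
    have h3 := norm_integral_mul_sq_le (hu N) hf.star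
    have h4 : ∫ a, ‖star f a‖ ^ 2 ∂μ = I := by simp [hI]
    rw [h4] at h3
    exact h3.trans (mul_le_mul_of_nonneg_right (hb N) hI0)
  by_contra hlt
  push Not at hlt
  nlinarith

/-- The partial sums are bounded in `L²` uniformly in `N` and `x`, and weak limits inherit the
bound. This applies to every admissible `F` and justifies the later use of Fubini's theorem. -/
theorem IsSpectralKernel.exists_bound {F : ℝ → ℝ → Matrix (Fin 2) (Fin 2) ℂ}
    (hF : IsSpectralKernel φ h₂ ev F) {k k' : ℤ}
    (hev : Summable fun n => (ev n - shiftIndex k k' n) ^ 2)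
    (hc : Summable fun n => (1 / normalizingNumber φ h₂ (ev n) - 1 / π) ^ 2) :
    ∃ C : ℝ, 0 ≤ C ∧ ∀ x ∈ Icc 0 π, ∀ i j, ∫ t in Ioo 0 π, ‖F x t i j‖ ^ 2 ≤ C := by
  obtain ⟨C, hC, hb⟩ := exists_bound_partialF hev hc
  refine ⟨C, hC, fun x hx i j => ?_⟩
  refine integral_norm_sq_le_of_tendsto (fun N => memLp_partialF N hx i j) (hF.2 x hx i j).1 hC
    (fun N => hb N x hx i j) fun g hg => ?_
  simpa only [intervalIntegral_pi_eq _ Real.pi_pos.le] using (hF.2 x hx i j).2 g hg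

end DiracBVP

/-! ### Compact symmetric integral operators -/

namespace DiracBVP

/-- An operator that is square summable on a Hilbert basis is compact. -/
theorem isCompactOperator_of_summable_norm_sq {H H' ι : Type*} [NormedAddCommGroup H]
    [InnerProductSpace ℂ H] [NormedAddCommGroup H'] [NormedSpace ℂ H'] [CompleteSpace H']
    (T : H →L[ℂ] H') (b : HilbertBasis ι ℂ H) (h : Summable fun i => ‖T (b i)‖ ^ 2) :
    IsCompactOperator T := by
  set S : Finset ι → H →L[ℂ] H' := fun s => ∑ i ∈ s, (innerSL ℂ (b i)).smulRight (T (b i)) with hS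
  have hcomp : ∀ s, IsCompactOperator (S s) := fun s => by
    refine (Submodule.sum_mem (compactOperator (RingHom.id ℂ) H H') fun i _ => ?_ :
      S s ∈ compactOperator (RingHom.id ℂ) H H')
    exact (isCompactOperator_of_locallyCompactSpace_rng
      (ContinuousLinearMap.toSpanSingleton ℂ (T (b i)))).comp_clm (innerSL ℂ (b i))
  have hSa : ∀ s f, S s f = ∑ i ∈ s, inner ℂ (b i) f • T (b i) := fun s f => by
    simp [hS]
  refine isCompactOperator_of_tendsto (l := (atTop : Filter (Finset ι))) (F := S) ?_
    (Eventually.of_forall hcomp)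
  rw [Metric.tendsto_nhds]
  intro ε hε
  -- The operator is approximated in norm by its finite rank truncations: Cauchy–Schwarz bounds the
  -- remainder by the tail of `∑ ‖T b_i‖²` times Bessel's sum for `f`.
  obtain ⟨s, hs⟩ := summable_iff_vanishing_norm.1 h ((ε / 2) ^ 2) (by positivity)
  filter_upwards [eventually_ge_atTop s] with s' hs'
  rw [dist_eq_norm, norm_sub_rev]
  refine lt_of_le_of_lt (ContinuousLinearMap.opNorm_le_bound _ (by positivity) fun f => ?_)
    (half_lt_self hε)
  have h1 : HasSum (fun i => inner ℂ (b i) f • T (b i)) (T f) := by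
    have := (b.hasSum_repr f).mapL T
    simpa [b.repr_apply_apply] using this
  have h2 : Tendsto (fun u => ‖∑ i ∈ u, inner ℂ (b i) f • T (b i) - S s' f‖) atTop
      (𝓝 ‖T f - S s' f‖) := (Tendsto.sub_const h1 _).norm
  refine le_of_tendsto h2 ?_
  filter_upwards [eventually_ge_atTop s'] with u hu
  classical
  rw [hSa, ← Finset.sum_sdiff hu, add_sub_cancel_right]
  have h3 : Disjoint (u \ s') s := Finset.disjoint_of_subset_right hs' Finset.sdiff_disjoint
  have h4 := (le_abs_self _).trans (hs _ h3).le
  refine abs_le_of_sq_le_sq' ?_ (by positivity) |>.2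
  have h5 : ‖∑ i ∈ u \ s', inner ℂ (b i) f • T (b i)‖ ≤
      ∑ i ∈ u \ s', ‖inner ℂ (b i) f‖ * ‖T (b i)‖ :=
    (norm_sum_le _ _).trans (Finset.sum_le_sum fun i _ => (norm_smul _ _).le)
  refine (pow_le_pow_left₀ (norm_nonneg _) h5 2).trans ?_
  refine (Finset.sum_mul_sq_le_sq_mul_sq _ _ _).trans ?_
  rw [mul_comm, mul_pow]
  exact mul_le_mul h4 (b.orthonormal.sum_inner_products_le f)
    (Finset.sum_nonneg fun _ _ => by positivity) (by positivity)

section KernelOperator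

variable {α : Type*} [MeasurableSpace α] {μ : Measure α}

theorem norm_Lp_sq (F : Lp ℂ 2 μ) : ‖F‖ ^ 2 = ∫ a, ‖F a‖ ^ 2 ∂μ := by
  have := norm_toLp_sq (Lp.memLp F)
  rwa [Lp.toLp_coeFn] at this

variable [IsFiniteMeasure μ]

/-- Integral operators with a bounded measurable kernel on a finite measure space. -/
theorem exists_kernelOperator {k : α → α → ℂ} (hk : StronglyMeasurable (Function.uncurry k))
    {C : ℝ} (hC : ∀ w v, ‖k w v‖ ≤ C) :
    ∃ T : Lp ℂ 2 μ →L[ℂ] Lp ℂ 2 μ, (∀ F, T F =ᵐ[μ] fun w => ∫ v, k w v * F v ∂μ) ∧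
      IsCompactOperator T ∧
      ((∀ w v, k w v = (starRingEnd ℂ) (k v w)) → (T : Lp ℂ 2 μ →ₗ[ℂ] Lp ℂ 2 μ).IsSymmetric) := by
  have hkr : ∀ w, MemLp (k w) 2 μ := fun w =>
    MemLp.of_bound (hk.comp_measurable measurable_prodMk_left).aestronglyMeasurable C
      (Eventually.of_forall (hC w))
  have hk2 : ∀ w, ∫ v, ‖k w v‖ ^ 2 ∂μ ≤ C ^ 2 * μ.real univ := fun w => by
    have h0 : Integrable (fun v => ‖k w v‖ ^ 2) μ :=
      (memLp_two_iff_integrable_sq_norm (hkr w).1).1 (hkr w)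
    refine (integral_mono h0 (integrable_const (C ^ 2)) fun v =>
      pow_le_pow_left₀ (norm_nonneg _) (hC w v) 2).trans (le_of_eq ?_)
    rw [integral_const, smul_eq_mul, mul_comm]
  have hi : ∀ w (F : Lp ℂ 2 μ), Integrable (fun v => k w v * F v) μ := fun w F =>
    (hkr w).integrable_mul (Lp.memLp F)
  have hpt : ∀ w (F : Lp ℂ 2 μ), ‖∫ v, k w v * F v ∂μ‖ ^ 2 ≤ C ^ 2 * μ.real univ * ‖F‖ ^ 2 :=
    fun w F => by
      rw [norm_Lp_sq]
      exact (norm_integral_mul_sq_le (hkr w) (Lp.memLp F)).trans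
        (mul_le_mul_of_nonneg_right (hk2 w) (integral_nonneg fun _ => by positivity))
  have hsm : ∀ F : Lp ℂ 2 μ, StronglyMeasurable fun w => ∫ v, k w v * F v ∂μ := fun F => by
    have : StronglyMeasurable (Function.uncurry fun w v => k w v * F v) :=
      hk.mul ((Lp.stronglyMeasurable F).comp_measurable measurable_snd)
    exact this.integral_prod_right
  have hmem : ∀ F : Lp ℂ 2 μ, MemLp (fun w => ∫ v, k w v * F v ∂μ) 2 μ := fun F =>
    MemLp.of_bound (hsm F).aestronglyMeasurable (√(C ^ 2 * μ.real univ * ‖F‖ ^ 2))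
      (Eventually.of_forall fun w => Real.le_sqrt_of_sq_le (hpt w F))
  let L : Lp ℂ 2 μ →ₗ[ℂ] Lp ℂ 2 μ :=
    { toFun := fun F => (hmem F).toLp _
      map_add' := fun F G => by
        rw [← MemLp.toLp_add, MemLp.toLp_eq_toLp_iff]
        refine Eventually.of_forall fun w => ?_
        simp only [Pi.add_apply]
        rw [← integral_add (hi w F) (hi w G)]
        refine integral_congr_ae ?_
        filter_upwards [Lp.coeFn_add F G] with v hv
        rw [hv, Pi.add_apply, mul_add]
      map_smul' := fun c F => by
        rw [RingHom.id_apply, ← MemLp.toLp_const_smul, MemLp.toLp_eq_toLp_iff]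
        refine Eventually.of_forall fun w => ?_
        simp only [Pi.smul_apply, smul_eq_mul]
        rw [← integral_const_mul]
        refine integral_congr_ae ?_
        filter_upwards [Lp.coeFn_smul c F] with v hv
        rw [hv, Pi.smul_apply, smul_eq_mul]; ring }
  have hLc : ∀ F, L F =ᵐ[μ] fun w => ∫ v, k w v * F v ∂μ := fun F => (hmem F).coeFn_toLp
  have hLn : ∀ F, ‖L F‖ ^ 2 = ∫ w, ‖∫ v, k w v * F v ∂μ‖ ^ 2 ∂μ := fun F => norm_toLp_sq (hmem F)
  let T : Lp ℂ 2 μ →L[ℂ] Lp ℂ 2 μ := L.mkContinuous (|C| * μ.real univ) fun F => by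
    refine abs_le_of_sq_le_sq' ?_ (by positivity) |>.2
    rw [hLn]
    refine (integral_mono ((memLp_two_iff_integrable_sq_norm (hmem F).1).1 (hmem F))
      (integrable_const _) (hpt · F)).trans (le_of_eq ?_)
    rw [integral_const, smul_eq_mul, mul_pow, mul_pow, sq_abs]; ring
  refine ⟨T, hLc, ?_, fun hsymm F G => ?_⟩
  · obtain ⟨ι, b, -⟩ := exists_hilbertBasis ℂ (Lp ℂ 2 μ)
    refine isCompactOperator_of_summable_norm_sq T b
      (summable_of_sum_le (c := C ^ 2 * μ.real univ * μ.real univ) (fun _ => by positivity)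
        fun s => ?_)
    have h1 : ∀ i, ‖T (b i)‖ ^ 2 = ∫ w, ‖∫ v, k w v * b i v ∂μ‖ ^ 2 ∂μ := fun i => hLn (b i)
    have h2 : ∀ i ∈ s, Integrable (fun w => ‖∫ v, k w v * b i v ∂μ‖ ^ 2) μ := fun i _ =>
      (memLp_two_iff_integrable_sq_norm (hmem (b i)).1).1 (hmem (b i))
    simp only [h1]
    rw [← integral_finsetSum _ h2]
    refine (integral_mono (integrable_finsetSum _ h2)
      (integrable_const (C ^ 2 * μ.real univ)) fun w => ?_).trans (le_of_eq ?_)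
    -- Bessel's inequality for the row `k w`, integrated over `w`, is the Hilbert–Schmidt bound.
    · have h3 := b.orthonormal.sum_inner_products_le (s := s) ((hkr w).star.toLp _)
      have h4 : ‖(hkr w).star.toLp _‖ ^ 2 ≤ C ^ 2 * μ.real univ := by
        rw [norm_toLp_sq]
        simpa using hk2 w
      refine le_trans (le_of_eq (Finset.sum_congr rfl fun i _ => ?_)) (h3.trans h4)
      rw [norm_inner_symm, L2.inner_def]
      congr 2
      refine integral_congr_ae ?_
      filter_upwards [(hkr w).star.coeFn_toLp] with v hv
      rw [hv]
      simp [mul_comm]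
    · rw [integral_const, smul_eq_mul, mul_comm]
  · rw [L2.inner_def, L2.inner_def]
    have e1 : ∫ w, inner ℂ ((T : Lp ℂ 2 μ →ₗ[ℂ] Lp ℂ 2 μ) F w) (G w) ∂μ =
        ∫ w, ∫ v, G w * k v w * (starRingEnd ℂ) (F v) ∂μ ∂μ := by
      refine integral_congr_ae ?_
      filter_upwards [hLc F] with w hw
      change inner ℂ (L F w) (G w) = _
      rw [hw, RCLike.inner_apply, ← integral_conj, ← integral_const_mul]
      refine integral_congr_ae (Eventually.of_forall fun v => ?_)
      simp only [map_mul]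
      rw [hsymm v w]; ring
    have e2 : ∫ v, inner ℂ (F v) ((T : Lp ℂ 2 μ →ₗ[ℂ] Lp ℂ 2 μ) G v) ∂μ =
        ∫ v, ∫ w, G w * k v w * (starRingEnd ℂ) (F v) ∂μ ∂μ := by
      refine integral_congr_ae ?_
      filter_upwards [hLc G] with v hv
      change inner ℂ (F v) (L G v) = _
      rw [hv, RCLike.inner_apply, ← integral_mul_const]
      refine integral_congr_ae (Eventually.of_forall fun w => ?_)
      ring
    rw [e1, e2]
    refine integral_integral_swap ?_
    have hF : Integrable (fun v => (starRingEnd ℂ) (F v)) μ :=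
      (MemLp.star (Lp.memLp F)).integrable one_le_two
    have hG : Integrable (fun w => G w) μ := (Lp.memLp G).integrable one_le_two
    have h5 : Integrable (fun z : α × α => k z.2 z.1 * (G z.1 * (starRingEnd ℂ) (F z.2)))
        (μ.prod μ) :=
      (hG.mul_prod hF).bdd_mul (c := C)
        (hk.comp_measurable measurable_swap).aestronglyMeasurable
        (Eventually.of_forall fun z => hC _ _)
    refine h5.congr (Eventually.of_forall fun z => ?_)
    simp only [Function.uncurry]
    ring

end KernelOperator

end DiracBVP

/-! ### The resolvent with the spectral parameter in the boundary condition -/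

namespace DiracBVP

variable {p q : ℝ → ℝ} {φ : ℝ → ℂ → Fin 2 → ℂ} {h₁ h₂ : ℝ}

section BvpMeasure

/-- The measure whose `L²` space carries the problem with the spectral parameter in the boundary
condition. -/
noncomputable def bvpMeasure (h₂ : ℝ) : Measure (ℝ × Fin 2) :=
  pairMeasure (volume.restrict (Ioo 0 π) + ENNReal.ofReal (1 / h₂) • Measure.dirac π)
    (volume.restrict (Ioo 0 π))

instance (h₂ : ℝ) : IsFiniteMeasure (ENNReal.ofReal (1 / h₂) • (Measure.dirac π : Measure ℝ)) :=
  ⟨by simp⟩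

instance (h₂ : ℝ) : IsFiniteMeasure (bvpMeasure h₂) := by
  unfold bvpMeasure; infer_instance

theorem ae_bvpMeasure (hh₂ : 0 < h₂) {P : ℝ × Fin 2 → Prop} :
    (∀ᵐ w ∂(bvpMeasure h₂), P w) ↔
      (∀ i, ∀ᵐ t ∂(volume.restrict (Ioo 0 π)), P (t, i)) ∧ P (π, 0) := by
  have hne : ENNReal.ofReal (1 / h₂) ≠ 0 := by simpa using hh₂
  rw [bvpMeasure, ae_pairMeasure, ae_add_measure_iff, Measure.ae_ennreal_smul_measure_iff hne,
    ae_dirac_eq, Filter.eventually_pure, Fin.forall_fin_two]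
  tauto

theorem memLp_of_memLp_bvpMeasure {f : ℝ × Fin 2 → ℂ} (hf : MemLp f 2 (bvpMeasure h₂))
    (i : Fin 2) : MemLp (fun t => f (t, i)) 2 (volume.restrict (Ioo 0 π)) := by
  have h := memLp_pairMeasure.1 hf
  fin_cases i
  · exact h.1.left_of_add_measure
  · exact h.2

theorem memLp_bvpMeasure {f : ℝ × Fin 2 → ℂ}
    (hf : ∀ i, MemLp (fun t => f (t, i)) 2 (volume.restrict (Ioo 0 π))) :
    MemLp f 2 (bvpMeasure h₂) := by
  have hm : AEStronglyMeasurable (fun t => f (t, 0))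
      (ENNReal.ofReal (1 / h₂) • (Measure.dirac π : Measure ℝ)) := aestronglyMeasurable_dirac.smul_measure _
  have hd : MemLp (fun t => f (t, 0)) 2
      (ENNReal.ofReal (1 / h₂) • (Measure.dirac π : Measure ℝ)) :=
    MemLp.of_bound hm ‖f (π, 0)‖
      (Measure.ae_smul_measure (by rw [ae_dirac_eq, Filter.eventually_pure]) _)
  refine memLp_pairMeasure.2 ⟨?_, hf 1⟩
  have h0 := hf 0
  have hms : AEStronglyMeasurable (fun t => f (t, 0)) (volume.restrict (Ioo 0 π) +
      ENNReal.ofReal (1 / h₂) • (Measure.dirac π : Measure ℝ)) :=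
    aestronglyMeasurable_add_measure_iff.2 ⟨h0.1, hm⟩
  rw [memLp_two_iff_integrable_sq_norm hms, integrable_add_measure]
  exact ⟨(memLp_two_iff_integrable_sq_norm h0.1).1 h0,
    (memLp_two_iff_integrable_sq_norm hm).1 hd⟩

theorem integral_bvpMeasure (hh₂ : 0 < h₂) {f : ℝ × Fin 2 → ℂ}
    (hf : Integrable f (bvpMeasure h₂)) :
    ∫ w, f w ∂(bvpMeasure h₂) =
      (∫ t in Ioo 0 π, (f (t, 0) + f (t, 1))) + 1 / h₂ * f (π, 0) := by
  have h := integrable_pairMeasure.1 hf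
  have h0 := integrable_add_measure.1 h.1
  rw [bvpMeasure, integral_pairMeasure hf, integral_add_measure h0.1 h0.2, integral_smul_measure,
    integral_dirac, integral_add h0.1 h.2, ENNReal.toReal_ofReal (by positivity),
    Complex.real_smul]
  push_cast
  ring

end BvpMeasure

section Step

/-- The Heaviside function, normalised symmetrically at the origin. -/
noncomputable def heavisideHalf (u : ℝ) : ℂ := if 0 < u then 1 else if u = 0 then 1 / 2 else 0

theorem measurable_heavisideHalf : Measurable heavisideHalf :=
  Measurable.ite measurableSet_Ioi measurable_const
    (Measurable.ite (measurableSet_singleton 0) measurable_const measurable_const)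

theorem norm_heavisideHalf_le (u : ℝ) : ‖heavisideHalf u‖ ≤ 1 := by
  unfold heavisideHalf
  split_ifs <;> norm_num

theorem conj_heavisideHalf (u : ℝ) : (starRingEnd ℂ) (heavisideHalf u) = heavisideHalf u := by
  unfold heavisideHalf
  split_ifs
  · simp
  · rw [map_div₀, map_one, map_ofNat]
  · simp

theorem setIntegral_heavisideHalf_left {s : ℝ} (hs : s ∈ Icc 0 π) (G : ℝ → ℂ) :
    ∫ t in Ioo 0 π, heavisideHalf (s - t) * G t = ∫ t in (0 : ℝ)..s, G t := by
  have h1 : ∀ᵐ t ∂(volume.restrict (Ioo 0 π)),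
      heavisideHalf (s - t) * G t = (Iio s).indicator G t := by
    refine ae_restrict_of_ae ?_
    filter_upwards [Measure.ae_ne volume s] with t ht
    rcases lt_or_gt_of_ne ht with h | h
    · rw [heavisideHalf, if_pos (by linarith), one_mul, indicator_of_mem (show t ∈ Iio s from h)]
    · rw [heavisideHalf, if_neg (by linarith), if_neg (by linarith), zero_mul,
        indicator_of_notMem (by simpa using h.le)]
  rw [integral_congr_ae h1, setIntegral_indicator measurableSet_Iio, intervalIntegral_pi_eq _ hs.1]
  congr 2
  ext t
  simp only [mem_inter_iff, mem_Ioo, mem_Iio]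
  constructor
  · rintro ⟨⟨h2, -⟩, h3⟩; exact ⟨h2, h3⟩
  · rintro ⟨h2, h3⟩; exact ⟨⟨h2, h3.trans_le hs.2⟩, h3⟩

theorem setIntegral_heavisideHalf_right {s : ℝ} (hs : s ∈ Icc 0 π) (G : ℝ → ℂ) :
    ∫ t in Ioo 0 π, heavisideHalf (t - s) * G t = ∫ t in s..π, G t := by
  have h1 : ∀ᵐ t ∂(volume.restrict (Ioo 0 π)),
      heavisideHalf (t - s) * G t = (Ioi s).indicator G t := by
    refine ae_restrict_of_ae ?_
    filter_upwards [Measure.ae_ne volume s] with t ht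
    rcases lt_or_gt_of_ne ht with h | h
    · rw [heavisideHalf, if_neg (by linarith), if_neg (by linarith), zero_mul,
        indicator_of_notMem (by simpa using h.le)]
    · rw [heavisideHalf, if_pos (by linarith), one_mul, indicator_of_mem (show t ∈ Ioi s from h)]
  rw [integral_congr_ae h1, setIntegral_indicator measurableSet_Ioi,
    intervalIntegral.integral_of_le hs.2, integral_Ioc_eq_integral_Ioo]
  congr 2
  ext t
  simp only [mem_inter_iff, mem_Ioo, mem_Ioi]
  constructor
  · rintro ⟨⟨-, h2⟩, h3⟩; exact ⟨h3, h2⟩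
  · rintro ⟨h2, h3⟩; exact ⟨⟨hs.1.trans_lt h2, h3⟩, h2⟩

end Step

theorem IsSolution.conj_eq (hp : MemLp p 2 (volume.restrict (Ioo 0 π)))
    (hq : MemLp q 2 (volume.restrict (Ioo 0 π))) {l : ℝ} {y : ℝ → Fin 2 → ℂ}
    (hy : IsSolution p q l y) (h0 : ∀ i, (starRingEnd ℂ) (y 0 i) = y 0 i) {x : ℝ}
    (hx : x ∈ Icc 0 π) (i : Fin 2) : (starRingEnd ℂ) (y x i) = y x i := by
  have h1 := hy.conj hp hq
  rw [Complex.conj_ofReal] at h1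
  exact congrFun (h1.eq_of_eq_zero hp hq hy (funext h0) x hx) i

/-- The solution satisfying the boundary condition at `π`. -/
theorem IsPhi.exists_right_solution (hp : MemLp p 2 (volume.restrict (Ioo 0 π)))
    (hq : MemLp q 2 (volume.restrict (Ioo 0 π))) (hφ : IsPhi p q φ) (h₁ h₂ l : ℝ) :
    ∃ ψ : ℝ → Fin 2 → ℂ, IsSolution p q l ψ ∧
      (∀ x ∈ Icc 0 π, ∀ i, (starRingEnd ℂ) (ψ x i) = ψ x i) ∧
      ψ π 0 = h₂ ∧ ψ π 1 = -(l + h₁) ∧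
      ∀ x ∈ Icc 0 π, ψ x 0 * φ x l 1 - φ x l 0 * ψ x 1 = charFun φ h₁ h₂ l := by
  obtain ⟨χ, hχ, hχ0⟩ := exists_isSolution hp hq (l : ℂ) ![1, 0]
  have hχr : ∀ x ∈ Icc 0 π, ∀ i, (starRingEnd ℂ) (χ x i) = χ x i := fun x hx i =>
    hχ.conj_eq hp hq (fun i => by rw [hχ0]; fin_cases i <;> simp) hx i
  have hw := (hφ l).1.green hp hq hχ pi_mem_Icc_pi
  rw [sub_self, zero_mul, hχ0, (hφ l).2] at hw
  simp only [Matrix.cons_val_zero, Matrix.cons_val_one, Matrix.cons_val_fin_one] at hw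
  -- Cramer's rule for prescribing `ψ(π) = (h₂, -(l + h₁))`, using the constant Wronskian `φ₂χ₁ -
  -- φ₁χ₂ = -1`.
  set a : ℂ := h₂ * χ π 1 + (l + h₁) * χ π 0 with ha
  set b : ℂ := φ π l 0 * (l + h₁) + φ π l 1 * h₂ with hb
  have hψ := ((hφ l).1.smul hp hq a).sub hp hq (hχ.smul hp hq b)
  have e0 : ∀ x i, (a • φ x l - b • χ x) i = a * φ x l i - b * χ x i := fun x i => by simp
  have h0 : (a • φ π l - b • χ π) 0 = h₂ := by
    rw [e0, ha, hb]; linear_combination (h₂ : ℂ) * hw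
  have h1 : (a • φ π l - b • χ π) 1 = -(l + h₁) := by
    rw [e0, ha, hb]; linear_combination (-(l + h₁) : ℂ) * hw
  refine ⟨fun x => a • φ x l - b • χ x, hψ, fun x hx i => ?_, h0, h1, fun x hx => ?_⟩
  · have ra : (starRingEnd ℂ) a = a := by
      simp [ha, hχr π pi_mem_Icc_pi]
    have rb : (starRingEnd ℂ) b = b := by
      simp [hb, hφ.conj_eq hp hq l pi_mem_Icc_pi]
    simp only [e0]
    rw [map_sub, map_mul, map_mul, ra, rb, hφ.conj_eq hp hq l hx, hχr x hx]
  · have g1 := (hφ l).1.green hp hq hψ hx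
    have g2 := (hφ l).1.green hp hq hψ pi_mem_Icc_pi
    rw [h0, h1] at g2
    simp only [charFun]
    linear_combination g2 - g1

/-- The kernel is Green's function: `φ` satisfies the condition at `0`, `ψ` the one at `π`, and
their Wronskian is the constant `W ≠ 0`. The operator inverts `l` minus the differential operator on
`L²(0, π)² ⊕ ℂ`; the value `F (π, 0)` at the atom is the independent scalar coordinate and appears
as the datum of the boundary condition. -/
theorem exists_resolvent (hp : MemLp p 2 (volume.restrict (Ioo 0 π)))
    (hq : MemLp q 2 (volume.restrict (Ioo 0 π))) (hφ : IsPhi p q φ) (hh₂ : 0 < h₂) {l : ℝ}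
    (hl : charFun φ h₁ h₂ l ≠ 0) :
    ∃ T : Lp ℂ 2 (bvpMeasure h₂) →L[ℂ] Lp ℂ 2 (bvpMeasure h₂), IsCompactOperator T ∧
      (T : Lp ℂ 2 (bvpMeasure h₂) →ₗ[ℂ] Lp ℂ 2 (bvpMeasure h₂)).IsSymmetric ∧
      ∀ F : Lp ℂ 2 (bvpMeasure h₂), ∃ u : ℝ → Fin 2 → ℂ,
        T F =ᵐ[bvpMeasure h₂] (fun w => u w.1 w.2) ∧
        HasAEDeriv (fun x => u x 0) (fun x => ∑ j, sysCoeff p q l 0 j x * u x j + F (x, 1)) ∧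
        HasAEDeriv (fun x => u x 1) (fun x => ∑ j, sysCoeff p q l 1 j x * u x j - F (x, 0)) ∧
        u 0 0 = 0 ∧ (l + h₁) * u π 0 + h₂ * u π 1 = F (π, 0) := by
  obtain ⟨ψ, hψ, hψr, hψ0, hψ1, hW⟩ := hφ.exists_right_solution hp hq h₁ h₂ l
  set W := charFun φ h₁ h₂ l with hWdef
  have hWr : (starRingEnd ℂ) W = W := by
    rw [hWdef]
    simp [charFun, hφ.conj_eq hp hq l pi_mem_Icc_pi]
  have hφs := (isSolution_iff hp hq).1 (hφ l).1
  have hψs := (isSolution_iff hp hq).1 hψ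
  set pr : ℝ → ℝ := fun x => projIcc 0 π Real.pi_pos.le x with hpr
  have prm : ∀ x, pr x ∈ Icc 0 π := fun x => (projIcc 0 π Real.pi_pos.le x).2
  have pre : ∀ x ∈ Icc 0 π, pr x = x := fun x hx => by
    simp only [hpr, projIcc_of_mem Real.pi_pos.le hx]
  have prc : Continuous pr := continuous_subtype_val.comp continuous_projIcc
  have ext_meas : ∀ {y : ℝ → Fin 2 → ℂ}, ContinuousOn y (Icc 0 π) →
      Measurable fun w : ℝ × Fin 2 => y (pr w.1) w.2 := fun hy =>
    measurable_from_prod_countable_left fun i =>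
      ((continuous_apply i).comp (hy.comp_continuous prc prm)).measurable
  obtain ⟨M₀, hM₀⟩ := isCompact_Icc.exists_bound_of_continuousOn hφs.1
  obtain ⟨M₁, hM₁⟩ := isCompact_Icc.exists_bound_of_continuousOn hψs.1
  have hbφ : ∀ w : ℝ × Fin 2, ‖φ (pr w.1) l w.2‖ ≤ M₀ := fun w =>
    (norm_le_pi_norm _ _).trans (hM₀ _ (prm _))
  have hbψ : ∀ w : ℝ × Fin 2, ‖ψ (pr w.1) w.2‖ ≤ M₁ := fun w =>
    (norm_le_pi_norm _ _).trans (hM₁ _ (prm _))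
  -- On the diagonal the two products are averaged. This makes the kernel Hermitian at every point,
  -- and the diagonal is not negligible because of the atom at `(π, 0)`.
  set k : ℝ × Fin 2 → ℝ × Fin 2 → ℂ := fun w v =>
    W⁻¹ * (heavisideHalf (w.1 - v.1) * (ψ (pr w.1) w.2 * φ (pr v.1) l v.2) +
      heavisideHalf (v.1 - w.1) * (φ (pr w.1) l w.2 * ψ (pr v.1) v.2)) with hk
  have mφ := ext_meas hφs.1
  have mψ := ext_meas hψs.1
  have hkm : StronglyMeasurable (Function.uncurry k) := by
    refine Measurable.stronglyMeasurable ?_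
    refine Measurable.const_mul (Measurable.add (Measurable.mul ?_ ?_) (Measurable.mul ?_ ?_)) _
    · exact measurable_heavisideHalf.comp (by fun_prop)
    · exact (mψ.comp measurable_fst).mul (mφ.comp measurable_snd)
    · exact measurable_heavisideHalf.comp (by fun_prop)
    · exact (mφ.comp measurable_fst).mul (mψ.comp measurable_snd)
  have hkb : ∀ w v, ‖k w v‖ ≤ ‖W⁻¹‖ * (1 * (M₁ * M₀) + 1 * (M₀ * M₁)) := by
    intro w v
    have hM₀' : 0 ≤ M₀ := (norm_nonneg _).trans (hbφ w)
    have hM₁' : 0 ≤ M₁ := (norm_nonneg _).trans (hbψ w)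
    rw [hk, norm_mul]
    refine mul_le_mul_of_nonneg_left ((norm_add_le _ _).trans (add_le_add ?_ ?_)) (norm_nonneg _)
    · rw [norm_mul, norm_mul]
      exact mul_le_mul (norm_heavisideHalf_le _) (mul_le_mul (hbψ w) (hbφ v) (norm_nonneg _) hM₁')
        (by positivity) zero_le_one
    · rw [norm_mul, norm_mul]
      exact mul_le_mul (norm_heavisideHalf_le _) (mul_le_mul (hbφ w) (hbψ v) (norm_nonneg _) hM₀')
        (by positivity) zero_le_one
  obtain ⟨T, hT, hTc, hTs⟩ := exists_kernelOperator (μ := bvpMeasure h₂) hkm hkb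
  refine ⟨T, hTc, hTs fun w v => ?_, fun F => ?_⟩
  · simp only [hk, map_mul, map_add, map_inv₀, conj_heavisideHalf, hWr,
      hφ.conj_eq hp hq l (prm _), hψr _ (prm _)]
    ring
  have hF := memLp_of_memLp_bvpMeasure (Lp.memLp F)
  have mem_comp : ∀ {y : ℝ → Fin 2 → ℂ}, ContinuousOn y (Icc 0 π) → ∀ i,
      MemLp (fun t => y t i) 2 (volume.restrict (Ioo 0 π)) := fun hy i =>
    ((continuous_apply i).comp_continuousOn hy).memLp_restrict_Ioo 2
  have hint : ∀ {y : ℝ → Fin 2 → ℂ}, ContinuousOn y (Icc 0 π) →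
      IntervalIntegrable (fun t => y t 0 * F (t, 0) + y t 1 * F (t, 1)) volume 0 π := fun hy => by
    rw [intervalIntegrable_iff_integrableOn_Ioo_of_le Real.pi_pos.le]
    exact ((mem_comp hy 0).integrable_mul (hF 0)).add ((mem_comp hy 1).integrable_mul (hF 1))
  have hint' : ∀ {y : ℝ → Fin 2 → ℂ}, ContinuousOn y (Icc 0 π) → ∀ {a b : ℝ}, a ∈ Icc 0 π →
      b ∈ Icc 0 π → IntervalIntegrable (fun t => y t 0 * F (t, 0) + y t 1 * F (t, 1)) volume a b :=
    by
      intro y hy a b ha hb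
      refine (hint hy).mono_set ?_
      rw [uIcc_of_le Real.pi_pos.le]
      exact uIcc_subset_Icc ha hb
  set P : ℝ → ℂ := fun s => ∫ t in (0 : ℝ)..s, (φ t l 0 * F (t, 0) + φ t l 1 * F (t, 1)) with hP
  -- The summand `F (π, 0)` is the contribution of the atom: its mass `1/h₂` times `ψ π 0 = h₂`.
  set Q : ℝ → ℂ := fun s => (∫ t in s..π, (ψ t 0 * F (t, 0) + ψ t 1 * F (t, 1))) + F (π, 0) with hQ
  have hPd : HasAEDeriv P (fun t => φ t l 0 * F (t, 0) + φ t l 1 * F (t, 1)) :=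
    hasAEDeriv_of_eq_add_integral (hint hφs.1) fun x hx => by simp [hP]
  have hQd : HasAEDeriv Q (fun t => -(ψ t 0 * F (t, 0) + ψ t 1 * F (t, 1))) := by
    refine hasAEDeriv_of_eq_add_integral (hint hψs.1).neg fun x hx => ?_
    simp only [hQ]
    rw [intervalIntegral.integral_neg, ← intervalIntegral.integral_add_adjacent_intervals
      (hint' hψs.1 zero_mem_Icc_pi hx) (hint' hψs.1 hx pi_mem_Icc_pi)]
    ring
  have hφd := hφs.2
  have hψd := hψs.2
  refine ⟨fun s i => W⁻¹ * (ψ s i * P s + φ s l i * Q s), ?_, ?_, ?_, ?_, ?_⟩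
  · -- evaluation of the integral operator
    have hsplit : ∀ w : ℝ × Fin 2, ∫ v, k w v * F v ∂(bvpMeasure h₂) =
        W⁻¹ * (ψ (pr w.1) w.2 * ((∫ t in Ioo 0 π, heavisideHalf (w.1 - t) *
          (φ t l 0 * F (t, 0) + φ t l 1 * F (t, 1))) +
            1 / h₂ * (heavisideHalf (w.1 - π) * φ π l 0 * F (π, 0))) +
          φ (pr w.1) l w.2 * ((∫ t in Ioo 0 π, heavisideHalf (t - w.1) *
            (ψ t 0 * F (t, 0) + ψ t 1 * F (t, 1))) +
              1 / h₂ * (heavisideHalf (π - w.1) * ψ π 0 * F (π, 0)))) := by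
      intro w
      have hi : ∀ {y : ℝ × Fin 2 → ℂ} {s : ℝ → ℝ}, Measurable y → Measurable s → ∀ {C : ℝ},
          (∀ v, ‖y v‖ ≤ C) → Integrable (fun v : ℝ × Fin 2 => heavisideHalf (s v.1) * y v * F v)
            (bvpMeasure h₂) := by
        intro y s hy hs C hC
        refine ((Lp.memLp F).integrable one_le_two).bdd_mul (c := 1 * C)
          ((measurable_heavisideHalf.comp (hs.comp measurable_fst)).mul hy).aestronglyMeasurable
          (Eventually.of_forall fun v => ?_)
        rw [norm_mul]
        exact mul_le_mul (norm_heavisideHalf_le _) (hC v) (norm_nonneg _) zero_le_one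
      have i1 := hi (s := fun t => w.1 - t) mφ (by fun_prop) hbφ
      have i2 := hi (s := fun t => t - w.1) mψ (by fun_prop) hbψ
      have e : ∀ v, k w v * F v =
          W⁻¹ * ψ (pr w.1) w.2 * (heavisideHalf (w.1 - v.1) * φ (pr v.1) l v.2 * F v) +
          W⁻¹ * φ (pr w.1) l w.2 * (heavisideHalf (v.1 - w.1) * ψ (pr v.1) v.2 * F v) := fun v => by
        simp only [hk]; ring
      simp only [e]
      rw [integral_add (i1.const_mul _) (i2.const_mul _), integral_const_mul, integral_const_mul,
        integral_bvpMeasure hh₂ i1, integral_bvpMeasure hh₂ i2]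
      have e1 : ∫ t in Ioo 0 π, (heavisideHalf (w.1 - t) * φ (pr t) l 0 * F (t, 0) +
          heavisideHalf (w.1 - t) * φ (pr t) l 1 * F (t, 1)) =
          ∫ t in Ioo 0 π, heavisideHalf (w.1 - t) *
            (φ t l 0 * F (t, 0) + φ t l 1 * F (t, 1)) := by
        refine setIntegral_congr_fun measurableSet_Ioo fun t ht => ?_
        simp only [pre t (Ioo_subset_Icc_self ht)]; ring
      have e2 : ∫ t in Ioo 0 π, (heavisideHalf (t - w.1) * ψ (pr t) 0 * F (t, 0) +
          heavisideHalf (t - w.1) * ψ (pr t) 1 * F (t, 1)) =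
          ∫ t in Ioo 0 π, heavisideHalf (t - w.1) *
            (ψ t 0 * F (t, 0) + ψ t 1 * F (t, 1)) := by
        refine setIntegral_congr_fun measurableSet_Ioo fun t ht => ?_
        simp only [pre t (Ioo_subset_Icc_self ht)]; ring
      simp only [e1, e2, pre π pi_mem_Icc_pi]
      ring
    have hh₂' : (h₂ : ℂ) ≠ 0 := by exact_mod_cast hh₂.ne'
    refine (hT F).trans ((ae_bvpMeasure hh₂).2 ⟨fun i => ?_, ?_⟩)
    · refine (ae_restrict_iff' measurableSet_Ioo).2 (Eventually.of_forall fun s hs => ?_)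
      have hs' := Ioo_subset_Icc_self hs
      change ∫ v, k (s, i) v * F v ∂(bvpMeasure h₂) = W⁻¹ * (ψ s i * P s + φ s l i * Q s)
      rw [hsplit]
      simp only [pre s hs', setIntegral_heavisideHalf_left hs', setIntegral_heavisideHalf_right hs']
      have z1 : heavisideHalf (s - π) = 0 := by
        rw [heavisideHalf, if_neg (by linarith [hs.2]), if_neg (by linarith [hs.2])]
      have z2 : heavisideHalf (π - s) = 1 := by
        rw [heavisideHalf, if_pos (by linarith [hs.2])]
      rw [z1, z2, hψ0]
      simp only [hP, hQ]
      field_simp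
      ring
    · change ∫ v, k (π, 0) v * F v ∂(bvpMeasure h₂) = W⁻¹ * (ψ π 0 * P π + φ π l 0 * Q π)
      rw [hsplit]
      simp only [pre π pi_mem_Icc_pi, setIntegral_heavisideHalf_left pi_mem_Icc_pi,
        setIntegral_heavisideHalf_right pi_mem_Icc_pi, sub_self]
      have z1 : heavisideHalf 0 = 1 / 2 := by simp [heavisideHalf]
      rw [z1, hψ0]
      simp only [hP, hQ, intervalIntegral.integral_same, zero_add]
      field_simp
      ring
  · refine ((((hψd 0).mul hPd).add ((hφd 0).mul hQd)).const_mul W⁻¹).congr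
      (Eventually.of_forall fun x hx => ?_)
    have := hW x (Ioo_subset_Icc_self hx)
    simp only [Fin.sum_univ_two]
    field_simp
    linear_combination F (x, 1) * this
  · refine ((((hψd 1).mul hPd).add ((hφd 1).mul hQd)).const_mul W⁻¹).congr
      (Eventually.of_forall fun x hx => ?_)
    have := hW x (Ioo_subset_Icc_self hx)
    simp only [Fin.sum_univ_two]
    field_simp
    linear_combination -F (x, 0) * this
  · simp [hP, (hφ l).2]
  · simp only [hQ, intervalIntegral.integral_same, zero_add, hψ0, hψ1]
    have : (l + h₁) * φ π l 0 + h₂ * φ π l 1 = W := by rw [hWdef, charFun]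
    field_simp
    linear_combination F (π, 0) * this

end DiracBVP

/-! ### Completeness of the eigenfunctions -/

namespace DiracBVP

variable {p q : ℝ → ℝ} {φ : ℝ → ℂ → Fin 2 → ℂ} {h₁ h₂ : ℝ} {ev : ℤ → ℝ}

theorem inner_toLp_eq {α : Type*} [MeasurableSpace α] {μ : Measure α} {f g : α → ℂ}
    (hf : MemLp f 2 μ) (hg : MemLp g 2 μ) :
    inner ℂ (hf.toLp f) (hg.toLp g) = ∫ a, (starRingEnd ℂ) (f a) * g a ∂μ := by
  rw [L2.inner_def]
  refine integral_congr_ae ?_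
  filter_upwards [hf.coeFn_toLp, hg.coeFn_toLp] with a h1 h2
  rw [h1, h2, RCLike.inner_apply, mul_comm]

theorem IsPhi.memLp_bvpMeasure (hφ : IsPhi p q φ) (h₂ : ℝ) (z : ℂ) :
    MemLp (fun w : ℝ × Fin 2 => φ w.1 z w.2) 2 (bvpMeasure h₂) :=
  DiracBVP.memLp_bvpMeasure fun i => (hφ.continuousOn_apply z i).memLp_restrict_Ioo 2

theorem IsPhi.integral_bvpMeasure_mul (hφ : IsPhi p q φ) (hh₂ : 0 < h₂) (z ζ : ℂ) :
    ∫ w, φ w.1 z w.2 * φ w.1 ζ w.2 ∂(bvpMeasure h₂) =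
      (∫ t in (0 : ℝ)..π, (φ t z 0 * φ t ζ 0 + φ t z 1 * φ t ζ 1)) +
        1 / h₂ * (φ π z 0 * φ π ζ 0) := by
  have hi : Integrable (fun w : ℝ × Fin 2 => φ w.1 z w.2 * φ w.1 ζ w.2) (bvpMeasure h₂) :=
    (hφ.memLp_bvpMeasure h₂ z).integrable_mul (hφ.memLp_bvpMeasure h₂ ζ)
  rw [integral_bvpMeasure hh₂ hi, intervalIntegral_pi_eq _ Real.pi_pos.le]

theorem IsPhi.integral_bvpMeasure_self (hp : MemLp p 2 (volume.restrict (Ioo 0 π)))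
    (hq : MemLp q 2 (volume.restrict (Ioo 0 π))) (hφ : IsPhi p q φ) (hh₂ : 0 < h₂) (l : ℝ) :
    ∫ w, φ w.1 l w.2 * φ w.1 l w.2 ∂(bvpMeasure h₂) = normalizingNumber φ h₂ l := by
  rw [hφ.integral_bvpMeasure_mul hh₂, ← hφ.ofReal_integral_norm_sq hp hq,
    hφ.mul_self_eq hp hq l pi_mem_Icc_pi, normalizingNumber]
  push_cast
  rfl

/-- In Green's identity the boundary conditions turn the Wronskian at `π` into minus `z - ζ` times
the atom's contribution; this is the reason for the mass `1/h₂`. -/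
theorem IsPhi.integral_bvpMeasure_eq_zero (hp : MemLp p 2 (volume.restrict (Ioo 0 π)))
    (hq : MemLp q 2 (volume.restrict (Ioo 0 π))) (hφ : IsPhi p q φ) (hh₂ : 0 < h₂) {z ζ : ℂ}
    (hz : charFun φ h₁ h₂ z = 0) (hζ : charFun φ h₁ h₂ ζ = 0) (hne : z ≠ ζ) :
    ∫ w, φ w.1 z w.2 * φ w.1 ζ w.2 ∂(bvpMeasure h₂) = 0 := by
  have hh₂' : (h₂ : ℂ) ≠ 0 := by exact_mod_cast hh₂.ne'
  rw [hφ.integral_bvpMeasure_mul hh₂]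
  have hg := (hφ z).1.green hp hq (hφ ζ).1 pi_mem_Icc_pi
  simp only [(hφ _).2, Matrix.cons_val_zero, Matrix.cons_val_one, Matrix.cons_val_fin_one] at hg
  simp only [charFun] at hz hζ
  refine (mul_eq_zero.1 (?_ : h₂ * (z - ζ) * _ = 0)).resolve_left
    (mul_ne_zero hh₂' (sub_ne_zero.2 hne))
  rw [mul_add, mul_assoc, hg]
  field_simp
  linear_combination φ π ζ 0 * hz - φ π z 0 * hζ

theorem HasAEDeriv.ae_eq_zero {y y' : ℝ → ℂ} (h : HasAEDeriv y y')
    (h0 : ∀ x ∈ Icc 0 π, y x = 0) : ∀ᵐ x ∂(volume.restrict (Ioo 0 π)), y' x = 0 := by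
  refine (ae_restrict_iff' measurableSet_Ioo).2 ?_
  filter_upwards [h.2.2] with x hx hmem
  have h1 : HasDerivAt y 0 x := (hasDerivAt_const x (0 : ℂ)).congr_of_eventuallyEq (by
    filter_upwards [isOpen_Ioo.mem_nhds hmem] with t ht using h0 t (Ioo_subset_Icc_self ht))
  exact (hx hmem).unique h1

theorem eq_zero_on_Icc_of_ae {y : ℝ → ℂ} (hy : ContinuousOn y (Icc 0 π))
    (h : ∀ᵐ x ∂(volume.restrict (Ioo 0 π)), y x = 0) : ∀ x ∈ Icc 0 π, y x = 0 := by
  rw [restrict_Ioo_eq_restrict_Icc] at h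
  exact Measure.eqOn_Icc_of_ae_eq volume Real.pi_pos.ne h hy continuousOn_const

/-- The eigenvectors of the resolvent are multiples of the `φ(·, λ_n)`. -/
theorem exists_eq_smul_of_resolvent_eigenvector
    (hp : MemLp p 2 (volume.restrict (Ioo 0 π)))
    (hq : MemLp q 2 (volume.restrict (Ioo 0 π))) (hφ : IsPhi p q φ) (hh₂ : 0 < h₂)
    {l : ℝ} {F : ℝ × Fin 2 → ℂ} {u : ℝ → Fin 2 → ℂ} {ρ : ℂ}
    (hu : ∀ᵐ w ∂(bvpMeasure h₂), u w.1 w.2 = ρ * F w)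
    (d0 : HasAEDeriv (fun x => u x 0) (fun x => ∑ j, sysCoeff p q l 0 j x * u x j + F (x, 1)))
    (d1 : HasAEDeriv (fun x => u x 1) (fun x => ∑ j, sysCoeff p q l 1 j x * u x j - F (x, 0)))
    (h0 : u 0 0 = 0) (hbc : (l + h₁) * u π 0 + h₂ * u π 1 = F (π, 0)) :
    (∀ᵐ w ∂(bvpMeasure h₂), F w = 0) ∨
      ∃ z c : ℂ, charFun φ h₁ h₂ z = 0 ∧ ∀ᵐ w ∂(bvpMeasure h₂), F w = c * φ w.1 z w.2 := by
  obtain ⟨hu1, hu2⟩ := (ae_bvpMeasure hh₂).1 hu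
  -- For `ρ = 0` the continuous components of `u` vanish identically, and the equations and the
  -- boundary condition give back `F = 0`. The resolvent is injective.
  rcases eq_or_ne ρ 0 with rfl | hρ
  · left
    have z0 : ∀ x ∈ Icc 0 π, u x 0 = 0 := eq_zero_on_Icc_of_ae d0.continuousOn (by simpa using hu1 0)
    have z1 : ∀ x ∈ Icc 0 π, u x 1 = 0 := eq_zero_on_Icc_of_ae d1.continuousOn (by simpa using hu1 1)
    have hmem := ae_restrict_mem (μ := (volume : Measure ℝ)) (measurableSet_Ioo (a := 0) (b := π))
    refine (ae_bvpMeasure hh₂).2 ⟨Fin.forall_fin_two.2 ⟨?_, ?_⟩, ?_⟩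
    · filter_upwards [d1.ae_eq_zero z1, hmem] with x hx hm
      simpa [Fin.sum_univ_two, z0 x (Ioo_subset_Icc_self hm), z1 x (Ioo_subset_Icc_self hm)] using hx
    · filter_upwards [d0.ae_eq_zero z0, hmem] with x hx hm
      simpa [Fin.sum_univ_two, z0 x (Ioo_subset_Icc_self hm), z1 x (Ioo_subset_Icc_self hm)] using hx
    · rw [← hbc, z0 π pi_mem_Icc_pi, z1 π pi_mem_Icc_pi]; simp
  -- Since the operator inverts `l` minus the differential operator, its eigenvalue `ρ` corresponds
  -- to the spectral parameter `l - ρ⁻¹`.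
  · set z : ℂ := l - ρ⁻¹ with hz
    have hF : ∀ᵐ w ∂(bvpMeasure h₂), F w = ρ⁻¹ * u w.1 w.2 := by
      filter_upwards [hu] with w hw
      rw [hw, inv_mul_cancel_left₀ hρ]
    obtain ⟨hF1, hF2⟩ := (ae_bvpMeasure hh₂).1 hF
    have a0 := (ae_restrict_iff' measurableSet_Ioo).1 (hF1 0)
    have a1 := (ae_restrict_iff' measurableSet_Ioo).1 (hF1 1)
    have hsol : IsSolution p q z u := by
      refine (isSolution_iff hp hq).2 ⟨continuousOn_pi.2 (Fin.forall_fin_two.2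
        ⟨d0.continuousOn, d1.continuousOn⟩), Fin.forall_fin_two.2 ⟨?_, ?_⟩⟩
      · refine d0.congr ?_
        filter_upwards [a1] with x hx hm
        rw [hx hm]
        simp [Fin.sum_univ_two, sysCoeff, hz]; ring
      · refine d1.congr ?_
        filter_upwards [a0] with x hx hm
        rw [hx hm]
        simp [Fin.sum_univ_two, sysCoeff, hz]; ring
    have hev := hsol.eq_of_eq_zero hp hq ((hφ z).1.smul hp hq (-(u 0 1))) (by
      ext i
      fin_cases i <;> simp [(hφ z).2, h0])
    have hev' : ∀ x ∈ Icc 0 π, ∀ i, u x i = -(u 0 1) * φ x z i := fun x hx i => by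
      rw [hev x hx]; rfl
    have hc : -(u 0 1) * charFun φ h₁ h₂ z = 0 := by
      have e0 := hev' π pi_mem_Icc_pi 0
      have e1 := hev' π pi_mem_Icc_pi 1
      simp only [charFun]
      simp only at hF2
      linear_combination (-(z + h₁) : ℂ) * e0 - (h₂ : ℂ) * e1 + hbc + hF2 + u π 0 * hz
    have hFc : ∀ᵐ w ∂(bvpMeasure h₂), F w = ρ⁻¹ * -(u 0 1) * φ w.1 z w.2 := by
      refine (ae_bvpMeasure hh₂).2 ⟨fun i => ?_, ?_⟩
      · filter_upwards [hF1 i, ae_restrict_mem measurableSet_Ioo] with t ht hm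
        rw [ht, mul_assoc, ← hev' t (Ioo_subset_Icc_self hm) i]
      · rw [hF2, mul_assoc, ← hev' π pi_mem_Icc_pi 0]
    rcases mul_eq_zero.1 hc with h | h
    · left
      filter_upwards [hFc] with w hw
      rw [hw, h]; simp
    · exact Or.inr ⟨z, _, h, hFc⟩

/-- Parseval's identity for the eigenfunctions. -/
theorem IsEigenvalueEnumeration.hasSum_expansion (hp : MemLp p 2 (volume.restrict (Ioo 0 π)))
    (hq : MemLp q 2 (volume.restrict (Ioo 0 π))) (hφ : IsPhi p q φ) (hh₂ : 0 < h₂)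
    (hev : IsEigenvalueEnumeration p q h₁ h₂ ev) {F G : ℝ × Fin 2 → ℂ}
    (hF : MemLp F 2 (bvpMeasure h₂)) (hG : MemLp G 2 (bvpMeasure h₂)) :
    HasSum (fun n => 1 / (normalizingNumber φ h₂ (ev n) : ℂ) *
      (∫ w, φ w.1 (ev n) w.2 * F w ∂(bvpMeasure h₂)) *
        ∫ w, φ w.1 (ev n) w.2 * G w ∂(bvpMeasure h₂)) (∫ w, F w * G w ∂(bvpMeasure h₂)) := by
  set μ := bvpMeasure h₂ with hμ
  have hz : ∀ n, charFun φ h₁ h₂ (ev n) = 0 := fun n =>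
    (hev.charFun_eq_zero_iff hp hq hφ _).2 ⟨n, rfl⟩
  have hpos : ∀ n, 0 < normalizingNumber φ h₂ (ev n) := fun n => hφ.normalizingNumber_pos hh₂ _
  have hΦ : ∀ n, MemLp (fun w : ℝ × Fin 2 => φ w.1 (ev n) w.2) 2 μ := fun n =>
    hφ.memLp_bvpMeasure h₂ _
  set a : ℤ → ℂ := fun n => ((√(normalizingNumber φ h₂ (ev n)))⁻¹ : ℝ) with ha
  have ha0 : ∀ n, a n ≠ 0 := fun n => by
    have := Real.sqrt_pos.2 (hpos n)
    simp only [ha]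
    exact_mod_cast (inv_pos.2 this).ne'
  have hac : ∀ n, (starRingEnd ℂ) (a n) = a n := fun n => Complex.conj_ofReal _
  have haa : ∀ n, a n * a n = 1 / (normalizingNumber φ h₂ (ev n) : ℂ) := fun n => by
    simp only [ha]
    rw [← Complex.ofReal_mul, ← mul_inv, Real.mul_self_sqrt (hpos n).le]
    push_cast
    rw [one_div]
  set v : ℤ → Lp ℂ 2 μ := fun n => ((hΦ n).const_mul (a n)).toLp _ with hv
  have hΦr : ∀ n, ∀ᵐ w ∂μ, (starRingEnd ℂ) (φ w.1 (ev n) w.2) = φ w.1 (ev n) w.2 := fun n =>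
    (ae_bvpMeasure hh₂).2 ⟨fun i => by
      filter_upwards [ae_restrict_mem measurableSet_Ioo] with t ht
      exact hφ.conj_eq hp hq _ (Ioo_subset_Icc_self ht) i, hφ.conj_eq hp hq _ pi_mem_Icc_pi 0⟩
  have hvin : ∀ n {g : ℝ × Fin 2 → ℂ} (hg : MemLp g 2 μ), inner ℂ (v n) (hg.toLp g) =
      a n * ∫ w, φ w.1 (ev n) w.2 * g w ∂μ := by
    intro n g hg
    rw [hv, inner_toLp_eq, ← integral_const_mul]
    refine integral_congr_ae ?_
    filter_upwards [hΦr n] with w hw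
    rw [map_mul, hac, hw, mul_assoc]
  have horth : Orthonormal ℂ v := by
    rw [orthonormal_iff_ite]
    intro n m
    have h1 : inner ℂ (v n) (v m) = a n * (a m * ∫ w, φ w.1 (ev n) w.2 * φ w.1 (ev m) w.2 ∂μ) := by
      rw [hv, hvin n]
      refine congrArg (a n * ·) ?_
      rw [← integral_const_mul]
      exact integral_congr_ae (Eventually.of_forall fun w => mul_left_comm _ _ _)
    rw [h1]
    split_ifs with h
    · subst h
      rw [hμ, hφ.integral_bvpMeasure_self hp hq hh₂, ← mul_assoc, haa]
      have : (normalizingNumber φ h₂ (ev n) : ℂ) ≠ 0 := by exact_mod_cast (hpos n).ne'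
      field_simp
    · rw [hμ, hφ.integral_bvpMeasure_eq_zero hp hq hh₂ (hz n) (hz m), mul_zero, mul_zero]
      exact_mod_cast fun h' => h (hev.1.injective h')
  obtain ⟨l, hl⟩ : ∃ l : ℝ, charFun φ h₁ h₂ l ≠ 0 := by
    by_contra! hcon
    have := finite_charFun_zeros (h₁ := h₁) (h₂ := h₂) hp hq hφ 0 1
    have h2 : {l : ℝ | charFun φ h₁ h₂ l = 0} ∩ Icc 0 1 = Icc 0 1 :=
      inter_eq_right.2 fun l _ => hcon l
    rw [h2] at this
    exact (Icc_infinite zero_lt_one) this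
  obtain ⟨T, hTc, hTs, hT⟩ := exists_resolvent hp hq hφ hh₂ hl
  have hspan : ⨆ ρ, Module.End.eigenspace (T : Module.End ℂ (Lp ℂ 2 μ)) ρ ≤
      Submodule.span ℂ (range v) := by
    refine iSup_le fun ρ f hf => ?_
    have hf' : T f = ρ • f := Module.End.mem_eigenspace_iff.1 hf
    obtain ⟨u, hu, d0, d1, h0, hbc⟩ := hT f
    have hu' : ∀ᵐ w ∂μ, u w.1 w.2 = ρ * f w := by
      filter_upwards [hu, Lp.coeFn_smul ρ f] with w h3 h4
      rw [← h3, hf', h4]; rfl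
    rcases exists_eq_smul_of_resolvent_eigenvector hp hq hφ hh₂ hu' d0 d1 h0 hbc with h | h
    · have : f = 0 := Lp.eq_zero_iff_ae_eq_zero.2 h
      rw [this]
      exact Submodule.zero_mem _
    · obtain ⟨z, c, hzc, hc⟩ := h
      obtain ⟨n, rfl⟩ := (hev.2 z).1 ((isEigenvalue_iff hp hq hφ z).2 hzc)
      have : f = (c * (a n)⁻¹) • v n := by
        refine Lp.ext ?_
        filter_upwards [hc, Lp.coeFn_smul (c * (a n)⁻¹) (v n),
          ((hΦ n).const_mul (a n)).coeFn_toLp] with w h3 h4 h5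
        rw [h3, h4, Pi.smul_apply, hv, h5, smul_eq_mul]
        have := ha0 n
        field_simp
      rw [this]
      exact Submodule.smul_mem _ _ (Submodule.subset_span (mem_range_self n))
  -- The spectral theorem for compact symmetric operators says that the eigenspaces are total, and
  -- all of them lie in the span of the normalised `φ(·, λ_n)`.
  have hbot : (Submodule.span ℂ (range v))ᗮ = ⊥ := by
    rw [eq_bot_iff, ← ContinuousLinearMap.orthogonalComplement_iSup_eigenspaces_eq_bot hTc hTs]
    exact Submodule.orthogonal_le hspan
  -- The desired pairing is bilinear, so Parseval's identity is applied to the conjugate of `F`.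
  have hsum := (HilbertBasis.mkOfOrthogonalEqBot horth hbot).hasSum_inner_mul_inner
    (hF.star.toLp _) (hG.toLp _)
  rw [inner_toLp_eq] at hsum
  simp only [HilbertBasis.coe_mkOfOrthogonalEqBot, Pi.star_apply, RCLike.star_def,
    Complex.conj_conj] at hsum
  convert! hsum using 2 with n
  have e1 : inner ℂ (hF.star.toLp (star F)) (v n) =
      a n * ∫ w, φ w.1 (ev n) w.2 * F w ∂μ := by
    rw [← integral_const_mul, hv, inner_toLp_eq]
    refine integral_congr_ae (Eventually.of_forall fun w => ?_)
    simp only [Pi.star_apply, RCLike.star_def, Complex.conj_conj]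
    ring
  rw [e1, hvin n hG, ← haa]
  ring

end DiracBVP

/-! ### Transforms of test functions and Fourier inversion -/

namespace DiracBVP

variable {ev : ℤ → ℝ} {g : ℝ → ℂ}

/-- The exponential transform over `(0, π)`. -/
noncomputable def expTransform (g : ℝ → ℂ) (z : ℂ) : ℂ :=
  ∫ t in (0 : ℝ)..π, g t * Complex.exp (Complex.I * z * t)

theorem expTransform_deriv {g' : ℝ → ℂ} (hg : ∀ t, HasDerivAt g (g' t) t) (hg' : Continuous g')
    (h0 : g 0 = 0) (hπ : g π = 0) (z : ℂ) :
    Complex.I * z * expTransform g z = -expTransform g' z := by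
  have hE : ∀ t : ℝ, HasDerivAt (fun t : ℝ => Complex.exp (Complex.I * z * t))
      (Complex.exp (Complex.I * z * t) * (Complex.I * z)) t := fun t => by
    have h1 : HasDerivAt (fun t : ℝ => Complex.I * z * t) (Complex.I * z) t := by
      simpa using (Complex.ofRealCLM.hasDerivAt (x := t)).const_mul (Complex.I * z)
    exact h1.cexp
  have h := intervalIntegral.integral_mul_deriv_eq_deriv_mul (a := 0) (b := π)
    (fun t _ => hg t) (fun t _ => hE t) (hg'.intervalIntegrable _ _)
    (Continuous.intervalIntegrable (by fun_prop) _ _)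
  rw [h0, hπ, zero_mul, zero_mul, sub_zero, zero_sub] at h
  rw [expTransform, expTransform, ← h, ← intervalIntegral.integral_const_mul]
  congr 1
  ext t
  ring

theorem norm_expTransform_le (g : ℝ → ℂ) (l : ℝ) :
    ‖expTransform g l‖ ≤ ∫ t in (0 : ℝ)..π, ‖g t‖ := by
  refine (intervalIntegral.norm_integral_le_integral_norm Real.pi_pos.le).trans (le_of_eq ?_)
  congr 1
  ext t
  rw [norm_mul, norm_cexp_I_real, mul_one]

/-- Twice differentiable functions vanishing near the end points have quadratically decaying
transforms. -/
theorem exists_norm_expTransform_le (hg : ContDiff ℝ 2 g) (hs : tsupport g ⊆ Ioo 0 π) :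
    ∃ C : ℝ, 0 ≤ C ∧ ∀ l : ℝ, ‖expTransform g l‖ ≤ C * (1 / (1 + l ^ 2)) := by
  have hd1 : Differentiable ℝ g := hg.differentiable (by norm_num)
  have hg1 : ContDiff ℝ 1 (deriv g) := by
    have : ContDiff ℝ (1 + 1) g := by norm_num; exact hg
    exact (contDiff_succ_iff_deriv.1 this).2.2
  have hd2 : Differentiable ℝ (deriv g) := hg1.differentiable (by norm_num)
  have hc2 : Continuous (deriv (deriv g)) := hg1.continuous_deriv (by norm_num)
  have hz : ∀ x, x ∉ Ioo 0 π → g x = 0 ∧ deriv g x = 0 := by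
    intro x hx
    have h1 : x ∉ tsupport g := fun h => hx (hs h)
    have h2 : g =ᶠ[𝓝 x] 0 := notMem_tsupport_iff_eventuallyEq.1 h1
    exact ⟨h2.eq_of_nhds, by rw [h2.deriv_eq]; exact deriv_const x 0⟩
  have z0 := hz 0 (by simp)
  have zπ := hz π (by simp)
  refine ⟨(∫ t in (0 : ℝ)..π, ‖g t‖) + ∫ t in (0 : ℝ)..π, ‖deriv (deriv g) t‖, ?_, fun l => ?_⟩
  · exact add_nonneg (intervalIntegral.integral_nonneg Real.pi_pos.le fun _ _ => norm_nonneg _)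
      (intervalIntegral.integral_nonneg Real.pi_pos.le fun _ _ => norm_nonneg _)
  · have e1 := expTransform_deriv (fun t => (hd1 t).hasDerivAt) hg1.continuous z0.1 zπ.1 l
    have e2 := expTransform_deriv (fun t => (hd2 t).hasDerivAt) hc2 z0.2 zπ.2 l
    have e3 : ((l ^ 2 : ℝ) : ℂ) * expTransform g l = -expTransform (deriv (deriv g)) l := by
      push_cast
      linear_combination ((l : ℂ) ^ 2 * expTransform g l) * Complex.I_sq -
        Complex.I * l * e1 + e2
    have e4 : l ^ 2 * ‖expTransform g l‖ = ‖expTransform (deriv (deriv g)) l‖ := by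
      have h := congrArg norm e3
      rwa [norm_neg, norm_mul, Complex.norm_real, Real.norm_eq_abs,
        abs_of_nonneg (sq_nonneg l)] at h
    rw [mul_one_div, le_div_iff₀ (by positivity)]
    have b0 := norm_expTransform_le g l
    have b1 := norm_expTransform_le (deriv (deriv g)) l
    linarith

theorem summable_one_div_one_add_sq : Summable fun n : ℤ => 1 / (1 + (n : ℝ) ^ 2) := by
  have h := Real.summable_one_div_int_pow.2 one_lt_two
  refine Summable.of_norm_bounded_eventually h ?_
  filter_upwards [(Set.finite_singleton (0 : ℤ)).compl_mem_cofinite] with n hn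
  have hn0 : (n : ℝ) ≠ 0 := by simpa using hn
  have : 0 < (n : ℝ) ^ 2 := by positivity
  rw [Real.norm_eq_abs, abs_of_nonneg (by positivity)]
  exact one_div_le_one_div_of_le this (by linarith)

theorem summable_one_div_one_add_sq_of_shift {k k' : ℤ}
    (hev : Summable fun n => (ev n - shiftIndex k k' n) ^ 2) :
    Summable fun n => 1 / (1 + ev n ^ 2) := by
  set D := ∑' n, (ev n - shiftIndex k k' n) ^ 2
  have hD : 0 ≤ D := tsum_nonneg fun _ => sq_nonneg _
  refine Summable.of_nonneg_of_le (fun n => by positivity) (fun n => ?_)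
    ((summable_comp_shiftIndex summable_one_div_one_add_sq (fun _ => by positivity) k k').mul_left
      (2 * (1 + D)))
  have h1 : (ev n - shiftIndex k k' n) ^ 2 ≤ D := hev.le_tsum n (fun _ _ => sq_nonneg _)
  rw [mul_one_div, div_le_div_iff₀ (by positivity) (by positivity)]
  nlinarith [sq_nonneg (2 * ev n - shiftIndex k k' n), mul_nonneg hD (sq_nonneg (ev n))]

section Inversion

theorem circle_fourierCoeff (hsupp : ∀ t ≤ 0, g t = 0) (hc : Continuous g) (n : ℤ)
    [Fact (0 < 2 * π)] : fourierCoeff (AddCircle.liftIco (2 * π) (-π) g) n =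
      1 / (2 * π) * expTransform g (-n) := by
  rw [fourierCoeff_liftIco_eq, fourierCoeffOn_eq_integral]
  have e1 : -π + 2 * π = π := by ring
  have e2 : π - -π = 2 * π := by ring
  have hi : ∀ a b : ℝ, IntervalIntegrable
      (fun t : ℝ => g t * Complex.exp (Complex.I * (-n : ℂ) * t)) volume a b := fun a b =>
    (hc.mul (by fun_prop)).intervalIntegrable _ _
  have e3 : ∀ x : ℝ, fourier (-n) (x : AddCircle (-π + 2 * π - -π)) • g x =
      g x * Complex.exp (Complex.I * (-n : ℂ) * x) := by
    intro x
    rw [fourier_coe_apply, smul_eq_mul, mul_comm]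
    congr 2
    push_cast
    have : (π : ℂ) ≠ 0 := by exact_mod_cast Real.pi_ne_zero
    have h2 : (-π + 2 * π - -π : ℂ) = 2 * π := by ring
    rw [h2]
    field_simp
  simp only [e3]
  rw [e1, e2, ← intervalIntegral.integral_add_adjacent_intervals (hi (-π) 0) (hi 0 π)]
  have e4 : ∫ t in (-π)..0, g t * Complex.exp (Complex.I * (-n : ℂ) * t) = 0 := by
    rw [intervalIntegral.integral_congr (g := fun _ => (0 : ℂ)), intervalIntegral.integral_zero]
    intro t ht
    rw [uIcc_of_le (by linarith [Real.pi_pos])] at ht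
    simp only [hsupp t ht.2, zero_mul]
  rw [e4, zero_add, expTransform, Complex.real_smul]
  push_cast
  rfl

/-- Fourier inversion for smooth functions supported in `(0, π)`. -/
theorem hasSum_expTransform (hg : ContDiff ℝ 2 g) (hs : tsupport g ⊆ Ioo 0 π) {ξ : ℝ}
    (hξ : ξ ∈ Icc (-π) π) :
    HasSum (fun n : ℤ => expTransform g (-n) * Complex.exp (Complex.I * n * ξ)) (2 * π * g ξ) := by
  have hT : Fact (0 < 2 * π) := ⟨by positivity⟩
  have hc : Continuous g := hg.continuous
  have hz : ∀ x, x ∉ Ioo 0 π → g x = 0 := fun x hx =>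
    image_eq_zero_of_notMem_tsupport fun h => hx (hs h)
  have hsupp : ∀ t ≤ 0, g t = 0 := fun t ht => hz t (by simp [ht])
  have hend : g (-π) = g (-π + 2 * π) := by
    rw [hz (-π) (by simp [Real.pi_pos.le]), hz _ (by simp; intro; linarith)]
  let f : C(AddCircle (2 * π), ℂ) := ⟨AddCircle.liftIco (2 * π) (-π) g,
    AddCircle.liftIco_continuous hend hc.continuousOn⟩
  obtain ⟨C, hC, hb⟩ := exists_norm_expTransform_le hg hs
  have hfc : ∀ n, fourierCoeff f n = 1 / (2 * π) * expTransform g (-n) :=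
    fun n => circle_fourierCoeff hsupp hc n
  have hsum : Summable (fourierCoeff f) := by
    refine Summable.of_norm_bounded (summable_one_div_one_add_sq.mul_left (1 / (2 * π) * C))
      fun n => ?_
    rw [hfc, norm_mul]
    have h1 : ‖(1 / (2 * π) : ℂ)‖ = 1 / (2 * π) := by
      rw [show (1 / (2 * π) : ℂ) = ((1 / (2 * π) : ℝ) : ℂ) by push_cast; rfl, Complex.norm_real,
        Real.norm_eq_abs, abs_of_pos (by positivity)]
    have h2 := hb (-n)
    push_cast at h2
    rw [neg_sq] at h2
    rw [h1, mul_assoc]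
    exact mul_le_mul_of_nonneg_left h2 (by positivity)
  have key : ∀ η ∈ Ico (-π) π, HasSum (fun n : ℤ => expTransform g (-n) *
      Complex.exp (Complex.I * n * η)) (2 * π * g η) := by
    intro η hη
    have h := (has_pointwise_sum_fourier_series_of_summable hsum (η : AddCircle (2 * π))).mul_left
      (2 * π : ℂ)
    have hπ : (π : ℂ) ≠ 0 := by exact_mod_cast Real.pi_ne_zero
    have e : f (η : AddCircle (2 * π)) = g η := AddCircle.liftIco_coe_apply
      ⟨hη.1, by have := hη.2; linarith⟩
    rw [e] at h
    refine h.congr_fun fun n => ?_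
    rw [hfc, fourier_coe_apply, smul_eq_mul]
    have e5 : Complex.I * n * η = 2 * π * Complex.I * n * η / ((2 * π : ℝ) : ℂ) := by
      push_cast
      field_simp
    rw [e5]
    field_simp
  -- The end point `π` is the point `-π` of the circle, and `g` vanishes at both.
  rcases eq_or_ne ξ π with rfl | hne
  · have h := key (-π) ⟨le_rfl, by linarith [Real.pi_pos]⟩
    rw [hz (-π) (by simp [Real.pi_pos.le])] at h
    rw [hz π (by simp)]
    refine h.congr_fun fun n => ?_
    congr 1
    rw [Complex.exp_eq_exp_iff_exists_int]
    exact ⟨n, by push_cast; ring⟩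
  · exact key ξ ⟨hξ.1, lt_of_le_of_ne hξ.2 hne⟩

/-- The `phi0`-transform of a function in the `j`-th component. -/
noncomputable def phi0Transform (g : ℝ → ℂ) (j : Fin 2) (z : ℂ) : ℂ :=
  ∫ t in (0 : ℝ)..π, phi0 t z j * g t

theorem phi0Transform_eq (hg : Continuous g) (j : Fin 2) (z : ℂ) : phi0Transform g j z =
    phi0Coef j * (expTransform g z + phi0Sign j * expTransform g (-z)) := by
  have h1 : IntervalIntegrable (fun t : ℝ => g t * Complex.exp (Complex.I * z * t)) volume 0 π :=
    (hg.mul (by fun_prop)).intervalIntegrable _ _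
  have h2 : IntervalIntegrable (fun t : ℝ => g t * Complex.exp (Complex.I * -z * t)) volume 0 π :=
    (hg.mul (by fun_prop)).intervalIntegrable _ _
  rw [expTransform, expTransform, ← intervalIntegral.integral_const_mul,
    ← intervalIntegral.integral_add h1 (h2.const_mul _), ← intervalIntegral.integral_const_mul]
  refine intervalIntegral.integral_congr fun t _ => ?_
  have e : Complex.I * z * (-t : ℝ) = Complex.I * -z * t := by push_cast; ring
  simp only [phi0_eq_coef, e]
  ring

theorem exists_norm_phi0Transform_le (hg : ContDiff ℝ 2 g) (hs : tsupport g ⊆ Ioo 0 π)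
    (j : Fin 2) : ∃ C : ℝ, 0 ≤ C ∧ ∀ l : ℝ, ‖phi0Transform g j l‖ ≤ C * (1 / (1 + l ^ 2)) := by
  obtain ⟨C, hC, hb⟩ := exists_norm_expTransform_le hg hs
  refine ⟨C, hC, fun l => ?_⟩
  rw [phi0Transform_eq hg.continuous, norm_mul, norm_phi0Coef]
  have h1 := hb l
  have h2 := hb (-l)
  rw [neg_sq] at h2
  push_cast at h2
  have h3 : ‖expTransform g l + phi0Sign j * expTransform g (-l)‖ ≤
      ‖expTransform g l‖ + ‖expTransform g (-l)‖ := by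
    refine (norm_add_le _ _).trans (le_of_eq ?_)
    rw [norm_mul, norm_phi0Sign, one_mul]
  linarith

/-- Expanding both factors into exponentials gives four inversion sums. Two of them produce `g (-ξ)
= 0`, since the support lies in `(0, π)`; the other two add up when `i = j` and cancel by opposite
parity when `i ≠ j`. -/
theorem hasSum_phi0Transform (hg : ContDiff ℝ 2 g) (hs : tsupport g ⊆ Ioo 0 π) {ξ : ℝ}
    (hξ : ξ ∈ Icc 0 π) (i j : Fin 2) :
    HasSum (fun n : ℤ => 1 / (π : ℂ) * (phi0 ξ n i * phi0Transform g j n))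
      (if i = j then g ξ else 0) := by
  have hξ1 : ξ ∈ Icc (-π) π := ⟨by linarith [hξ.1, Real.pi_pos], hξ.2⟩
  have hξ2 : -ξ ∈ Icc (-π) π := ⟨by linarith [hξ.2], by linarith [hξ.1, Real.pi_pos]⟩
  have hz : g (-ξ) = 0 := image_eq_zero_of_notMem_tsupport fun h => by
    have := (hs h).1
    linarith [hξ.1]
  have s1 := hasSum_expTransform hg hs hξ1
  have s2 := hasSum_expTransform hg hs hξ2
  have s3 := (Equiv.neg ℤ).hasSum_iff.2 s1
  have s4 := (Equiv.neg ℤ).hasSum_iff.2 s2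
  rw [hz, mul_zero] at s2 s4
  have hsum := (((s4.add (s1.mul_left (phi0Sign j))).add (s3.mul_left (phi0Sign i))).add
    (s2.mul_left (phi0Sign i * phi0Sign j))).mul_left (1 / (π : ℂ) * (phi0Coef i * phi0Coef j))
  have hπ : (π : ℂ) ≠ 0 := by exact_mod_cast Real.pi_ne_zero
  have hval : 1 / (π : ℂ) * (phi0Coef i * phi0Coef j) *
      (0 + phi0Sign j * (2 * π * g ξ) + phi0Sign i * (2 * π * g ξ) +
        phi0Sign i * phi0Sign j * 0) = if i = j then g ξ else 0 := by
    have hI := Complex.I_mul_I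
    fin_cases i <;> fin_cases j <;> simp [phi0Coef, phi0Sign] <;> field_simp <;> ring_nf
    rw [Complex.I_sq]; ring
  rw [hval] at hsum
  refine hsum.congr_fun fun n => ?_
  rw [phi0Transform_eq hg.continuous, phi0_eq_coef]
  have e1 : Complex.I * (n : ℂ) * (-ξ : ℝ) = Complex.I * ((-n : ℤ) : ℂ) * ξ := by push_cast; ring
  have e2 : Complex.I * ((-n : ℤ) : ℂ) * (-ξ : ℝ) = Complex.I * (n : ℂ) * ξ := by push_cast; ring
  simp only [Function.comp_apply, Equiv.neg_apply, e2, e1]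
  push_cast
  rw [neg_neg]
  ring

end Inversion

end DiracBVP

/-! ### Causality of the eigenfunction expansion -/

namespace DiracBVP

variable {p q : ℝ → ℝ} {φ : ℝ → ℂ → Fin 2 → ℂ} {h₁ h₂ : ℝ} {ev : ℤ → ℝ} {g : ℝ → ℂ}

theorem exists_lt_of_tsupport_subset {x : ℝ} (hx : 0 < x) (hs : tsupport g ⊆ Ioo 0 x) :
    ∃ b ∈ Ioo 0 x, ∀ t, b < t → g t = 0 := by
  have hc : IsCompact (tsupport g) :=
    isCompact_Icc.of_isClosed_subset (isClosed_tsupport g) (hs.trans Ioo_subset_Icc_self)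
  rcases (tsupport g).eq_empty_or_nonempty with he | hne
  · exact ⟨x / 2, ⟨by linarith, by linarith⟩, fun t _ =>
      image_eq_zero_of_notMem_tsupport (by simp [he])⟩
  · obtain ⟨b, hb, hmax⟩ := hc.exists_isGreatest hne
    exact ⟨b, hs hb, fun t ht => image_eq_zero_of_notMem_tsupport fun h =>
      not_lt_of_ge (hmax h) ht⟩

/-- A transform in terms of `phi0` over `(0, b)` is a transform in terms of `φ` over `(0, b)`. -/
theorem IsPhi.exists_phi0Transform_eq (hp : MemLp p 2 (volume.restrict (Ioo 0 π)))
    (hq : MemLp q 2 (volume.restrict (Ioo 0 π))) (hφ : IsPhi p q φ) (hh₂ : 0 < h₂)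
    (hg : Continuous g) {b : ℝ} (hb : b ∈ Ioo 0 π) (h0 : ∀ t, b < t → g t = 0) (j : Fin 2) :
    ∃ κ : ℝ × Fin 2 → ℂ, MemLp κ 2 (bvpMeasure h₂) ∧ (∀ w, b ≤ w.1 → κ w = 0) ∧
      ∀ z, ∫ w, φ w.1 z w.2 * κ w ∂(bvpMeasure h₂) = phi0Transform g j z := by
  set G : ℝ × Fin 2 → ℂ := fun w => if w.2 = j then g w.1 else 0 with hG
  have hbI : b ∈ Icc 0 π := Ioo_subset_Icc_self hb
  have hGm : MemLp G 2 (twoMeasure b) := memLp_twoMeasure.2 fun i => by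
    by_cases h : i = j
    · simpa [hG, h] using hg.continuousOn.memLp_restrict_Ioo 2
    · simp [hG, h]
  obtain ⟨κ, hκ, e⟩ := hφ.exists_inverse_row hp hq hbI hGm
  have hsub : Ioo 0 b ⊆ Ioo 0 π := Ioo_subset_Ioo_right hb.2.le
  -- Extension by zero beyond `b`; in particular the value at the atom `(π, 0)` is zero.
  set κ' : ℝ × Fin 2 → ℂ := fun w => (Ioo 0 b).indicator (fun t => κ (t, w.2)) w.1 with hκ'
  have hm : MemLp κ' 2 (bvpMeasure h₂) := DiracBVP.memLp_bvpMeasure fun i => by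
    have h1 := memLp_twoMeasure.1 hκ i
    have h2 : MemLp ((Ioo 0 b).indicator fun t => κ (t, i)) 2 (volume.restrict (Ioo 0 π)) := by
      rw [memLp_indicator_iff_restrict measurableSet_Ioo,
        Measure.restrict_restrict measurableSet_Ioo, inter_eq_left.2 hsub]
      exact h1
    exact h2
  have hz : ∀ w, b ≤ w.1 → κ' w = 0 := fun w hw =>
    indicator_of_notMem (fun h => not_lt_of_ge hw h.2) _
  refine ⟨κ', hm, hz, fun z => ?_⟩
  have hi : Integrable (fun w : ℝ × Fin 2 => φ w.1 z w.2 * κ' w) (bvpMeasure h₂) :=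
    (hφ.memLp_bvpMeasure h₂ z).integrable_mul hm
  have hφb : ∀ z, MemLp (fun w : ℝ × Fin 2 => φ w.1 z w.2) 2 (twoMeasure b) := fun z =>
    memLp_twoMeasure_of_continuousOn fun i =>
      (hφ.continuousOn_apply z i).mono (Icc_subset_Icc_right hbI.2)
  have hκi : Integrable (fun w : ℝ × Fin 2 => κ w * φ w.1 z w.2) (twoMeasure b) :=
    hκ.integrable_mul (hφb z)
  have hGi : Integrable (fun w : ℝ × Fin 2 => G w * phi0 w.1 z w.2) (twoMeasure b) :=
    hGm.integrable_mul (memLp_phi0 z b)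
  have e1 := e z
  rw [integral_twoMeasure_mul hbI.1 hκ (hφb z), integral_twoMeasure_mul hbI.1 hGm (memLp_phi0 z b)]
    at e1
  rw [integral_bvpMeasure hh₂ hi, hz (π, 0) hb.2.le, mul_zero, mul_zero, add_zero]
  have e2 : ∀ t, φ t z 0 * κ' (t, 0) + φ t z 1 * κ' (t, 1) =
      (Ioo 0 b).indicator (fun t => κ (t, 0) * φ t z 0 + κ (t, 1) * φ t z 1) t := fun t => by
    by_cases h : t ∈ Ioo 0 b
    · simp only [hκ', indicator_of_mem h]; ring
    · simp only [hκ', indicator_of_notMem h]; ring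
  simp only [e2]
  rw [setIntegral_indicator measurableSet_Ioo, inter_eq_right.2 hsub,
    ← intervalIntegral_pi_eq _ hbI.1]
  have hpi : ∀ a c : ℝ, IntervalIntegrable (fun t => phi0 t z j * g t) volume a c := fun a c =>
    ((continuous_phi0 z j).mul hg).intervalIntegrable _ _
  have e3 : ∫ t in b..π, phi0 t z j * g t = 0 := by
    rw [intervalIntegral.integral_of_le hb.2.le]
    refine setIntegral_eq_zero_of_forall_eq_zero fun t ht => ?_
    rw [h0 t ht.1, mul_zero]
  rw [phi0Transform, ← intervalIntegral.integral_add_adjacent_intervals (hpi 0 b) (hpi b π), e3,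
    add_zero]
  refine Eq.trans e1 (intervalIntegral.integral_congr fun t _ => ?_)
  simp only [hG]
  fin_cases j <;> simp [mul_comm]

/-- The eigenfunction expansion of a function supported in `(0, x)` vanishes at `x`. -/
theorem IsEigenvalueEnumeration.hasSum_phi_eq_zero (hp : MemLp p 2 (volume.restrict (Ioo 0 π)))
    (hq : MemLp q 2 (volume.restrict (Ioo 0 π))) (hφ : IsPhi p q φ) (hh₂ : 0 < h₂)
    (hev : IsEigenvalueEnumeration p q h₁ h₂ ev) {C : ℝ} (hC : 0 ≤ C)
    (hc : ∀ n, |1 / normalizingNumber φ h₂ (ev n)| ≤ C)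
    (hsum : Summable fun n => 1 / (1 + ev n ^ 2)) {x : ℝ} (hx : x ∈ Ioc 0 π)
    (hg : ContDiff ℝ 2 g) (hs : tsupport g ⊆ Ioo 0 x) (i j : Fin 2) :
    HasSum (fun n => 1 / (normalizingNumber φ h₂ (ev n) : ℂ) *
      (φ x (ev n) i * phi0Transform g j (ev n))) 0 := by
  -- The gap between the support and `x` places `x` in the closure of the nonempty interval `(b,
  -- π)`, even for `x = π`. Vanishing of the sum almost everywhere there reaches `x` by continuity.
  obtain ⟨b, hb, hb0⟩ := exists_lt_of_tsupport_subset hx.1 hs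
  have hbπ : b < π := hb.2.trans_le hx.2
  obtain ⟨κ, hκ, hκ0, e⟩ := hφ.exists_phi0Transform_eq (h₂ := h₂) hp hq hh₂ hg.continuous
    ⟨hb.1, hbπ⟩ hb0 j
  obtain ⟨C', hC', hdec⟩ := exists_norm_phi0Transform_le hg
    (hs.trans (Ioo_subset_Ioo_right hx.2)) j
  obtain ⟨M, hM, hbd⟩ := hφ.exists_bound hp hq
  set c : ℤ → ℂ := fun n => 1 / (normalizingNumber φ h₂ (ev n) : ℂ) with hcdef
  have hcn : ∀ n, ‖c n‖ ≤ C := fun n => by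
    have : c n = ((1 / normalizingNumber φ h₂ (ev n) : ℝ) : ℂ) := by
      simp only [hcdef]; push_cast; rfl
    rw [this, Complex.norm_real]
    exact hc n
  set u : ℤ → ℝ → ℂ := fun n s => c n * (φ s (ev n) i * phi0Transform g j (ev n)) with hu
  have hub : ∀ n, ∀ s ∈ Icc 0 π, ‖u n s‖ ≤ C * (M * C') * (1 / (1 + ev n ^ 2)) := by
    intro n s hs
    rw [hu, norm_mul, norm_mul]
    calc ‖c n‖ * (‖φ s (ev n) i‖ * ‖phi0Transform g j (ev n)‖)
        ≤ C * (M * (C' * (1 / (1 + ev n ^ 2)))) :=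
          mul_le_mul (hcn n) (mul_le_mul (hbd s hs _ _) (hdec _) (norm_nonneg _) hM)
            (by positivity) hC
      _ = _ := by ring
  have hS := hsum.mul_left (C * (M * C'))
  have huc : ∀ n, ContinuousOn (u n) (Icc 0 π) := fun n =>
    continuousOn_const.mul ((hφ.continuousOn_apply _ i).mul continuousOn_const)
  set S : ℝ → ℂ := fun s => ∑' n, u n s with hSdef
  have hSc : ContinuousOn S (Icc 0 π) := continuousOn_tsum huc hS hub
  have hSsum : ∀ s ∈ Icc 0 π, HasSum (fun n => u n s) (S s) := fun s hs =>
    (Summable.of_norm_bounded hS fun n => hub n s hs).hasSum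
  have hsub : Ioo b π ⊆ Ioo 0 π := Ioo_subset_Ioo_left hb.1.le
  have hsub' : Icc b π ⊆ Icc 0 π := Icc_subset_Icc_left hb.1.le
  -- The sum `S` is tested against its own conjugate on `(b, π)`. Parseval's identity pairs `H` with
  -- `κ`, whose support is disjoint, and termwise integration identifies the result with `∫ |S|²`
  -- over `(b, π)`. The open interval keeps `H` zero at the atom.
  set H : ℝ × Fin 2 → ℂ := fun w =>
    if w.2 = i then (Ioo b π).indicator (fun t => star (S t)) w.1 else 0 with hH
  have hSm : MemLp S 2 (volume.restrict (Ioo b π)) := (hSc.mono hsub').memLp_restrict_Ioo 2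
  have hHm : MemLp H 2 (bvpMeasure h₂) := memLp_bvpMeasure fun a => by
    by_cases h : a = i
    · have h2 : MemLp ((Ioo b π).indicator fun t => star (S t)) 2 (volume.restrict (Ioo 0 π)) := by
        rw [memLp_indicator_iff_restrict measurableSet_Ioo,
          Measure.restrict_restrict measurableSet_Ioo, inter_eq_left.2 hsub]
        exact hSm.star
      simpa only [hH, h, if_true] using h2
    · simp [hH, h]
  have hHi : ∀ n, ∫ w, φ w.1 (ev n) w.2 * H w ∂(bvpMeasure h₂) =
      ∫ t in Ioo b π, φ t (ev n) i * star (S t) := by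
    intro n
    have hi : Integrable (fun w : ℝ × Fin 2 => φ w.1 (ev n) w.2 * H w) (bvpMeasure h₂) :=
      (hφ.memLp_bvpMeasure h₂ _).integrable_mul hHm
    have hH0 : H (π, 0) = 0 := by simp [hH]
    rw [integral_bvpMeasure hh₂ hi, hH0, mul_zero, mul_zero, add_zero]
    have e2 : ∀ t, φ t (ev n) 0 * H (t, 0) + φ t (ev n) 1 * H (t, 1) =
        (Ioo b π).indicator (fun t => φ t (ev n) i * star (S t)) t := fun t => by
      by_cases h : t ∈ Ioo b π
      · simp only [hH, indicator_of_mem h]; fin_cases i <;> simp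
      · simp only [hH, indicator_of_notMem h]; simp
    simp only [e2]
    rw [setIntegral_indicator measurableSet_Ioo, inter_eq_right.2 hsub]
  have hexp := hev.hasSum_expansion hp hq hφ hh₂ hκ hHm
  have hzero : ∫ w, κ w * H w ∂(bvpMeasure h₂) = 0 := by
    refine integral_eq_zero_of_ae (Eventually.of_forall fun w => ?_)
    rcases le_or_gt b w.1 with h | h
    · simp [hκ0 w h]
    · have : w.1 ∉ Ioo b π := fun h' => lt_asymm h h'.1
      simp [hH, this]
  rw [hzero] at hexp
  obtain ⟨MS, hMS⟩ := isCompact_Icc.exists_bound_of_continuousOn hSc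
  have hdom : HasSum (fun n => ∫ t in Ioo b π, u n t * star (S t))
      (∫ t in Ioo b π, S t * star (S t)) := by
    refine hasSum_integral_of_dominated_convergence
      (fun n _ => C * (M * C') * (1 / (1 + ev n ^ 2)) * MS) (fun n => ?_) (fun n => ?_)
      (Eventually.of_forall fun _ => hS.mul_right MS) (integrable_const _) ?_
    · exact (((huc n).mono (hsub.trans Ioo_subset_Icc_self)).mul
        ((hSc.mono (hsub.trans Ioo_subset_Icc_self)).star)).aestronglyMeasurable measurableSet_Ioo
    · refine (ae_restrict_iff' measurableSet_Ioo).2 (Eventually.of_forall fun t ht => ?_)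
      have ht' := Ioo_subset_Icc_self (hsub ht)
      rw [norm_mul, norm_star]
      exact mul_le_mul (hub n t ht') (hMS t ht') (norm_nonneg _) (by positivity)
    · refine (ae_restrict_iff' measurableSet_Ioo).2 (Eventually.of_forall fun t ht => ?_)
      exact (hSsum t (Ioo_subset_Icc_self (hsub ht))).mul_right _
  have hterm : ∀ n, ∫ t in Ioo b π, u n t * star (S t) =
      1 / (normalizingNumber φ h₂ (ev n) : ℂ) *
      (∫ w, φ w.1 (ev n) w.2 * κ w ∂(bvpMeasure h₂)) *
        ∫ w, φ w.1 (ev n) w.2 * H w ∂(bvpMeasure h₂) := by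
    intro n
    rw [hHi, e, ← integral_const_mul]
    refine integral_congr_ae (Eventually.of_forall fun t => ?_)
    simp only [hu, hcdef]
    ring
  simp only [hterm] at hdom
  have hnorm : ∫ t in Ioo b π, ‖S t‖ ^ 2 = 0 := by
    have h1 := hdom.unique hexp
    have h2 : ∫ t in Ioo b π, S t * star (S t) = ((∫ t in Ioo b π, ‖S t‖ ^ 2 : ℝ) : ℂ) := by
      rw [← integral_complex_ofReal]
      refine integral_congr_ae (Eventually.of_forall fun t => ?_)
      have := Complex.mul_conj (S t)
      rw [Complex.normSq_eq_norm_sq] at this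
      exact this
    rw [h2] at h1
    exact_mod_cast h1
  have hae : ∀ᵐ t ∂(volume.restrict (Icc b π)), S t = 0 := by
    rw [← restrict_Ioo_eq_restrict_Icc]
    have h3 := (integral_eq_zero_iff_of_nonneg (fun _ => by positivity)
      ((memLp_two_iff_integrable_sq_norm hSm.1).1 hSm)).1 hnorm
    filter_upwards [h3] with t ht
    simpa using ht
  have hx0 : S x = 0 := Measure.eqOn_Icc_of_ae_eq volume hbπ.ne hae (hSc.mono hsub')
    continuousOn_const ⟨hb.2.le, hx.2⟩
  have := hSsum x ⟨hx.1.le, hx.2⟩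
  rwa [hx0] at this

end DiracBVP

/-! ### The main equation -/

namespace DiracBVP

variable {p q : ℝ → ℝ} {φ : ℝ → ℂ → Fin 2 → ℂ} {h₁ h₂ C x : ℝ} {ev : ℤ → ℝ} {g : ℝ → ℂ}
  {F K : ℝ → ℝ → Matrix (Fin 2) (Fin 2) ℂ}

theorem integral_partialF_mul (hg : Continuous g) (N : ℕ) (ξ : ℝ) (a j : Fin 2) :
    ∫ t in (0 : ℝ)..π, partialF φ h₂ ev N ξ t a j * g t =
      (∑ n ∈ Finset.Icc (-(N : ℤ)) N, 1 / (normalizingNumber φ h₂ (ev n) : ℂ) *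
        (phi0 ξ (ev n) a * phi0Transform g j (ev n))) -
      ∑ n ∈ Finset.Icc (-(N : ℤ)) N, 1 / (π : ℂ) * (phi0 ξ n a * phi0Transform g j n) := by
  have hi : ∀ (k z : ℂ), IntervalIntegrable (fun t => k * (phi0 t z j * g t)) volume 0 π :=
    fun k z => (continuous_const.mul ((continuous_phi0 z j).mul hg)).intervalIntegrable _ _
  have e : ∀ t, partialF φ h₂ ev N ξ t a j * g t = ∑ n ∈ Finset.Icc (-(N : ℤ)) N,
      (1 / (normalizingNumber φ h₂ (ev n) : ℂ) * phi0 ξ (ev n) a * (phi0 t (ev n) j * g t) -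
        1 / (π : ℂ) * phi0 ξ n a * (phi0 t n j * g t)) := fun t => by
    rw [partialF, Matrix.sum_apply, Finset.sum_mul]
    refine Finset.sum_congr rfl fun n _ => ?_
    simp only [Matrix.sub_apply, Matrix.smul_apply, Matrix.vecMulVec_apply, smul_eq_mul]
    ring
  simp only [e]
  rw [intervalIntegral.integral_finsetSum fun n _ => (hi _ _).sub (hi _ _),
    ← Finset.sum_sub_distrib]
  refine Finset.sum_congr rfl fun n _ => ?_
  rw [intervalIntegral.integral_sub (hi _ _) (hi _ _), intervalIntegral.integral_const_mul,
    intervalIntegral.integral_const_mul, phi0Transform, phi0Transform, mul_assoc, mul_assoc]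

theorem norm_phi0_term_le {C' c : ℝ} (hC : 0 ≤ C) (hc : |1 / c| ≤ C) {T : ℂ} {l : ℝ}
    (hT : ‖T‖ ≤ C' * (1 / (1 + l ^ 2))) (ξ : ℝ) (a : Fin 2) :
    ‖1 / (c : ℂ) * (phi0 ξ l a * T)‖ ≤ C * (C' * (1 / (1 + l ^ 2))) := by
  have h1 : ‖1 / (c : ℂ)‖ ≤ C := by
    rw [show 1 / (c : ℂ) = ((1 / c : ℝ) : ℂ) by push_cast; rfl, Complex.norm_real]
    exact hc
  have h2 : ‖phi0 ξ l a * T‖ ≤ C' * (1 / (1 + l ^ 2)) := by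
    rw [norm_mul]
    exact (mul_le_of_le_one_left (norm_nonneg _) (norm_phi0_le_one ξ l a)).trans hT
  rw [norm_mul]
  exact mul_le_mul h1 h2 (norm_nonneg _) hC

/-- The expansion of a test function in terms of `phi0` at the eigenvalues. -/
theorem IsSpectralKernel.hasSum_phi0 (hF : IsSpectralKernel φ h₂ ev F) (hC : 0 ≤ C)
    (hc : ∀ n, |1 / normalizingNumber φ h₂ (ev n)| ≤ C)
    (hsum : Summable fun n => 1 / (1 + ev n ^ 2)) (hg : ContDiff ℝ 2 g)
    (hs : tsupport g ⊆ Ioo 0 π) {ξ : ℝ} (hξ : ξ ∈ Icc 0 π) (a j : Fin 2) :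
    HasSum (fun n => 1 / (normalizingNumber φ h₂ (ev n) : ℂ) *
        (phi0 ξ (ev n) a * phi0Transform g j (ev n)))
      ((∫ t in (0 : ℝ)..π, F ξ t a j * g t) + if a = j then g ξ else 0) := by
  obtain ⟨C', hC', hb⟩ := exists_norm_phi0Transform_le hg hs j
  have hS : Summable fun n => 1 / (normalizingNumber φ h₂ (ev n) : ℂ) *
      (phi0 ξ (ev n) a * phi0Transform g j (ev n)) :=
    Summable.of_norm_bounded ((hsum.mul_left C').mul_left C)
      fun n => norm_phi0_term_le hC (hc n) (hb _) ξ a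
  -- For test functions the decay of the transform lets the two halves of the series converge
  -- separately. The free half is Fourier inversion, and the difference of the halves is the weak
  -- limit defining `F`.
  have h1 := (hS.hasSum.comp tendsto_finset_Icc_neg_natCast).sub
    ((hasSum_phi0Transform hg hs hξ a j).comp tendsto_finset_Icc_neg_natCast)
  have h2 := (hF.2 ξ hξ a j).2 g (hg.continuous.continuousOn.memLp_restrict_Ioo 2)
  simp only [integral_partialF_mul hg.continuous] at h2
  have h3 := tendsto_nhds_unique h2 h1
  rw [h3, sub_add_cancel]
  exact hS.hasSum

/-- The main equation, tested against a smooth function. -/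
theorem IsSpectralKernel.integral_twoMeasure_eq (hp : MemLp p 2 (volume.restrict (Ioo 0 π)))
    (hq : MemLp q 2 (volume.restrict (Ioo 0 π))) (hφ : IsPhi p q φ) (hh₂ : 0 < h₂)
    (hev : IsEigenvalueEnumeration p q h₁ h₂ ev)
    (hF : IsSpectralKernel φ h₂ ev F) (hK : IsTransformationKernel φ K) (hC : 0 ≤ C)
    (hc : ∀ n, |1 / normalizingNumber φ h₂ (ev n)| ≤ C)
    (hsum : Summable fun n => 1 / (1 + ev n ^ 2)) (hx : x ∈ Ioc 0 π) (hg : ContDiff ℝ 2 g)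
    (hs : tsupport g ⊆ Ioo 0 x) (i j : Fin 2) :
    ∫ w, K x w.1 i w.2 * ((∫ t in (0 : ℝ)..π, F w.1 t w.2 j * g t) +
      if w.2 = j then g w.1 else 0) ∂(twoMeasure x) = -∫ t in (0 : ℝ)..π, F x t i j * g t := by
  have hxI : x ∈ Icc 0 π := Ioc_subset_Icc_self hx
  have hsπ : tsupport g ⊆ Ioo 0 π := hs.trans (Ioo_subset_Ioo_right hx.2)
  obtain ⟨C', hC', hb⟩ := exists_norm_phi0Transform_le hg hsπ j
  have hKm : MemLp (fun w : ℝ × Fin 2 => K x w.1 i w.2) 2 (twoMeasure x) :=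
    memLp_twoMeasure.2 fun a => (hK x hxI).1 i a
  have hS := (hsum.mul_left C').mul_left C
  have hmem : ∀ᵐ w ∂(twoMeasure x), w.1 ∈ Icc 0 π := by
    have h : ∀ᵐ t ∂(volume.restrict (Ioo 0 x)), t ∈ Icc 0 π :=
      (ae_restrict_mem measurableSet_Ioo).mono fun t ht => ⟨ht.1.le, ht.2.le.trans hx.2⟩
    rw [twoMeasure, ae_pairMeasure]
    exact ⟨h, h⟩
  -- The `φ₀` expansion is integrated termwise against a row of `K`, which replaces each `φ₀(x,
  -- λ_n)` by `φ(x, λ_n) - φ₀(x, λ_n)`.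
  have h1 := hasSum_integral_of_dominated_convergence (μ := twoMeasure x)
    (F := fun n w => K x w.1 i w.2 * (1 / (normalizingNumber φ h₂ (ev n) : ℂ) *
      (phi0 w.1 (ev n) w.2 * phi0Transform g j (ev n))))
    (f := fun w => K x w.1 i w.2 * ((∫ t in (0 : ℝ)..π, F w.1 t w.2 j * g t) +
      if w.2 = j then g w.1 else 0))
    (fun n w => ‖K x w.1 i w.2‖ * (C * (C' * (1 / (1 + ev n ^ 2)))))
    (fun n => hKm.1.mul (((memLp_phi0 (ev n) x).1.mul_const _).const_mul _))
    (fun n => Eventually.of_forall fun w => by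
      rw [norm_mul]
      exact mul_le_mul_of_nonneg_left (norm_phi0_term_le hC (hc n) (hb _) _ _) (norm_nonneg _))
    (Eventually.of_forall fun w => hS.mul_left _)
    (by
      simp only [tsum_mul_left]
      exact (hKm.integrable one_le_two).norm.mul_const _)
    (hmem.mono fun w hw => (hF.hasSum_phi0 hC hc hsum hg hsπ hw w.2 j).mul_left _)
  have e : ∀ n, ∫ w, K x w.1 i w.2 * (1 / (normalizingNumber φ h₂ (ev n) : ℂ) *
      (phi0 w.1 (ev n) w.2 * phi0Transform g j (ev n))) ∂(twoMeasure x) =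
      1 / (normalizingNumber φ h₂ (ev n) : ℂ) * (φ x (ev n) i * phi0Transform g j (ev n)) -
      1 / (normalizingNumber φ h₂ (ev n) : ℂ) * (phi0 x (ev n) i * phi0Transform g j (ev n)) := by
    intro n
    have e1 : ∀ w : ℝ × Fin 2, K x w.1 i w.2 * (1 / (normalizingNumber φ h₂ (ev n) : ℂ) *
        (phi0 w.1 (ev n) w.2 * phi0Transform g j (ev n))) =
        (1 / (normalizingNumber φ h₂ (ev n) : ℂ) * phi0Transform g j (ev n)) *
          (K x w.1 i w.2 * phi0 w.1 (ev n) w.2) := fun w => by ring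
    simp only [e1]
    rw [integral_const_mul, hK.apply hxI]
    ring
  simp only [e] at h1
  have hgx : g x = 0 := image_eq_zero_of_notMem_tsupport fun h => (hs h).2.false
  have h2 := (hev.hasSum_phi_eq_zero hp hq hφ hh₂ hC hc hsum hx hg hs i j).sub
    (hF.hasSum_phi0 hC hc hsum hg hsπ hxI i j)
  -- The sum over `φ` vanishes by causality, and the diagonal term at `x` vanishes because `x` lies
  -- outside the support of `g`.
  rw [hgx, ite_self, add_zero, zero_sub] at h2
  exact h1.unique h2

/-- From `|a| ≤ 1 + |a|²`, the `L¹` norm of each `F(ξ, ·)` is at most `π + C`, uniformly in `ξ`. So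
Tonelli's theorem applies with `κ` merely integrable. -/
theorem IsSpectralKernel.integrable_mul_prod (hF : IsSpectralKernel φ h₂ ev F)
    (hFC : ∀ ξ ∈ Icc 0 π, ∀ i j, ∫ t in Ioo 0 π, ‖F ξ t i j‖ ^ 2 ≤ C) (hx : x ≤ π) {κ : ℝ → ℂ}
    (hκ : Integrable κ (volume.restrict (Ioo 0 x))) (a j : Fin 2) :
    Integrable (fun z : ℝ × ℝ => κ z.1 * F z.1 z.2 a j)
      ((volume.restrict (Ioo 0 x)).prod (volume.restrict (Ioo 0 x))) := by
  have hsub : Ioo 0 x ⊆ Ioo 0 π := Ioo_subset_Ioo_right hx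
  have hle : volume.restrict (Ioo 0 x) ≤ volume.restrict (Ioo 0 π) :=
    Measure.restrict_mono hsub le_rfl
  have hFm : AEStronglyMeasurable (fun z : ℝ × ℝ => F z.1 z.2 a j)
      ((volume.restrict (Ioo 0 x)).prod (volume.restrict (Ioo 0 x))) := by
    rw [Measure.prod_restrict, ← Measure.volume_eq_prod]
    exact (hF.1 a j).mono_measure (Measure.restrict_mono (prod_mono hsub hsub) le_rfl)
  have hm : AEStronglyMeasurable (fun z : ℝ × ℝ => κ z.1 * F z.1 z.2 a j)
      ((volume.restrict (Ioo 0 x)).prod (volume.restrict (Ioo 0 x))) := hκ.1.comp_fst.mul hFm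
  have hmemI : ∀ ξ ∈ Ioo 0 x, ξ ∈ Icc 0 π := fun ξ hξ => Ioo_subset_Icc_self (hsub hξ)
  have hFi : ∀ ξ ∈ Ioo 0 x, Integrable (fun t => F ξ t a j) (volume.restrict (Ioo 0 π)) :=
    fun ξ hξ => (hF.2 ξ (hmemI ξ hξ) a j).1.integrable one_le_two
  rw [integrable_prod_iff hm]
  refine ⟨(ae_restrict_mem measurableSet_Ioo).mono fun ξ hξ =>
    ((hFi ξ hξ).mono_measure hle).const_mul (κ ξ), ?_⟩
  refine (hκ.norm.mul_const (π + C)).mono' hm.norm.integral_prod_right' ?_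
  filter_upwards [ae_restrict_mem measurableSet_Ioo] with ξ hξ
  rw [Real.norm_eq_abs, abs_of_nonneg (integral_nonneg fun _ => norm_nonneg _)]
  simp only [norm_mul]
  rw [integral_const_mul]
  refine mul_le_mul_of_nonneg_left ?_ (norm_nonneg _)
  have hsq : Integrable (fun t => ‖F ξ t a j‖ ^ 2) (volume.restrict (Ioo 0 π)) :=
    (memLp_two_iff_integrable_sq_norm (hF.2 ξ (hmemI ξ hξ) a j).1.1).1 (hF.2 ξ (hmemI ξ hξ) a j).1
  have h1 : Integrable (fun _ : ℝ => (1 : ℝ)) (volume.restrict (Ioo 0 π)) := integrable_const _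
  calc ∫ t in Ioo 0 x, ‖F ξ t a j‖ ≤ ∫ t in Ioo 0 π, ‖F ξ t a j‖ :=
        integral_mono_measure hle (Eventually.of_forall fun _ => norm_nonneg _) (hFi ξ hξ).norm
    _ ≤ ∫ t in Ioo 0 π, (1 + ‖F ξ t a j‖ ^ 2) :=
        integral_mono (hFi ξ hξ).norm (h1.add hsq) fun t => by
          change ‖F ξ t a j‖ ≤ 1 + ‖F ξ t a j‖ ^ 2
          nlinarith [sq_nonneg (‖F ξ t a j‖ - 1)]
    _ ≤ π + C := by
        rw [integral_add h1 hsq]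
        refine add_le_add (le_of_eq ?_) (hFC ξ (hmemI ξ hξ) a j)
        simp [Real.pi_pos.le]

theorem setIntegral_Ioo_eq_of_tsupport_subset (hx : x ≤ π) (hs : tsupport g ⊆ Ioo 0 x)
    (f : ℝ → ℂ) : ∫ t in (0 : ℝ)..π, f t * g t = ∫ t in Ioo 0 x, f t * g t := by
  rw [intervalIntegral_pi_eq _ Real.pi_pos.le]
  exact setIntegral_eq_of_subset_of_forall_sdiff_eq_zero measurableSet_Ioo
    (Ioo_subset_Ioo_right hx) fun t ht => by
      rw [image_eq_zero_of_notMem_tsupport fun h => ht.2 (hs h), mul_zero]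

/-- The left-hand side of the main equation is orthogonal to smooth functions. -/
theorem IsSpectralKernel.integral_mul_eq_zero (hp : MemLp p 2 (volume.restrict (Ioo 0 π)))
    (hq : MemLp q 2 (volume.restrict (Ioo 0 π))) (hφ : IsPhi p q φ) (hh₂ : 0 < h₂)
    (hev : IsEigenvalueEnumeration p q h₁ h₂ ev)
    (hF : IsSpectralKernel φ h₂ ev F) (hK : IsTransformationKernel φ K) (hC : 0 ≤ C)
    (hc : ∀ n, |1 / normalizingNumber φ h₂ (ev n)| ≤ C)
    (hsum : Summable fun n => 1 / (1 + ev n ^ 2))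
    {CF : ℝ} (hFC : ∀ ξ ∈ Icc 0 π, ∀ i j, ∫ t in Ioo 0 π, ‖F ξ t i j‖ ^ 2 ≤ CF)
    (hx : x ∈ Ioc 0 π) (hg : ContDiff ℝ 2 g)
    (hgc : HasCompactSupport g) (hs : tsupport g ⊆ Ioo 0 x) (i j : Fin 2) :
    ∫ t in Ioo 0 x, (F x t i j + K x t i j + ((∫ ξ in Ioo 0 x, K x ξ i 0 * F ξ t 0 j) +
      ∫ ξ in Ioo 0 x, K x ξ i 1 * F ξ t 1 j)) * g t = 0 := by
  have hxI : x ∈ Icc 0 π := Ioc_subset_Icc_self hx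
  obtain ⟨M, hM⟩ := hgc.exists_bound_of_continuous hg.continuous
  set μ := volume.restrict (Ioo 0 x) with hμ
  have hbdd : ∀ {f : ℝ → ℂ}, Integrable f μ → Integrable (fun t => f t * g t) μ := fun hf =>
    hf.mul_bdd (c := M) hg.continuous.aestronglyMeasurable (Eventually.of_forall hM)
  have hKi : ∀ a, Integrable (fun t => K x t i a) μ := fun a =>
    ((hK x hxI).1 i a).integrable one_le_two
  have hFi : Integrable (fun t => F x t i j) μ :=
    ((hF.2 x hxI i j).1.integrable one_le_two).mono_measure
      (Measure.restrict_mono (Ioo_subset_Ioo_right hx.2) le_rfl)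
  have hP : ∀ a, Integrable (fun z : ℝ × ℝ => K x z.1 i a * F z.1 z.2 a j) (μ.prod μ) :=
    fun a => hF.integrable_mul_prod hFC hx.2 (hKi a) a j
  have hPg : ∀ a, Integrable (fun z : ℝ × ℝ => K x z.1 i a * F z.1 z.2 a j * g z.2) (μ.prod μ) :=
    fun a => (hP a).mul_bdd (c := M) (hg.continuous.comp continuous_snd).aestronglyMeasurable
      (Eventually.of_forall fun z => hM z.2)
  have hPt : ∀ a, Integrable (fun t => ∫ ξ, K x ξ i a * F ξ t a j ∂μ) μ := fun a =>
    (hP a).integral_prod_right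
  have hL : ∀ a, Integrable (fun ξ => K x ξ i a * ∫ t, F ξ t a j * g t ∂μ) μ := fun a => by
    refine (hPg a).integral_prod_left.congr (Eventually.of_forall fun ξ => ?_)
    simp only [mul_assoc]
    rw [integral_const_mul]
  have hswap : ∀ a, ∫ ξ, K x ξ i a * ∫ t, F ξ t a j * g t ∂μ ∂μ =
      ∫ t, (∫ ξ, K x ξ i a * F ξ t a j ∂μ) * g t ∂μ := fun a => by
    have h := integral_integral_swap (f := fun ξ t => K x ξ i a * F ξ t a j * g t) (hPg a)
    simp only [integral_mul_const] at h
    rw [← h]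
    simp only [mul_assoc, integral_const_mul]
  have hKδ : ∀ a, Integrable (fun t => K x t i a * if a = j then g t else 0) μ := fun a => by
    by_cases h : a = j
    · simpa [h] using hbdd (hKi j)
    · simp [h]
  have main := hF.integral_twoMeasure_eq hp hq hφ hh₂ hev hK hC hc hsum hx hg hs i j
  simp only [setIntegral_Ioo_eq_of_tsupport_subset hx.2 hs] at main
  have hLδ : ∀ a, Integrable (fun ξ => K x ξ i a * ((∫ t, F ξ t a j * g t ∂μ) +
      if a = j then g ξ else 0)) μ := fun a => by
    simp only [mul_add]
    exact (hL a).add (hKδ a)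
  have hsplit : ∀ a, ∫ ξ, K x ξ i a * ((∫ t, F ξ t a j * g t ∂μ) +
      if a = j then g ξ else 0) ∂μ = (∫ t, (∫ ξ, K x ξ i a * F ξ t a j ∂μ) * g t ∂μ) +
        ∫ t, K x t i a * (if a = j then g t else 0) ∂μ := fun a => by
    simp only [mul_add]
    rw [integral_add (hL a) (hKδ a), hswap]
  have hδ : (∫ t, K x t i 0 * (if (0 : Fin 2) = j then g t else 0) ∂μ) +
      ∫ t, K x t i 1 * (if (1 : Fin 2) = j then g t else 0) ∂μ = ∫ t, K x t i j * g t ∂μ := by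
    fin_cases j <;> simp
  rw [twoMeasure, integral_pairMeasure (integrable_pairMeasure.2 ⟨hLδ 0, hLδ 1⟩)] at main
  have main' := hsplit 0 ▸ hsplit 1 ▸ main
  simp only [add_mul]
  have i1 := hbdd hFi
  have i2 := hbdd (hKi j)
  have i3 := hbdd (hPt 0)
  have i4 := hbdd (hPt 1)
  have i12 : Integrable (fun t => F x t i j * g t + K x t i j * g t) μ := i1.add i2
  have i34 : Integrable (fun t => (∫ ξ, K x ξ i 0 * F ξ t 0 j ∂μ) * g t +
    (∫ ξ, K x ξ i 1 * F ξ t 1 j ∂μ) * g t) μ := i3.add i4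
  rw [integral_add i12 i34, integral_add i1 i2, integral_add i3 i4]
  linear_combination main' - hδ

/-- Each of the four entries of the left side is locally integrable and orthogonal to all smooth
functions compactly supported in `(0, x)`, so it vanishes almost everywhere. Fubini's theorem
supplies the integrability in `ξ` for almost every `t`. -/
theorem IsSpectralKernel.ae_mainEquation (hp : MemLp p 2 (volume.restrict (Ioo 0 π)))
    (hq : MemLp q 2 (volume.restrict (Ioo 0 π))) (hφ : IsPhi p q φ) (hh₂ : 0 < h₂)
    (hev : IsEigenvalueEnumeration p q h₁ h₂ ev)
    (hF : IsSpectralKernel φ h₂ ev F) (hK : IsTransformationKernel φ K) (hx : x ∈ Ioc 0 π) :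
    ∀ᵐ t ∂(volume.restrict (Ioo 0 x)), MainEquation F K x t := by
  obtain ⟨k, k', hshift⟩ := hev.exists_shift hp hq hφ
  have hnorm := summable_sq_one_div_normalizingNumber_sub hp hq hφ hh₂ hshift
  obtain ⟨C, hC, hc⟩ := exists_abs_le_of_summable_sub_sq hnorm
  obtain ⟨CF, -, hFC⟩ := hF.exists_bound hshift hnorm
  have hsum := summable_one_div_one_add_sq_of_shift hshift
  have hxI : x ∈ Icc 0 π := Ioc_subset_Icc_self hx
  set μ := volume.restrict (Ioo 0 x) with hμ
  have hKi : ∀ i a, Integrable (fun t => K x t i a) μ := fun i a =>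
    ((hK x hxI).1 i a).integrable one_le_two
  have hFi : ∀ i j, Integrable (fun t => F x t i j) μ := fun i j =>
    ((hF.2 x hxI i j).1.integrable one_le_two).mono_measure
      (Measure.restrict_mono (Ioo_subset_Ioo_right hx.2) le_rfl)
  have hP : ∀ i a j, Integrable (fun z : ℝ × ℝ => K x z.1 i a * F z.1 z.2 a j) (μ.prod μ) :=
    fun i a j => hF.integrable_mul_prod hFC hx.2 (hKi i a) a j
  have hE : ∀ i j, ∀ᵐ t ∂μ, F x t i j + K x t i j + ((∫ ξ in Ioo 0 x, K x ξ i 0 * F ξ t 0 j) +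
      ∫ ξ in Ioo 0 x, K x ξ i 1 * F ξ t 1 j) = 0 := by
    intro i j
    have hint : IntegrableOn (fun t => F x t i j + K x t i j +
        ((∫ ξ in Ioo 0 x, K x ξ i 0 * F ξ t 0 j) +
          ∫ ξ in Ioo 0 x, K x ξ i 1 * F ξ t 1 j)) (Ioo 0 x) :=
      ((hFi i j).add (hKi i j)).add
        ((hP i 0 j).integral_prod_right.add (hP i 1 j).integral_prod_right)
    have h0 := isOpen_Ioo.ae_eq_zero_of_integral_contDiff_smul_eq_zero hint.locallyIntegrableOn
      fun g hg hgc hs => ?_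
    · exact (ae_restrict_iff' measurableSet_Ioo).2 h0
    · have hg' : ContDiff ℝ 2 fun t => (g t : ℂ) :=
        Complex.ofRealCLM.contDiff.comp (contDiff_infty.1 hg 2)
      have hsupp : tsupport (fun t => (g t : ℂ)) ⊆ tsupport g :=
        tsupport_comp_subset (g := fun r : ℝ => (r : ℂ)) Complex.ofReal_zero g
      have h := hF.integral_mul_eq_zero hp hq hφ hh₂ hev hK hC hc hsum hFC hx hg'
        (hgc.comp_left (g := fun r : ℝ => (r : ℂ)) Complex.ofReal_zero) (hsupp.trans hs) i j
      rw [setIntegral_eq_integral_of_forall_compl_eq_zero fun t ht => by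
        rw [image_eq_zero_of_notMem_tsupport fun h => ht (hs h), Complex.ofReal_zero,
          mul_zero]] at h
      rw [← h]
      refine integral_congr_ae (Eventually.of_forall fun t => ?_)
      simp only [Complex.real_smul]
      ring
  have hE' := ae_all_iff.2 fun i => ae_all_iff.2 fun j => hE i j
  have hP' := ae_all_iff.2 fun i => ae_all_iff.2 fun a => ae_all_iff.2 fun j =>
    (hP i a j).prod_left_ae
  filter_upwards [hE', hP'] with t ht hPt
  have emul : ∀ ξ i j, (K x ξ * F ξ t) i j = K x ξ i 0 * F ξ t 0 j + K x ξ i 1 * F ξ t 1 j :=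
    fun ξ i j => by rw [Matrix.mul_apply, Fin.sum_univ_two]
  refine ⟨fun i j => ?_, ?_⟩
  · rw [intervalIntegrable_iff_integrableOn_Ioo_of_le hx.1.le]
    simp only [emul]
    exact (hPt i 0 j).add (hPt i 1 j)
  · ext i j
    simp only [Matrix.add_apply, Matrix.of_apply, Matrix.zero_apply, emul]
    rw [intervalIntegral_pi_eq _ hx.1.le, integral_add (hPt i 0 j) (hPt i 1 j)]
    exact ht i j

end DiracBVP
theorem mainTheorem5 (p q : ℝ → ℝ)
    (hp : MemLp p 2 (volume.restrict (Ioo 0 π)))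
    (hq : MemLp q 2 (volume.restrict (Ioo 0 π)))
    (h₁ h₂ : ℝ) (hh₂ : 0 < h₂) :
    (∃ φ, DiracBVP.IsPhi p q φ) ∧
    (∃ ev, DiracBVP.IsEigenvalueEnumeration p q h₁ h₂ ev) ∧
    ∀ φ, DiracBVP.IsPhi p q φ →
      (∃ K, DiracBVP.IsTransformationKernel φ K) ∧
      ∀ ev, DiracBVP.IsEigenvalueEnumeration p q h₁ h₂ ev →
        (∃ F, DiracBVP.IsSpectralKernel φ h₂ ev F) ∧
        ∀ F, DiracBVP.IsSpectralKernel φ h₂ ev F →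
          ∀ K, DiracBVP.IsTransformationKernel φ K →
            ∀ x ∈ Ioc 0 π, ∀ᵐ t ∂(volume.restrict (Ioo 0 x)),
              DiracBVP.MainEquation F K x t := by
  refine ⟨DiracBVP.exists_isPhi hp hq, DiracBVP.exists_isEigenvalueEnumeration hp hq h₁ hh₂,
    fun φ hφ => ⟨hφ.exists_transformationKernel hp hq, fun ev hev => ⟨?_, fun F hF K hK x hx =>
      hF.ae_mainEquation hp hq hφ hh₂ hev hK hx⟩⟩⟩
  obtain ⟨k, k', hshift⟩ := hev.exists_shift hp hq hφ
  exact DiracBVP.exists_isSpectralKernel hshift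
    (DiracBVP.summable_sq_one_div_normalizingNumber_sub hp hq hφ hh₂ hshift)
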